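/- Let $\bar n_S>0$, $\bar n_B>0$, $0<\theta<1$ and $q(k;\bar n)=\bar n^k/(1+\bar n)^{k+1}$. Let $|\psi\rangle_{IS}=\sum_k\sqrt{q(k;\bar n_S)}\,|k\rangle_I|k\rangle_S$ be the two-mode squeezed vacuum (TMSV). Let $\mathcal E^{\theta}_{S\to R}$ be the single-mode lossy thermal-noise bosonic channel: a beam splitter of transmittance $\theta$, with input–output relation $\hat b=\sqrt\theta\,\hat a+\sqrt{1-\theta}\,\hat e$, whose environment mode $\hat e$ is in the thermal state $\sum_k q(k;\bar n_T)|k\rangle\langle k|$ with $\bar n_T=\bar n_B/(1-\theta)$ and is traced out at the output. Let $\hat\sigma(\theta)=(\mathcal I_I\otimes\mathcal E^{\theta}_{S\to R})(|\psi\rangle\langle\psi|)$ be the output state on the modes $R$ and $I$, and write $|km\rangle=|k\rangle_R|m\rangle_I$ for the Fock states. For real $\omega$ let $\hat S(\omega)=\exp\big(\omega(\hat a_R\hat a_I-\hat a_R^\dagger\hat a_I^\dagger)\big)$ be the two-mode squeezing operator, i.e. the unique unitary that is the time-one value of a strongly continuous one-parameter unitary group whose generator extends $\omega(\hat a_R\hat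 a_I-\hat a_R^\dagger\hat a_I^\dagger)$ from the finite linear combinations of Fock states (it exists). A symmetric logarithmic derivative (SLD) of $\hat\sigma$ at $\theta$ is a self-adjoint operator $\hat\Lambda_\theta$, in general unbounded, with $\frac{d\hat\sigma}{d\theta}=\frac12(\hat\Lambda_\theta\hat\sigma+\hat\sigma\hat\Lambda_\theta)$, the derivative being taken in operator norm and $\hat\Lambda_\theta\hat\sigma$ being everywhere defined and bounded. Put $$a=\bar n_B^2+(1+\bar n_S(1-\theta))^2+2\bar n_B(1+\bar n_S+\theta\bar n_S),$$ $$\mu=\sqrt{\tfrac{1+\bar n_B+\bar n_S+\theta\bar n_S}{2\sqrt a}+\tfrac12},\qquad \nu=\sqrt{\tfrac{1+\bar n_B+\bar n_S+\theta\bar n_S}{2\sqrt a}-\tfrac12},\qquad \zeta=\log(\mu+\nu)$$ (so that $\cosh\zeta=\mu$ and $\sinh\zeta=\nu$), $$N_1=\tfrac12\big(\sqrt a+\bar n_B-1-\bar n_S(1-\theta)\big),\qquad N_2=\tfrac12\big(\sqrt a-\bar n_B-1+\bar n_S(1-\theta)\big),$$ $$C=\mu^2\frac{\bar n_B-N_1}{N_1(1+N_1)},\quad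 D=\nu^2\frac{\bar n_B+1+N_2}{N_2(1+N_2)},\quad E=\mu\nu\,\frac{N_1-N_2-2\bar n_B-1}{2N_1N_2+N_1+N_2+1},$$ $$F=\mu^2\frac{N_1-\bar n_B}{1+N_1}-\nu^2\frac{\bar n_B+1+N_2}{1+N_2},$$ and let $\hat K$ be the closure of $C\hat a_R^\dagger\hat a_R+D\hat a_I^\dagger\hat a_I+E(\hat a_I^\dagger\hat a_R^\dagger+\hat a_R\hat a_I)+F\hat I$ defined on the finite linear combinations of Fock states. Then: 1. $\hat\sigma$ has exactly one SLD at $\theta$, namely $\hat\Lambda_\theta=-\frac1\theta\,\hat S^\dagger(\zeta)\,\hat K\,\hat S(\zeta)$. 2. Suppose $(C+D)^2>4E^2$, and put $$T_1=\tfrac12\big(\sqrt{(C+D)^2-4E^2}+C-D\big),\qquad T_2=\tfrac12\big(\sqrt{(C+D)^2-4E^2}-C+D\big),$$ $$\lambda=\tfrac12\log\frac{2E+|C+D|}{\sqrt{(C+D)^2-4E^2}},\qquad F'=F-(T_1+T_2)\sinh^2\lambda,\qquad \omega=\lambda-\zeta.$$ Then for all $k,m\ge0$ the two-mode squeezed Fock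 state $\hat S(\omega)|km\rangle$ lies in the domain of $\hat\Lambda_\theta$ and is an eigenvector with eigenvalue $-\frac1\theta(F'+T_1k+T_2m)$. 3. Under the assumption of 2, the measurement $\{|s_{km}\rangle\langle s_{km}|\}$ with $|s_{km}\rangle=\hat S(\omega)|km\rangle$ and $\omega$ fixed at its value for $\theta$ (a two-mode squeezer followed by photon-number-resolving counting of both modes) achieves the quantum Cramér–Rao bound at $\theta$: the $|s_{km}\rangle$ form an orthonormal basis, the outcome probabilities $p(k,m;t)=\langle s_{km}|\hat\sigma(t)|s_{km}\rangle$ are differentiable in $t$ at $t=\theta$, and their classical Fisher information $\sum_{k,m}p(k,m;\theta)\,\big(\partial_t\log p(k,m;t)|_{t=\theta}\big)^2$ equals the quantum Fisher information $\mathrm{Tr}(\hat\Lambda_\theta^2\hat\sigma(\theta))$, which is positive and finite. -/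

import Mathlib

open scoped InnerProductSpace

namespace TMSV

noncomputable section

/-! ### Two-mode Fock space -/

/-- The Hilbert space of two bosonic modes, `ℓ²(ℕ × ℕ)`.  For the pair returned probe / idler,
the first index counts the photons of the mode `R` and the second those of the mode `I`. -/
abbrev Fock : Type := lp (fun _ : ℕ × ℕ => ℂ) 2

/-- The Hilbert basis of the Fock states `|k m⟩`. -/
def fock : HilbertBasis (ℕ × ℕ) ℂ Fock := HilbertBasis.ofRepr (LinearIsometryEquiv.refl ℂ _)

/-- Finite linear combinations of Fock states, the common invariant domain of all polynomials
in the creation and annihilation operators. -/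
abbrev FinFock : Type := (ℕ × ℕ) →₀ ℂ

/-- The inclusion of the finite linear combinations of Fock states in the Fock space. -/
def incl : FinFock →ₗ[ℂ] Fock := Finsupp.linearCombination ℂ (fun x => fock x)

theorem incl_injective : Function.Injective incl :=
  fock.orthonormal.linearIndependent

/-- Annihilation operator of the first mode: `a |k m⟩ = √k |k-1, m⟩`. -/
def ann₁ : Module.End ℂ FinFock :=
  Finsupp.linearCombination ℂ
    (fun x : ℕ × ℕ => Finsupp.single (x.1 - 1, x.2) ((Real.sqrt x.1 : ℝ) : ℂ))

/-- Creation operator of the first mode: `a† |k m⟩ = √(k+1) |k+1, m⟩`. -/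
def cre₁ : Module.End ℂ FinFock :=
  Finsupp.linearCombination ℂ
    (fun x : ℕ × ℕ => Finsupp.single (x.1 + 1, x.2) ((Real.sqrt (x.1 + 1) : ℝ) : ℂ))

/-- Annihilation operator of the second mode. -/
def ann₂ : Module.End ℂ FinFock :=
  Finsupp.linearCombination ℂ
    (fun x : ℕ × ℕ => Finsupp.single (x.1, x.2 - 1) ((Real.sqrt x.2 : ℝ) : ℂ))

/-- Creation operator of the second mode. -/
def cre₂ : Module.End ℂ FinFock :=
  Finsupp.linearCombination ℂ
    (fun x : ℕ × ℕ => Finsupp.single (x.1, x.2 + 1) ((Real.sqrt (x.2 + 1) : ℝ) : ℂ))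

/-- An operator on finite linear combinations of Fock states, seen as a densely defined operator
on the Fock space. -/
def toPMap (X : Module.End ℂ FinFock) : Fock →ₗ.[ℂ] Fock where
  domain := LinearMap.range incl
  toFun := (incl ∘ₗ X) ∘ₗ (LinearEquiv.ofInjective incl incl_injective).symm.toLinearMap

/-- The operator `S† A S`, with domain `{φ | S φ ∈ dom A}`. -/
def conjugate (S : Fock →L[ℂ] Fock) (A : Fock →ₗ.[ℂ] Fock) : Fock →ₗ.[ℂ] Fock where
  domain := A.domain.comap (S : Fock →ₗ[ℂ] Fock)
  toFun := ((star S : Fock →L[ℂ] Fock) : Fock →ₗ[ℂ] Fock) ∘ₗ A.toFun ∘ₗ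
    ((S : Fock →ₗ[ℂ] Fock).restrict (fun _ h => h :
      ∀ φ ∈ A.domain.comap (S : Fock →ₗ[ℂ] Fock), (S : Fock →ₗ[ℂ] Fock) φ ∈ A.domain))

/-! ### Two-mode squeezer -/

/-- `S` is the unitary exponential `exp X` of the skew-symmetric operator `X`: it is the value at
time `1` of a strongly continuous one-parameter unitary group whose generator extends `X`. -/
def IsUnitaryExp (X : Module.End ℂ FinFock) (S : Fock →L[ℂ] Fock) : Prop :=
  ∃ U : ℝ → Fock →L[ℂ] Fock,
    (∀ t, U t ∈ unitary (Fock →L[ℂ] Fock)) ∧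
    U 0 = 1 ∧ (∀ s t, U (s + t) = U s * U t) ∧
    (∀ φ : Fock, Continuous fun t => U t φ) ∧
    (∀ v : FinFock, HasDerivAt (fun t => U t (incl v)) (incl (X v)) 0) ∧
    U 1 = S

/-- `S = exp (ω* a_R a_I - ω a_R† a_I†)`. -/
def IsTwoModeSqueezer (ω : ℂ) (S : Fock →L[ℂ] Fock) : Prop :=
  IsUnitaryExp ((starRingEnd ℂ) ω • (ann₁ * ann₂) - ω • (cre₁ * cre₂)) S

/-- The two-mode squeezer `S(ω)`.  The theorem asserts that for real `ω` exactly one operator has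
the defining property, so that the choice is no choice. -/
def squeezer (ω : ℝ) : Fock →L[ℂ] Fock :=
  Classical.epsilon (IsTwoModeSqueezer (ω : ℂ))

/-! ### Lossy thermal-noise channel and output state -/

/-- Bose-Einstein (thermal) photon-number distribution with mean `n`. -/
def boseEinstein (k : ℕ) (n : ℝ) : ℝ := n ^ k / (1 + n) ^ (k + 1)

/-- The image of the Fock state `|n⟩|e⟩` (signal, environment) under the beam splitter of
transmittance `θ`, whose input-output relation is `b = √θ a + √(1-θ) e`:
`(n! e!)^(-1/2) (√θ a† - √(1-θ) e†)^n (√(1-θ) a† + √θ e†)^e |0 0⟩`. -/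
def beamSplitter (θ : ℝ) (n e : ℕ) : FinFock :=
  (((Real.sqrt (n.factorial * e.factorial))⁻¹ : ℝ) : ℂ) •
    (((Real.sqrt θ : ℂ) • cre₁ - (Real.sqrt (1 - θ) : ℂ) • cre₂) ^ n *
      ((Real.sqrt (1 - θ) : ℂ) • cre₁ + (Real.sqrt θ : ℂ) • cre₂) ^ e)
    (Finsupp.single (0, 0) 1)

/-- The matrix element `⟨r| 𝓔(|n⟩⟨n'|) |r'⟩` of the single-mode channel `𝓔`: the signal is mixed on
a beam splitter of transmittance `θ` with an environment mode in the thermal state with mean photon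
number `nT`, and the environment output is traced out. -/
def channelMatrix (nT θ : ℝ) (n n' r r' : ℕ) : ℂ :=
  ∑' e : ℕ, (boseEinstein e nT : ℂ) *
    ∑' l : ℕ, beamSplitter θ n e (r, l) * (starRingEnd ℂ) (beamSplitter θ n' e (r', l))

/-- Fock amplitudes `⟨n|_S ⟨m|_I |ψ⟩` of the two-mode squeezed vacuum with mean photon number `nS`
per mode. -/
def tmsv (nS : ℝ) (n m : ℕ) : ℂ :=
  if n = m then ((Real.sqrt (boseEinstein m nS) : ℝ) : ℂ) else 0

/-- Matrix elements `⟨r m| σ |r' m'⟩` (returned probe, idler) of the output state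
`σ = (𝓘_I ⊗ 𝓔_{S → R}) (|ψ⟩⟨ψ|)` for the environment photon number `nB / (1 - θ)`. -/
def outputMatrix (nS nB θ : ℝ) (x y : ℕ × ℕ) : ℂ :=
  ∑' n : ℕ, ∑' n' : ℕ, tmsv nS n x.2 * (starRingEnd ℂ) (tmsv nS n' y.2) *
    channelMatrix (nB / (1 - θ)) θ n n' x.1 y.1

/-- `σ` is the bounded operator with the matrix elements of the output state. -/
def IsOutputState (nS nB θ : ℝ) (σ : Fock →L[ℂ] Fock) : Prop :=
  ∀ x y : ℕ × ℕ, ⟪fock x, σ (fock y)⟫_ℂ = outputMatrix nS nB θ x y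

/-- The output state `σ_{IR}(θ)`.  At most one bounded operator has given matrix elements; the
theorem asserts that there is one. -/
def outputState (nS nB θ : ℝ) : Fock →L[ℂ] Fock :=
  Classical.epsilon (IsOutputState nS nB θ)

/-! ### Quantum estimation -/

/-- `Λ` is a symmetric logarithmic derivative at `θ` of the family of states `σ`: `Λ` is
self-adjoint and `dσ/dθ = (Λ σ + σ Λ) / 2`.  Here `Λ σ` is the everywhere defined bounded operator
`L`, and the (densely defined) operator `σ Λ` has the bounded extension `L†`. -/
structure IsSLD (σ : ℝ → Fock →L[ℂ] Fock) (θ : ℝ) (Λ : Fock →ₗ.[ℂ] Fock) : Prop where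
  selfAdjoint : IsSelfAdjoint Λ
  equation : ∃ L : Fock →L[ℂ] Fock,
    (∀ φ : Fock, ∃ h : σ θ φ ∈ Λ.domain, Λ ⟨σ θ φ, h⟩ = L φ) ∧
    HasDerivAt σ ((1 / 2 : ℂ) • (L + star L)) θ

/-- `J = Tr (Λ² ρ)`, where `Λ² ρ` is an everywhere defined bounded operator `M` whose trace
converges to `J` in every orthonormal basis. -/
def IsQuantumFisherInfo (ρ : Fock →L[ℂ] Fock) (Λ : Fock →ₗ.[ℂ] Fock) (J : ℝ) : Prop :=
  ∃ M : Fock →L[ℂ] Fock,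
    (∀ φ : Fock, ∃ h : ρ φ ∈ Λ.domain, ∃ h' : Λ ⟨ρ φ, h⟩ ∈ Λ.domain,
      Λ ⟨Λ ⟨ρ φ, h⟩, h'⟩ = M φ) ∧
    ∀ b : HilbertBasis (ℕ × ℕ) ℂ Fock, HasSum (fun x => ⟪b x, M (b x)⟫_ℂ) (J : ℂ)

/-- Probability `p(x; θ) = ⟨s_x| σ(θ) |s_x⟩` of the outcome `x`. -/
def outcomeProb (σ : ℝ → Fock →L[ℂ] Fock) (s : ℕ × ℕ → Fock) (x : ℕ × ℕ) (θ : ℝ) : ℝ :=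
  (⟪s x, σ θ (s x)⟫_ℂ).re

/-- The measurement `{|s_x⟩⟨s_x|}` (with `s` not depending on the parameter of `σ`) achieves the
quantum Cramér-Rao bound at `θ`: the classical Fisher information
`∑ x, p(x; θ) (∂ log p(x; θ) / ∂θ)²` of its outcome equals the quantum Fisher information
`Tr (Λ² σ(θ))`, and this number is positive. -/
structure AchievesQuantumCRB (σ : ℝ → Fock →L[ℂ] Fock) (θ : ℝ) (Λ : Fock →ₗ.[ℂ] Fock)
    (s : ℕ × ℕ → Fock) : Prop where
  isBasis : ∃ b : HilbertBasis (ℕ × ℕ) ℂ Fock, ∀ x, b x = s x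
  differentiable : ∀ x, DifferentiableAt ℝ (outcomeProb σ s x) θ
  fisher_eq : ∃ J : ℝ, 0 < J ∧ IsQuantumFisherInfo (σ θ) Λ J ∧
    HasSum (fun x => outcomeProb σ s x θ *
      (deriv (fun t => Real.log (outcomeProb σ s x t)) θ) ^ 2) J

/-! ### The explicit scalars -/

def a (nS nB θ : ℝ) : ℝ :=
  nB ^ 2 + (1 + nS * (1 - θ)) ^ 2 + 2 * nB * (1 + nS + θ * nS)

def μ (nS nB θ : ℝ) : ℝ :=
  Real.sqrt ((1 + nB + nS + θ * nS) / (2 * Real.sqrt (a nS nB θ)) + 1 / 2)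

def ν (nS nB θ : ℝ) : ℝ :=
  Real.sqrt ((1 + nB + nS + θ * nS) / (2 * Real.sqrt (a nS nB θ)) - 1 / 2)

/-- The real number with `cosh ζ = μ` and `sinh ζ = ν`. -/
def ζ (nS nB θ : ℝ) : ℝ := Real.log (μ nS nB θ + ν nS nB θ)

def N₁ (nS nB θ : ℝ) : ℝ := (Real.sqrt (a nS nB θ) + nB - 1 - nS * (1 - θ)) / 2

def N₂ (nS nB θ : ℝ) : ℝ := (Real.sqrt (a nS nB θ) - nB - 1 + nS * (1 - θ)) / 2

def C (nS nB θ : ℝ) : ℝ :=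
  μ nS nB θ ^ 2 * ((nB - N₁ nS nB θ) / (N₁ nS nB θ * (1 + N₁ nS nB θ)))

def D (nS nB θ : ℝ) : ℝ :=
  ν nS nB θ ^ 2 * ((nB + 1 + N₂ nS nB θ) / (N₂ nS nB θ * (1 + N₂ nS nB θ)))

def E (nS nB θ : ℝ) : ℝ :=
  μ nS nB θ * ν nS nB θ * ((N₁ nS nB θ - N₂ nS nB θ - 2 * nB - 1) /
    (2 * N₁ nS nB θ * N₂ nS nB θ + N₁ nS nB θ + N₂ nS nB θ + 1))

def F (nS nB θ : ℝ) : ℝ :=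
  μ nS nB θ ^ 2 * ((N₁ nS nB θ - nB) / (1 + N₁ nS nB θ)) -
    ν nS nB θ ^ 2 * ((nB + 1 + N₂ nS nB θ) / (1 + N₂ nS nB θ))

/-- `√((C + D)² - 4 E²)` -/
def disc (nS nB θ : ℝ) : ℝ :=
  Real.sqrt ((C nS nB θ + D nS nB θ) ^ 2 - 4 * E nS nB θ ^ 2)

def T₁ (nS nB θ : ℝ) : ℝ := (disc nS nB θ + C nS nB θ - D nS nB θ) / 2

def T₂ (nS nB θ : ℝ) : ℝ := (disc nS nB θ - C nS nB θ + D nS nB θ) / 2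

def lam (nS nB θ : ℝ) : ℝ :=
  1 / 2 * Real.log ((2 * E nS nB θ + |C nS nB θ + D nS nB θ|) / disc nS nB θ)

def F' (nS nB θ : ℝ) : ℝ :=
  F nS nB θ - (T₁ nS nB θ + T₂ nS nB θ) * Real.sinh (lam nS nB θ) ^ 2

def ω (nS nB θ : ℝ) : ℝ := lam nS nB θ - ζ nS nB θ

/-- `K = C a_R† a_R + D a_I† a_I + E (a_I† a_R† + a_R a_I) + F`, on finite linear combinations of
Fock states. -/
def K (nS nB θ : ℝ) : Module.End ℂ FinFock :=
  (C nS nB θ : ℂ) • (cre₁ * ann₁) + (D nS nB θ : ℂ) • (cre₂ * ann₂) +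
    (E nS nB θ : ℂ) • (cre₂ * cre₁ + ann₁ * ann₂) + (F nS nB θ : ℂ) • 1

/-- The operator `-(1/θ) S(ζ)† K S(ζ)`, with `K` closed. -/
def sld (nS nB θ : ℝ) : Fock →ₗ.[ℂ] Fock :=
  ((-(1 / θ) : ℝ) : ℂ) • conjugate (squeezer (ζ nS nB θ)) (toPMap (K nS nB θ)).closure

/-- The two-mode squeezed Fock states `S(ω)|k m⟩`. -/
def squeezedFock (nS nB θ : ℝ) (x : ℕ × ℕ) : Fock := squeezer (ω nS nB θ) (fock x)

end

end TMSV

open scoped InnerProductSpace Topology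
open Filter

namespace TMSV

noncomputable section

/-! ### Formal ladder operators on sequences -/

/-! Every operator in play is Gaussian, and a Gaussian operator `G` is encoded by four ladder
relations `a G = s b† G + p G a`, `b G = s a† G + q G b` and their mirror images (`LadderRel`). Read
in Fock matrix elements these are recursions that fix the kernel from its vacuum entry
(`LadderRel.unique`), and their solution is the kernel `gker` of `exp (s a†b†) p^n₁ q^n₂ exp (s'
ab)`. The squeezers are built as such kernels. Tracing the thermal environment out of the beam
splitter shows that the output state is another one, with `p = nB / (1 + nB)` independent of `θ`
(`outputMatrix_eq_gker`). The gap `(1 - p) (1 - q) - s² > 0` gives rapid decay in both indices,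
locally uniformly in `θ`; hence norm differentiability, and boundedness and summability of all
products of a quadratic operator with the state.

To find the SLD, `Λ σ` for a quadratic `Λ` is written in normal order around `σ`, as a combination
of `a†b† σ`, `a† σ a`, `b† σ b`, `σ ab` and `σ`. The derivative of `σ` contains only the first,
third and fourth of these, so the SLD equation becomes a small linear system (`sldKer_add`).
Self-adjointness holds because finite combinations of Fock states are a core of the maximal
quadratic operator: a linear cutoff has a uniformly bounded commutator with it
(`closure_graph_finQuad`, `isSelfAdjoint_maxOp`). Conjugation by a squeezer acts on the coefficients
by a hyperbolic rotation (`SqueezeRel`), and `squeezeRel_ζ` identifies the solution with the stated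
operator.

For uniqueness, `S(-ζ)|k m⟩` diagonalizes `σ` with positive eigenvalues `w`, so `(w x + w y)
⟨x|Λ|y⟩` is prescribed by the derivative of `σ`; these vectors span a core, and a self-adjoint
operator has no proper self-adjoint extension (`IsSLD.eq_logDeriv`). When `(C + D)² > 4 E²`, a
further squeezing by `λ` removes the cross term of `K`, which yields the eigenvectors `S(λ - ζ)|k
m⟩`. In an eigenbasis of `Λ` the score `∂ log p` is the eigenvalue itself, so the classical Fisher
information is the trace of `Λ² σ` computed in that basis, and this trace does not depend on the
basis. -/

/-- Arbitrary sequences of Fock amplitudes. -/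
abbrev Seq : Type := ℕ × ℕ → ℂ

/-- The formal annihilation operator of the first mode. -/
def lower₁ : Module.End ℂ Seq where
  toFun f x := ((Real.sqrt (x.1 + 1) : ℝ) : ℂ) * f (x.1 + 1, x.2)
  map_add' f g := by ext x; simp [mul_add]
  map_smul' c f := by ext x; simp; ring

/-- The formal creation operator of the first mode. -/
def raise₁ : Module.End ℂ Seq where
  toFun f x := ((Real.sqrt x.1 : ℝ) : ℂ) * f (x.1 - 1, x.2)
  map_add' f g := by ext x; simp [mul_add]
  map_smul' c f := by ext x; simp; ring

/-- The formal annihilation operator of the second mode. -/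
def lower₂ : Module.End ℂ Seq where
  toFun f x := ((Real.sqrt (x.2 + 1) : ℝ) : ℂ) * f (x.1, x.2 + 1)
  map_add' f g := by ext x; simp [mul_add]
  map_smul' c f := by ext x; simp; ring

/-- The formal creation operator of the second mode. -/
def raise₂ : Module.End ℂ Seq where
  toFun f x := ((Real.sqrt x.2 : ℝ) : ℂ) * f (x.1, x.2 - 1)
  map_add' f g := by ext x; simp [mul_add]
  map_smul' c f := by ext x; simp; ring

theorem lower₁_apply (f : Seq) (r m : ℕ) :
    lower₁ f (r, m) = ((Real.sqrt (r + 1) : ℝ) : ℂ) * f (r + 1, m) := rfl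
theorem raise₁_apply (f : Seq) (r m : ℕ) :
    raise₁ f (r, m) = ((Real.sqrt r : ℝ) : ℂ) * f (r - 1, m) := rfl
theorem lower₂_apply (f : Seq) (r m : ℕ) :
    lower₂ f (r, m) = ((Real.sqrt (m + 1) : ℝ) : ℂ) * f (r, m + 1) := rfl
theorem raise₂_apply (f : Seq) (r m : ℕ) :
    raise₂ f (r, m) = ((Real.sqrt m : ℝ) : ℂ) * f (r, m - 1) := rfl

theorem sqrt_mul_self_complex (n : ℕ) :
    ((Real.sqrt n : ℝ) : ℂ) * ((Real.sqrt n : ℝ) : ℂ) = n := by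
  rw [← Complex.ofReal_mul, Real.mul_self_sqrt (Nat.cast_nonneg n)]; simp

theorem sqrt_succ_mul_self_complex (n : ℕ) :
    ((Real.sqrt (n + 1) : ℝ) : ℂ) * ((Real.sqrt (n + 1) : ℝ) : ℂ) = n + 1 := by
  rw [← Complex.ofReal_mul, Real.mul_self_sqrt (by positivity)]; simp

/-- The truncated index `r - 1` at `r = 0` is harmless since it comes with the factor `√0`. The same
convention spares all later recursions their boundary cases. -/
theorem lower₁_raise₁ (f : Seq) : lower₁ (raise₁ f) = raise₁ (lower₁ f) + f := by
  ext ⟨r, m⟩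
  simp only [lower₁_apply, raise₁_apply, Pi.add_apply]
  rcases r with _ | r
  · simp
  · have h := sqrt_succ_mul_self_complex (r + 1)
    have h' := sqrt_succ_mul_self_complex r
    push_cast at *
    linear_combination f (r + 1, m) * (h - h')

theorem lower₂_raise₂ (f : Seq) : lower₂ (raise₂ f) = raise₂ (lower₂ f) + f := by
  ext ⟨r, m⟩
  simp only [lower₂_apply, raise₂_apply, Pi.add_apply]
  rcases m with _ | m
  · simp
  · have h := sqrt_succ_mul_self_complex (m + 1)
    have h' := sqrt_succ_mul_self_complex m
    push_cast at *
    linear_combination f (r, m + 1) * (h - h')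

theorem lower₁_lower₂ (f : Seq) : lower₁ (lower₂ f) = lower₂ (lower₁ f) := by
  ext ⟨r, m⟩; simp only [lower₁_apply, lower₂_apply]; ring
theorem lower₁_raise₂ (f : Seq) : lower₁ (raise₂ f) = raise₂ (lower₁ f) := by
  ext ⟨r, m⟩; simp only [lower₁_apply, raise₂_apply]; ring
theorem lower₂_raise₁ (f : Seq) : lower₂ (raise₁ f) = raise₁ (lower₂ f) := by
  ext ⟨r, m⟩; simp only [lower₂_apply, raise₁_apply]; ring
theorem raise₁_raise₂ (f : Seq) : raise₁ (raise₂ f) = raise₂ (raise₁ f) := by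
  ext ⟨r, m⟩; simp only [raise₁_apply, raise₂_apply]; ring

/-! ### Finite combinations as sequences -/

theorem ann₁_single (x : ℕ × ℕ) (c : ℂ) : ann₁ (Finsupp.single x c) =
    Finsupp.single (x.1 - 1, x.2) (c * ((Real.sqrt x.1 : ℝ) : ℂ)) := by
  simp [ann₁]
theorem cre₁_single (x : ℕ × ℕ) (c : ℂ) : cre₁ (Finsupp.single x c) =
    Finsupp.single (x.1 + 1, x.2) (c * ((Real.sqrt (x.1 + 1) : ℝ) : ℂ)) := by
  simp [cre₁]
theorem ann₂_single (x : ℕ × ℕ) (c : ℂ) : ann₂ (Finsupp.single x c) =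
    Finsupp.single (x.1, x.2 - 1) (c * ((Real.sqrt x.2 : ℝ) : ℂ)) := by
  simp [ann₂]
theorem cre₂_single (x : ℕ × ℕ) (c : ℂ) : cre₂ (Finsupp.single x c) =
    Finsupp.single (x.1, x.2 + 1) (c * ((Real.sqrt (x.2 + 1) : ℝ) : ℂ)) := by
  simp [cre₂]

/-- With its three analogues this transports identities between formal operators on sequences to
finite combinations of Fock states. -/
theorem coe_ann₁ (v : FinFock) : (⇑(ann₁ v) : Seq) = lower₁ ⇑v := by
  induction v using Finsupp.induction_linear with
  | zero => simp
  | add v w hv hw => simp [hv, hw]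
  | single x c =>
    obtain ⟨k, n⟩ := x
    rw [ann₁_single]
    ext ⟨r, m⟩
    rw [lower₁_apply]
    rcases k with _ | k
    · simp
    · simp only [Finsupp.single_apply, Prod.mk.injEq, Nat.add_sub_cancel, Nat.add_right_cancel_iff]
      split_ifs with h
      · rw [h.1]; push_cast; ring
      · simp

theorem coe_cre₁ (v : FinFock) : (⇑(cre₁ v) : Seq) = raise₁ ⇑v := by
  induction v using Finsupp.induction_linear with
  | zero => simp
  | add v w hv hw => simp [hv, hw]
  | single x c =>
    obtain ⟨k, n⟩ := x
    rw [cre₁_single]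
    ext ⟨r, m⟩
    rw [raise₁_apply]
    rcases r with _ | r
    · simp
    · simp only [Finsupp.single_apply, Prod.mk.injEq, Nat.add_sub_cancel, Nat.add_right_cancel_iff]
      split_ifs with h
      · rw [h.1]; push_cast; ring
      · simp

theorem coe_ann₂ (v : FinFock) : (⇑(ann₂ v) : Seq) = lower₂ ⇑v := by
  induction v using Finsupp.induction_linear with
  | zero => simp
  | add v w hv hw => simp [hv, hw]
  | single x c =>
    obtain ⟨k, n⟩ := x
    rw [ann₂_single]
    ext ⟨r, m⟩
    rw [lower₂_apply]
    rcases n with _ | n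
    · simp
    · simp only [Finsupp.single_apply, Prod.mk.injEq, Nat.add_sub_cancel, Nat.add_right_cancel_iff]
      split_ifs with h
      · rw [h.2]; push_cast; ring
      · simp

theorem coe_cre₂ (v : FinFock) : (⇑(cre₂ v) : Seq) = raise₂ ⇑v := by
  induction v using Finsupp.induction_linear with
  | zero => simp
  | add v w hv hw => simp [hv, hw]
  | single x c =>
    obtain ⟨k, n⟩ := x
    rw [cre₂_single]
    ext ⟨r, m⟩
    rw [raise₂_apply]
    rcases m with _ | m
    · simp
    · simp only [Finsupp.single_apply, Prod.mk.injEq, Nat.add_sub_cancel, Nat.add_right_cancel_iff]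
      split_ifs with h
      · rw [h.2]; push_cast; ring
      · simp

theorem ann₁_cre₁ (v : FinFock) : ann₁ (cre₁ v) = cre₁ (ann₁ v) + v :=
  DFunLike.coe_injective (by simp [coe_ann₁, coe_cre₁, lower₁_raise₁])
theorem ann₂_cre₂ (v : FinFock) : ann₂ (cre₂ v) = cre₂ (ann₂ v) + v :=
  DFunLike.coe_injective (by simp [coe_ann₂, coe_cre₂, lower₂_raise₂])
theorem ann₁_ann₂ (v : FinFock) : ann₁ (ann₂ v) = ann₂ (ann₁ v) :=
  DFunLike.coe_injective (by simp [coe_ann₁, coe_ann₂, lower₁_lower₂])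
theorem ann₁_cre₂ (v : FinFock) : ann₁ (cre₂ v) = cre₂ (ann₁ v) :=
  DFunLike.coe_injective (by simp [coe_ann₁, coe_cre₂, lower₁_raise₂])
theorem ann₂_cre₁ (v : FinFock) : ann₂ (cre₁ v) = cre₁ (ann₂ v) :=
  DFunLike.coe_injective (by simp [coe_ann₂, coe_cre₁, lower₂_raise₁])
theorem cre₁_cre₂ (v : FinFock) : cre₁ (cre₂ v) = cre₂ (cre₁ v) :=
  DFunLike.coe_injective (by simp [coe_cre₁, coe_cre₂, raise₁_raise₂])

theorem fock_apply (x y : ℕ × ℕ) : (fock x : Seq) y = if y = x then 1 else 0 := by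
  have h : fock x = lp.single 2 x (1 : ℂ) := by
    rw [← HilbertBasis.repr_symm_single]; rfl
  rw [h, lp.coeFn_single, Pi.single_apply]

theorem inner_fock (x : ℕ × ℕ) (φ : Fock) : ⟪fock x, φ⟫_ℂ = φ x := by
  rw [← HilbertBasis.repr_apply_apply]; rfl

theorem incl_single (x : ℕ × ℕ) (c : ℂ) : incl (Finsupp.single x c) = c • fock x := by
  simp [incl]

theorem coe_incl (v : FinFock) : (⇑(incl v) : Seq) = ⇑v := by
  induction v using Finsupp.induction_linear with
  | zero => rw [map_zero]; rfl
  | add v w hv hw => rw [map_add, lp.coeFn_add, hv, hw]; rfl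
  | single x c =>
    rw [incl_single]
    ext y
    rw [lp.coeFn_smul, Pi.smul_apply, fock_apply, Finsupp.single_apply]
    simp [eq_comm]

theorem denseRange_incl : DenseRange incl := by
  rw [DenseRange]
  have h := fock.dense_span
  have h2 : (Submodule.span ℂ (Set.range fock) : Set Fock) = Set.range incl := by
    rw [← Finsupp.range_linearCombination]; rfl
  rw [← h2]
  exact Submodule.dense_iff_topologicalClosure_eq_top.mpr h

/-- By density and continuity, matrix elements determine a bounded operator; every operator identity
below is checked this way. -/
theorem clm_ext {A B : Fock →L[ℂ] Fock} (h : ∀ x y, ⟪fock x, A (fock y)⟫_ℂ = ⟪fock x, B (fock y)⟫_ℂ) :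
    A = B := by
  have h1 : ∀ y, A (fock y) = B (fock y) := fun y => by
    ext x; rw [← inner_fock, ← inner_fock, h]
  refine ContinuousLinearMap.ext fun φ => ?_
  refine congrFun (DenseRange.equalizer denseRange_incl A.continuous B.continuous ?_) φ
  ext1 v
  simp only [Function.comp]
  induction v using Finsupp.induction_linear with
  | zero => simp
  | add v w hv hw => simp [hv, hw]
  | single x c => rw [incl_single, map_smul, map_smul, h1]

/-! ### Rapidly decreasing sequences -/

/-- The weight `1 + k + m` of the Fock state `|k m⟩`. -/
def wt (x : ℕ × ℕ) : ℝ := 1 + x.1 + x.2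

theorem one_le_wt (x : ℕ × ℕ) : 1 ≤ wt x := by
  have h1 : (0 : ℝ) ≤ x.1 := Nat.cast_nonneg _
  have h2 : (0 : ℝ) ≤ x.2 := Nat.cast_nonneg _
  rw [wt]; linarith

theorem wt_pos (x : ℕ × ℕ) : 0 < wt x := zero_lt_one.trans_le (one_le_wt x)

/-- A family of sequences that decreases rapidly, also with respect to the weight `W` of its
index. -/
def RapidDecay {T : Type*} (W : T → ℝ) (f : T → Seq) : Prop :=
  ∀ n : ℕ, ∃ B : ℝ, ∀ t x, ‖f t x‖ * (wt x * W t) ^ n ≤ B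

/-- A single rapidly decreasing sequence. -/
abbrev Rapid (f : Seq) : Prop := RapidDecay (fun _ : Unit => 1) (fun _ => f)

namespace RapidDecay

variable {T T' : Type*} {W : T → ℝ} {W' : T' → ℝ} {f g : T → Seq}

/-- One spare power of the weight absorbs the factor `K * (wt x * W' t)`. The new index `φ t x` may
depend on `x`, so that index and argument can be exchanged, as in `transpose`. -/
theorem of_le {g : T' → Seq} (hf : RapidDecay W f) (φ : T' → ℕ × ℕ → T)
    (ψ : T' → ℕ × ℕ → ℕ × ℕ) {K : ℝ} (hK : 0 ≤ K) (hW : ∀ t, 0 ≤ W' t)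
    (h1 : ∀ t x, ‖g t x‖ ≤ K * (wt x * W' t) * ‖f (φ t x) (ψ t x)‖)
    (h2 : ∀ t x, wt x * W' t ≤ K * (wt (ψ t x) * W (φ t x))) : RapidDecay W' g := by
  intro n
  obtain ⟨B, hB⟩ := hf (n + 1)
  refine ⟨K * K ^ (n + 1) * B, fun t x => ?_⟩
  have hw : 0 ≤ wt x * W' t := mul_nonneg (wt_pos x).le (hW t)
  calc ‖g t x‖ * (wt x * W' t) ^ n
      ≤ K * (wt x * W' t) * ‖f (φ t x) (ψ t x)‖ * (wt x * W' t) ^ n := by gcongr; exact h1 t x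
    _ = K * ‖f (φ t x) (ψ t x)‖ * (wt x * W' t) ^ (n + 1) := by ring
    _ ≤ K * ‖f (φ t x) (ψ t x)‖ * (K * (wt (ψ t x) * W (φ t x))) ^ (n + 1) := by
        exact mul_le_mul_of_nonneg_left (pow_le_pow_left₀ hw (h2 t x) _) (by positivity)
    _ = K * K ^ (n + 1) * (‖f (φ t x) (ψ t x)‖ * (wt (ψ t x) * W (φ t x)) ^ (n + 1)) := by ring
    _ ≤ K * K ^ (n + 1) * B := by gcongr; exact hB _ _

theorem add (hW : ∀ t, 0 ≤ W t) (hf : RapidDecay W f) (hg : RapidDecay W g) :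
    RapidDecay W (fun t => f t + g t) := by
  intro n
  obtain ⟨B, hB⟩ := hf n
  obtain ⟨B', hB'⟩ := hg n
  refine ⟨B + B', fun t x => ?_⟩
  have hw : 0 ≤ (wt x * W t) ^ n := pow_nonneg (mul_nonneg (wt_pos x).le (hW t)) n
  calc ‖f t x + g t x‖ * (wt x * W t) ^ n ≤ (‖f t x‖ + ‖g t x‖) * (wt x * W t) ^ n := by
        gcongr; exact norm_add_le _ _
    _ ≤ B + B' := by rw [add_mul]; exact add_le_add (hB t x) (hB' t x)

theorem smul (c : T → ℂ) {K : ℝ} (hc : ∀ t, ‖c t‖ ≤ K) (hW : ∀ t, 0 ≤ W t)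
    (hf : RapidDecay W f) : RapidDecay W (fun t => c t • f t) := by
  intro n
  obtain ⟨B, hB⟩ := hf n
  refine ⟨K * B, fun t x => ?_⟩
  have hw : 0 ≤ (wt x * W t) ^ n := pow_nonneg (mul_nonneg (wt_pos x).le (hW t)) n
  have hK : 0 ≤ K := (norm_nonneg _).trans (hc t)
  calc ‖c t * f t x‖ * (wt x * W t) ^ n = ‖c t‖ * (‖f t x‖ * (wt x * W t) ^ n) := by
        rw [norm_mul]; ring
    _ ≤ K * B := by
        gcongr
        · exact hc t
        · exact hB t x

end RapidDecay

theorem sqrt_le_of_le {a b : ℝ} (hb : 1 ≤ b) (hab : a ≤ b) : Real.sqrt a ≤ b := by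
  rw [Real.sqrt_le_left (by linarith)]; nlinarith

theorem norm_sqrt_cast (a : ℝ) : ‖((Real.sqrt a : ℝ) : ℂ)‖ = Real.sqrt a := by
  rw [Complex.norm_real, Real.norm_of_nonneg (Real.sqrt_nonneg _)]

theorem wt_succ_left (x : ℕ × ℕ) : wt x ≤ wt (x.1 + 1, x.2) := by simp [wt]
theorem wt_succ_right (x : ℕ × ℕ) : wt x ≤ wt (x.1, x.2 + 1) := by simp [wt]
theorem wt_pred_left (x : ℕ × ℕ) : wt x ≤ 2 * wt (x.1 - 1, x.2) := by
  obtain ⟨_ | r, m⟩ := x <;> simp [wt] <;> linarith [Nat.cast_nonneg (α := ℝ) m]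
theorem wt_pred_right (x : ℕ × ℕ) : wt x ≤ 2 * wt (x.1, x.2 - 1) := by
  obtain ⟨r, _ | m⟩ := x <;> simp [wt] <;> linarith [Nat.cast_nonneg (α := ℝ) r]
theorem sqrt_fst_le (x : ℕ × ℕ) : Real.sqrt x.1 ≤ wt x :=
  sqrt_le_of_le (one_le_wt x) (by rw [wt]; linarith [Nat.cast_nonneg (α := ℝ) x.2])
theorem sqrt_snd_le (x : ℕ × ℕ) : Real.sqrt x.2 ≤ wt x :=
  sqrt_le_of_le (one_le_wt x) (by rw [wt]; linarith [Nat.cast_nonneg (α := ℝ) x.1])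
theorem sqrt_fst_succ_le (x : ℕ × ℕ) : Real.sqrt (x.1 + 1) ≤ wt x :=
  sqrt_le_of_le (one_le_wt x) (by rw [wt]; linarith [Nat.cast_nonneg (α := ℝ) x.2])
theorem sqrt_snd_succ_le (x : ℕ × ℕ) : Real.sqrt (x.2 + 1) ≤ wt x :=
  sqrt_le_of_le (one_le_wt x) (by rw [wt]; linarith [Nat.cast_nonneg (α := ℝ) x.1])

namespace RapidDecay

variable {T : Type*} {W : T → ℝ} {f : T → Seq}

/-- A ladder operator shifts one photon number by one and multiplies by a square root that is at
most the weight, so rapid decay survives it. -/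
theorem shift (hW : ∀ t, 1 ≤ W t) (hf : RapidDecay W f) (ψ : ℕ × ℕ → ℕ × ℕ) (c : ℕ × ℕ → ℝ)
    (hc0 : ∀ x, 0 ≤ c x) (hc : ∀ x, c x ≤ wt x) (hψ : ∀ x, wt x ≤ 2 * wt (ψ x)) :
    RapidDecay W (fun t x => ((c x : ℝ) : ℂ) * f t (ψ x)) := by
  refine hf.of_le (fun t _ => t) (fun _ x => ψ x) (K := 2) (by norm_num)
    (fun t => by linarith [hW t]) (fun t x => ?_) (fun t x => ?_)
  · rw [norm_mul, Complex.norm_real, Real.norm_of_nonneg (hc0 x)]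
    gcongr
    nlinarith [hc x, hW t, wt_pos x]
  · nlinarith [hψ x, hW t, wt_pos x]

theorem lower₁ (hW : ∀ t, 1 ≤ W t) (hf : RapidDecay W f) :
    RapidDecay W (fun t => TMSV.lower₁ (f t)) :=
  hf.shift hW (fun x => (x.1 + 1, x.2)) (fun x => Real.sqrt (x.1 + 1))
    (fun _ => Real.sqrt_nonneg _) sqrt_fst_succ_le
    (fun x => by linarith [wt_succ_left x, wt_pos x])
theorem lower₂ (hW : ∀ t, 1 ≤ W t) (hf : RapidDecay W f) :
    RapidDecay W (fun t => TMSV.lower₂ (f t)) :=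
  hf.shift hW (fun x => (x.1, x.2 + 1)) (fun x => Real.sqrt (x.2 + 1))
    (fun _ => Real.sqrt_nonneg _) sqrt_snd_succ_le
    (fun x => by linarith [wt_succ_right x, wt_pos x])
theorem raise₁ (hW : ∀ t, 1 ≤ W t) (hf : RapidDecay W f) :
    RapidDecay W (fun t => TMSV.raise₁ (f t)) :=
  hf.shift hW (fun x => (x.1 - 1, x.2)) (fun x => Real.sqrt x.1)
    (fun _ => Real.sqrt_nonneg _) sqrt_fst_le wt_pred_left
theorem raise₂ (hW : ∀ t, 1 ≤ W t) (hf : RapidDecay W f) :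
    RapidDecay W (fun t => TMSV.raise₂ (f t)) :=
  hf.shift hW (fun x => (x.1, x.2 - 1)) (fun x => Real.sqrt x.2)
    (fun _ => Real.sqrt_nonneg _) sqrt_snd_le wt_pred_right

theorem exists_bound (hW : ∀ t, 1 ≤ W t) (hf : RapidDecay W f) :
    ∃ B : ℝ, ∀ t x, ‖f t x‖ ≤ B * ((wt x ^ 4)⁻¹ * (W t ^ 4)⁻¹) := by
  obtain ⟨B, hB⟩ := hf 4
  refine ⟨B, fun t x => ?_⟩
  have h1 := wt_pos x
  have h2 : 0 < W t := by linarith [hW t]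
  rw [← mul_inv, ← div_eq_mul_inv, le_div_iff₀ (by positivity), ← mul_pow]
  exact hB t x

/-- The transpose of a rapidly decreasing family of kernels. -/
theorem transpose {U : Type*} {k : U → ℕ × ℕ → ℕ × ℕ → ℂ}
    (hk : RapidDecay (fun t : U × (ℕ × ℕ) => wt t.2) (fun t x => k t.1 x t.2)) :
    RapidDecay (fun t : U × (ℕ × ℕ) => wt t.2) (fun t x => k t.1 t.2 x) := by
  refine hk.of_le (fun t x => (t.1, x)) (fun t _ => t.2) (K := 1) zero_le_one
    (fun t => (wt_pos _).le) (fun t x => ?_) (fun t x => ?_)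
  · rw [one_mul]
    exact le_mul_of_one_le_left (norm_nonneg _) (one_le_mul_of_one_le_of_one_le (one_le_wt _) (one_le_wt _))
  · rw [one_mul, mul_comm]

theorem curry {T : Type*} {W : T → ℝ} {f : T → Seq} (hW : ∀ t, 1 ≤ W t) (hf : RapidDecay W f)
    (t : T) : Rapid (f t) := by
  intro n
  obtain ⟨B, hB⟩ := hf n
  refine ⟨B, fun _ x => le_trans ?_ (hB t x)⟩
  have := wt_pos x
  gcongr
  exact hW t

end RapidDecay

/-- The fourth power dominates `(x.1 + 1)² (x.2 + 1)²`, whose inverse is a product of two convergent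
series. -/
theorem summable_wt : Summable fun x : ℕ × ℕ => (wt x ^ 4)⁻¹ := by
  have h1 : Summable fun n : ℕ => (((n : ℝ) + 1) ^ 2)⁻¹ := by
    have := (summable_nat_add_iff 1).mpr (Real.summable_nat_pow_inv.mpr (by norm_num : 1 < 2))
    simpa using this
  have h2 := h1.mul_of_nonneg h1 (fun n => by positivity) (fun n => by positivity)
  refine h2.of_nonneg_of_le (fun x => by have := wt_pos x; positivity) (fun x => ?_)
  rw [← mul_inv]
  have a1 : (x.1 : ℝ) + 1 ≤ wt x := by rw [wt]; linarith [Nat.cast_nonneg (α := ℝ) x.2]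
  have a2 : (x.2 : ℝ) + 1 ≤ wt x := by rw [wt]; linarith [Nat.cast_nonneg (α := ℝ) x.1]
  gcongr
  calc ((x.1 : ℝ) + 1) ^ 2 * ((x.2 : ℝ) + 1) ^ 2 ≤ wt x ^ 2 * wt x ^ 2 := by gcongr
    _ = wt x ^ 4 := by ring

namespace Rapid

variable {f g : Seq}

theorem exists_bound (hf : Rapid f) : ∃ B : ℝ, ∀ x, ‖f x‖ ≤ B * (wt x ^ 4)⁻¹ := by
  obtain ⟨B, hB⟩ := RapidDecay.exists_bound (fun _ => le_rfl) hf
  exact ⟨B, fun x => by simpa using hB () x⟩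

theorem summable_norm (hf : Rapid f) : Summable fun x => ‖f x‖ := by
  obtain ⟨B, hB⟩ := hf.exists_bound
  exact (summable_wt.mul_left B).of_nonneg_of_le (fun _ => norm_nonneg _) hB

theorem bounded (hf : Rapid f) : ∃ B : ℝ, ∀ x, ‖f x‖ ≤ B := by
  obtain ⟨B, hB⟩ := hf 0
  exact ⟨B, fun x => by simpa using hB () x⟩

theorem summable_mul (hf : Rapid f) {B : ℝ} (hg : ∀ x, ‖g x‖ ≤ B) :
    Summable fun x => f x * g x := by
  refine Summable.of_norm_bounded (hf.summable_norm.mul_right B) fun x => ?_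
  rw [norm_mul]
  exact mul_le_mul_of_nonneg_left (hg x) (norm_nonneg _)

theorem memℓp (hf : Rapid f) : Memℓp f 2 := by
  refine memℓp_gen ?_
  obtain ⟨B, hB⟩ := hf.bounded
  refine (hf.summable_norm.mul_right B).of_nonneg_of_le (fun x => by positivity) fun x => ?_
  simp only [ENNReal.toReal_ofNat, Real.rpow_ofNat, sq]
  exact mul_le_mul_of_nonneg_left (hB x) (norm_nonneg _)

theorem add (hf : Rapid f) (hg : Rapid g) : Rapid (f + g) :=
  RapidDecay.add (fun _ => zero_le_one) hf hg

theorem smul (c : ℂ) (hf : Rapid f) : Rapid (c • f) :=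
  RapidDecay.smul (fun _ => c) (fun _ => le_rfl) (fun _ => zero_le_one) hf

theorem lower₁ (hf : Rapid f) : Rapid (TMSV.lower₁ f) := RapidDecay.lower₁ (fun _ => le_rfl) hf
theorem lower₂ (hf : Rapid f) : Rapid (TMSV.lower₂ f) := RapidDecay.lower₂ (fun _ => le_rfl) hf
theorem raise₁ (hf : Rapid f) : Rapid (TMSV.raise₁ f) := RapidDecay.raise₁ (fun _ => le_rfl) hf
theorem raise₂ (hf : Rapid f) : Rapid (TMSV.raise₂ f) := RapidDecay.raise₂ (fun _ => le_rfl) hf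

end Rapid

/-! ### The bilinear pairing -/

/-- The bilinear pairing of two sequences. -/
def pair (f g : Seq) : ℂ := ∑' x, f x * g x

theorem pair_comm (f g : Seq) : pair f g = pair g f := tsum_congr fun _ => mul_comm _ _

/-- Reindexing along `r ↦ r + 1`, whose range contains the support of the summand. A `tsum` is
invariant under this without any summability. -/
theorem pair_raise₁ (f g : Seq) : pair (raise₁ f) g = pair f (lower₁ g) := by
  have hinj : Function.Injective fun x : ℕ × ℕ => (x.1 + 1, x.2) := by
    rintro ⟨a, b⟩ ⟨c, d⟩ h; simpa using h
  rw [pair, ← hinj.tsum_eq, pair]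
  · refine tsum_congr fun x => ?_
    obtain ⟨r, m⟩ := x
    simp only [raise₁_apply, lower₁_apply, Nat.add_sub_cancel]
    push_cast; ring
  · rintro ⟨_ | r, m⟩ h
    · simp [raise₁_apply] at h
    · exact ⟨(r, m), rfl⟩

theorem pair_raise₂ (f g : Seq) : pair (raise₂ f) g = pair f (lower₂ g) := by
  have hinj : Function.Injective fun x : ℕ × ℕ => (x.1, x.2 + 1) := by
    rintro ⟨a, b⟩ ⟨c, d⟩ h; simpa using h
  rw [pair, ← hinj.tsum_eq, pair]
  · refine tsum_congr fun x => ?_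
    obtain ⟨r, m⟩ := x
    simp only [raise₂_apply, lower₂_apply, Nat.add_sub_cancel]
    push_cast; ring
  · rintro ⟨r, _ | m⟩ h
    · simp [raise₂_apply] at h
    · exact ⟨(r, m), rfl⟩

theorem pair_lower₁ (f g : Seq) : pair (lower₁ f) g = pair f (raise₁ g) := by
  rw [pair_comm, ← pair_raise₁, pair_comm]
theorem pair_lower₂ (f g : Seq) : pair (lower₂ f) g = pair f (raise₂ g) := by
  rw [pair_comm, ← pair_raise₂, pair_comm]

theorem pair_smul_left (c : ℂ) (f g : Seq) : pair (c • f) g = c * pair f g := by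
  simp only [pair, Pi.smul_apply, smul_eq_mul, mul_assoc, tsum_mul_left]
theorem pair_smul_right (c : ℂ) (f g : Seq) : pair f (c • g) = c * pair f g := by
  rw [pair_comm, pair_smul_left, pair_comm]

theorem pair_add_left {f g h : Seq} {B : ℝ} (hf : Rapid f) (hg : Rapid g) (hh : ∀ x, ‖h x‖ ≤ B) :
    pair (f + g) h = pair f h + pair g h := by
  simp only [pair, Pi.add_apply, add_mul]
  exact (hf.summable_mul hh).tsum_add (hg.summable_mul hh)

theorem pair_add_right {f g h : Seq} {B : ℝ} (hf : Rapid f) (hg : Rapid g) (hh : ∀ x, ‖h x‖ ≤ B) :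
    pair h (f + g) = pair h f + pair h g := by
  rw [pair_comm, pair_add_left hf hg hh, pair_comm, pair_comm g]

/-! ### Amplitudes of `exp (s a b)` -/

/-- The matrix element `⟨w| exp (s a b) |x⟩`. -/
def coef (s : ℂ) (x w : ℕ × ℕ) : ℂ :=
  if x.1 + w.2 = x.2 + w.1 then
    s ^ (x.1 - w.1) * ((Real.sqrt (x.1.choose w.1 * x.2.choose w.2) : ℝ) : ℂ) else 0

theorem coef_swap (s : ℂ) (r m u v : ℕ) : coef s (m, r) (v, u) = coef s (r, m) (u, v) := by
  unfold coef
  by_cases h : r + v = m + u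
  · have h' : m + u = r + v := h.symm
    simp only [if_pos h, if_pos h']
    by_cases hu : u ≤ r
    · rw [show m - v = r - u by omega, mul_comm (m.choose v : ℝ)]
    · rw [Nat.choose_eq_zero_of_lt (not_le.mp hu)]; simp
  · have h' : ¬ (m + u = r + v) := fun e => h e.symm
    simp only [if_neg h, if_neg h']

/-- The three radicands are `(u + i + 1)²`, `u²` and `(i + 1)²` times the common number `X / (u + i
+ 1)`, so the identity is `u + i + 1 = u + (i + 1)`. -/
theorem sqrt_mul_sqrt_choose_aux (u i v : ℕ) :
    Real.sqrt (u + i + 1) * Real.sqrt ((u + i + 1).choose u * (v + i + 1).choose v) =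
      Real.sqrt u * Real.sqrt ((u + i).choose (u - 1) * (v + i + 1).choose v) +
        Real.sqrt (v + i + 1) * Real.sqrt ((u + i).choose u * (v + i).choose v) := by
  set X : ℝ := (u + i + 1).choose u * (v + i + 1).choose v with hX
  have hX0 : 0 ≤ X := by positivity
  have hn : (0 : ℝ) < u + i + 1 := by positivity
  have e1 : (u : ℝ) * ((u + i).choose (u - 1) * (v + i + 1).choose v) =
      (u : ℝ) ^ 2 * (X / (u + i + 1)) := by
    rcases u with _ | u
    · simp
    · have h := Nat.add_one_mul_choose_eq (u + 1 + i) u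
      have h2 : ((u + 1 + i + 1 : ℕ) : ℝ) * (u + 1 + i).choose u =
        (u + 1 + i + 1).choose (u + 1) * (u + 1 : ℕ) := by exact_mod_cast h
      rw [hX]
      push_cast at h2 hn ⊢
      rw [← mul_div_assoc, eq_div_iff hn.ne']
      linear_combination ((u : ℝ) + 1) * ((v + i + 1).choose v : ℝ) * h2
  have e2 : ((v : ℝ) + i + 1) * ((u + i).choose u * (v + i).choose v) =
      ((i : ℝ) + 1) ^ 2 * (X / (u + i + 1)) := by
    have h := Nat.choose_mul_succ_eq (u + i) u
    have h' := Nat.choose_mul_succ_eq (v + i) v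
    rw [show u + i + 1 - u = i + 1 by omega] at h
    rw [show v + i + 1 - v = i + 1 by omega] at h'
    have h2 : ((u + i).choose u : ℝ) * ((u : ℝ) + i + 1) = (u + i + 1).choose u * ((i : ℝ) + 1) := by
      exact_mod_cast h
    have h2' : ((v + i).choose v : ℝ) * ((v : ℝ) + i + 1) = (v + i + 1).choose v * ((i : ℝ) + 1) := by
      exact_mod_cast h'
    rw [hX, ← mul_div_assoc, eq_div_iff hn.ne']
    linear_combination ((v : ℝ) + i + 1) * ((v + i).choose v : ℝ) * h2 +
      ((u + i + 1).choose u : ℝ) * ((i : ℝ) + 1) * h2'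
  have e3 : ((u : ℝ) + i + 1) * X = ((u : ℝ) + i + 1) ^ 2 * (X / (u + i + 1)) := by
    field_simp
  rw [← Real.sqrt_mul (by positivity), ← Real.sqrt_mul (by positivity),
    ← Real.sqrt_mul (by positivity), e1, e2, e3, Real.sqrt_mul (by positivity),
    Real.sqrt_mul (by positivity), Real.sqrt_mul (by positivity), Real.sqrt_sq (by positivity),
    Real.sqrt_sq (by positivity), Real.sqrt_sq (by positivity)]
  ring

/-- The intertwining `exp (s ab) a† = (a† + s b) exp (s ab)`, applied to `|r m⟩`. -/
theorem coef_succ_left (s : ℂ) (r m : ℕ) :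
    ((Real.sqrt (r + 1) : ℝ) : ℂ) • coef s (r + 1, m) =
      raise₁ (coef s (r, m)) + (s * ((Real.sqrt m : ℝ) : ℂ)) • coef s (r, m - 1) := by
  ext ⟨u, v⟩
  simp only [Pi.smul_apply, Pi.add_apply, raise₁_apply, smul_eq_mul]
  by_cases h : r + 1 + v = m + u
  swap
  · have h1 : ((Real.sqrt u : ℝ) : ℂ) * coef s (r, m) (u - 1, v) = 0 := by
      rcases u with _ | u
      · simp
      · rw [coef, if_neg (by simp; omega), mul_zero]
    have h2 : ((Real.sqrt m : ℝ) : ℂ) * coef s (r, m - 1) (u, v) = 0 := by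
      rcases m with _ | m
      · simp
      · rw [coef, if_neg (by simp; omega), mul_zero]
    rw [h1, mul_assoc, h2, coef, if_neg (by simpa using h)]
    simp
  by_cases hu : u ≤ r + 1
  swap
  · have c1 : (r + 1).choose u = 0 := Nat.choose_eq_zero_of_lt (not_le.mp hu)
    have c2 : r.choose (u - 1) = 0 := Nat.choose_eq_zero_of_lt (by omega)
    have c3 : r.choose u = 0 := Nat.choose_eq_zero_of_lt (by omega)
    simp [coef, c1, c2, c3]
  obtain ⟨j, hj⟩ := Nat.exists_eq_add_of_le hu
  have hm : m = v + j := by omega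
  subst hm
  rcases j with _ | i
  · have : u = r + 1 := by omega
    subst this
    simp [coef, add_comm]
  · have : r = u + i := by omega
    subst this
    have h2 : coef s (u + i, v + (i + 1) - 1) (u, v) =
        s ^ i * ((Real.sqrt ((u + i).choose u * (v + i).choose v) : ℝ) : ℂ) := by
      rw [coef, if_pos (by simp; omega)]
      simp [show u + i - u = i by omega]
    have h3 : coef s (u + i + 1, v + (i + 1)) (u, v) =
        s ^ (i + 1) * ((Real.sqrt ((u + i + 1).choose u * (v + i + 1).choose v) : ℝ) : ℂ) := by
      rw [coef, if_pos (by simp; omega)]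
      simp [add_assoc]
    have h1 : ((Real.sqrt u : ℝ) : ℂ) * coef s (u + i, v + (i + 1)) (u - 1, v) =
        ((Real.sqrt u : ℝ) : ℂ) * (s ^ (i + 1) *
          ((Real.sqrt ((u + i).choose (u - 1) * (v + i + 1).choose v) : ℝ) : ℂ)) := by
      rcases u with _ | u
      · simp
      · rw [coef, if_pos (by simp; omega)]
        simp [show u + 1 + i - u = i + 1 by omega, ← add_assoc]
    rw [h1, h2, h3]
    have := congrArg (fun t : ℝ => (t : ℂ)) (sqrt_mul_sqrt_choose_aux u i v)
    push_cast at this ⊢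
    rw [show (v : ℝ) + (i + 1) = v + i + 1 by ring]
    linear_combination s ^ (i + 1) * this

theorem coef_succ_right (s : ℂ) (r m : ℕ) :
    ((Real.sqrt (m + 1) : ℝ) : ℂ) • coef s (r, m + 1) =
      raise₂ (coef s (r, m)) + (s * ((Real.sqrt r : ℝ) : ℂ)) • coef s (r - 1, m) := by
  ext ⟨u, v⟩
  have := congrFun (coef_succ_left s m r) (v, u)
  simpa only [Pi.smul_apply, Pi.add_apply, raise₂_apply, raise₁_apply, coef_swap] using this

/-- The operator `a` commutes with `exp (s ab)`. -/
theorem lower₁_coef (s : ℂ) (r m : ℕ) :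
    lower₁ (coef s (r, m)) = ((Real.sqrt r : ℝ) : ℂ) • coef s (r - 1, m) := by
  ext ⟨u, v⟩
  simp only [Pi.smul_apply, lower₁_apply, smul_eq_mul]
  rcases r with _ | r
  · simp [coef]
  · simp only [coef, Nat.add_sub_cancel]
    by_cases h : r + v = m + u
    · rw [if_pos (by omega), if_pos h, show r + 1 - (u + 1) = r - u by omega]
      have e : ((u : ℝ) + 1) * ((r + 1).choose (u + 1) * m.choose v) =
          ((r + 1 : ℕ) : ℝ) * (r.choose u * m.choose v) := by
        have h := Nat.add_one_mul_choose_eq r u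
        have h2 : ((r + 1 : ℕ) : ℝ) * r.choose u = (r + 1).choose (u + 1) * ((u + 1 : ℕ) : ℝ) := by
          exact_mod_cast h
        push_cast at h2 ⊢
        linear_combination -(m.choose v : ℝ) * h2
      have e2 := congrArg (fun t : ℝ => ((Real.sqrt t : ℝ) : ℂ)) e
      rw [Real.sqrt_mul (show (0 : ℝ) ≤ (u : ℝ) + 1 by positivity),
        Real.sqrt_mul (show (0 : ℝ) ≤ ((r + 1 : ℕ) : ℝ) by positivity), Complex.ofReal_mul,
        Complex.ofReal_mul] at e2
      linear_combination s ^ (r - u) * e2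
    · rw [if_neg (by omega), if_neg h, mul_zero, mul_zero]

theorem lower₂_coef (s : ℂ) (r m : ℕ) :
    lower₂ (coef s (r, m)) = ((Real.sqrt m : ℝ) : ℂ) • coef s (r, m - 1) := by
  ext ⟨u, v⟩
  have := congrFun (lower₁_coef s m r) (v, u)
  simpa only [Pi.smul_apply, lower₂_apply, lower₁_apply, coef_swap] using this

/-- In operator form, `d/ds exp (s ab) = exp (s ab) ab`; each entry is a monomial in `s`. -/
theorem hasDerivAt_coef (s : ℂ) (r m : ℕ) (w : ℕ × ℕ) :
    HasDerivAt (fun s => coef s (r, m) w)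
      (((Real.sqrt r : ℝ) : ℂ) * ((Real.sqrt m : ℝ) : ℂ) * coef s (r - 1, m - 1) w) s := by
  obtain ⟨u, v⟩ := w
  by_cases h : r + v = m + u
  swap
  · have h1 : ((Real.sqrt r : ℝ) : ℂ) * ((Real.sqrt m : ℝ) : ℂ) * coef s (r - 1, m - 1) (u, v) = 0 := by
      rcases r with _ | r
      · simp
      rcases m with _ | m
      · simp
      · rw [coef, if_neg (by simp; omega), mul_zero]
    rw [h1]
    simp only [coef, if_neg h]
    exact hasDerivAt_const _ _
  by_cases hu : u ≤ r
  swap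
  · have c2 : r.choose u = 0 := Nat.choose_eq_zero_of_lt (not_le.mp hu)
    have c3 : (r - 1).choose u = 0 := Nat.choose_eq_zero_of_lt (by omega)
    simp only [coef, c2, c3, Nat.cast_zero, zero_mul, Real.sqrt_zero, Complex.ofReal_zero, mul_zero,
      ite_self]
    exact hasDerivAt_const _ _
  obtain ⟨j, rfl⟩ := Nat.exists_eq_add_of_le hu
  have hm : m = v + j := by omega
  subst hm
  simp only [coef, if_pos h, Nat.add_sub_cancel_left]
  have key : HasDerivAt (fun s : ℂ => s ^ j *
      ((Real.sqrt ((u + j).choose u * (v + j).choose v) : ℝ) : ℂ))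
      ((j * s ^ (j - 1)) * ((Real.sqrt ((u + j).choose u * (v + j).choose v) : ℝ) : ℂ)) s :=
    (hasDerivAt_pow j s).mul_const _
  convert key using 1
  rcases j with _ | i
  · rcases u with _ | u
    · simp
    · simp
  · rw [if_pos (by simp; omega), show u + (i + 1) - 1 = u + i by omega,
      show v + (i + 1) - 1 = v + i by omega]
    simp only [Nat.add_sub_cancel_left, Nat.add_sub_cancel]
    have h := Nat.choose_mul_succ_eq (u + i) u
    have h' := Nat.choose_mul_succ_eq (v + i) v
    rw [show u + i + 1 - u = i + 1 by omega] at h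
    rw [show v + i + 1 - v = i + 1 by omega] at h'
    have h2 : ((u + i).choose u : ℝ) * ((u : ℝ) + i + 1) = (u + i + 1).choose u * ((i : ℝ) + 1) := by
      exact_mod_cast h
    have h2' : ((v + i).choose v : ℝ) * ((v : ℝ) + i + 1) = (v + i + 1).choose v * ((i : ℝ) + 1) := by
      exact_mod_cast h'
    have e : (u + (i + 1) : ℝ) * ((v + (i + 1)) * ((u + i).choose u * (v + i).choose v)) =
        ((i : ℝ) + 1) ^ 2 * ((u + (i + 1)).choose u * (v + (i + 1)).choose v) := by
      rw [← add_assoc u i 1, ← add_assoc v i 1]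
      linear_combination ((v : ℝ) + i + 1) * ((v + i).choose v : ℝ) * h2 +
        ((u + i + 1).choose u : ℝ) * ((i : ℝ) + 1) * h2'
    have e2 := congrArg (fun t : ℝ => ((Real.sqrt t : ℝ) : ℂ)) e
    rw [Real.sqrt_mul (show (0 : ℝ) ≤ (u : ℝ) + (i + 1) by positivity),
      Real.sqrt_mul (show (0 : ℝ) ≤ (v : ℝ) + (i + 1) by positivity),
      Real.sqrt_mul (show (0 : ℝ) ≤ ((i : ℝ) + 1) ^ 2 by positivity),
      Real.sqrt_sq (by positivity)] at e2
    push_cast at e2 ⊢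
    linear_combination s ^ i * e2

theorem coef_eq_zero_of_lt {s : ℂ} {x w : ℕ × ℕ} (h : x.1 < w.1 ∨ x.2 < w.2) : coef s x w = 0 := by
  unfold coef
  rcases h with h | h <;> simp [Nat.choose_eq_zero_of_lt h]

theorem coef_zero_zero (s : ℂ) (w : ℕ × ℕ) : coef s (0, 0) w = if w = (0, 0) then 1 else 0 := by
  split_ifs with h
  · subst h; simp [coef]
  · apply coef_eq_zero_of_lt
    by_contra! h'
    exact h (Prod.ext (by simpa using h'.1) (by simpa using h'.2))

/-- Both modes lose the same number `j` of photons, so `‖s‖^(2j)` splits as `δ^j ε^j`; then `p^u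
δ^j` times a binomial coefficient is a single term of the binomial expansion of `(p + δ)^(u+j)`, and
likewise in the other mode. -/
theorem norm_coef_sq_le (s : ℂ) (x w : ℕ × ℕ) {p q δ ε : ℝ} (hp : 0 ≤ p) (hq : 0 ≤ q) (hδ : 0 ≤ δ)
    (hε : 0 ≤ ε) (hs : ‖s‖ ^ 2 ≤ δ * ε) :
    ‖coef s x w‖ ^ 2 * (p ^ w.1 * q ^ w.2) ≤ (p + δ) ^ x.1 * (q + ε) ^ x.2 := by
  obtain ⟨r, m⟩ := x
  obtain ⟨u, v⟩ := w
  by_cases h : r + v = m + u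
  swap
  · rw [coef, if_neg h]; simp; positivity
  by_cases hu : u ≤ r
  swap
  · rw [coef_eq_zero_of_lt (Or.inl (not_le.mp hu))]; simp; positivity
  obtain ⟨j, rfl⟩ := Nat.exists_eq_add_of_le hu
  have hm : m = v + j := by omega
  subst hm
  have key : ∀ (p δ : ℝ) (u : ℕ), 0 ≤ p → 0 ≤ δ →
      p ^ u * δ ^ j * (u + j).choose u ≤ (p + δ) ^ (u + j) := by
    intro p δ u hp hδ
    rw [add_pow]
    have := Finset.single_le_sum (f := fun i => p ^ i * δ ^ (u + j - i) * ((u + j).choose i : ℝ))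
      (fun i _ => by positivity) (Finset.mem_range.mpr (show u < u + j + 1 by omega))
    simpa using this
  have k1 := key p δ u hp hδ
  have k2 := key q ε v hq hε
  simp only [coef, if_pos h, Nat.add_sub_cancel_left]
  rw [norm_mul, norm_sqrt_cast, norm_pow, mul_pow, Real.sq_sqrt (by positivity)]
  calc (‖s‖ ^ j) ^ 2 * (((u + j).choose u : ℝ) * (v + j).choose v) * (p ^ u * q ^ v)
      = (‖s‖ ^ 2) ^ j * ((((u + j).choose u : ℝ) * (v + j).choose v) * (p ^ u * q ^ v)) := by ring
    _ ≤ (δ * ε) ^ j * ((((u + j).choose u : ℝ) * (v + j).choose v) * (p ^ u * q ^ v)) := by gcongr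
    _ = (p ^ u * δ ^ j * (u + j).choose u) * (q ^ v * ε ^ j * (v + j).choose v) := by
        rw [mul_pow]; ring
    _ ≤ _ := by gcongr

/-! ### Ladder relations determine a kernel -/

/-- The matrix elements `k x y = ⟨x| G |y⟩` of an operator `G` with
`a G = s b† G + p G a`, `b G = s a† G + q G b`, `G a† = s' G b + p a† G`, `G b† = s' G a + q b† G`. -/
structure LadderRel (p q s s' : ℂ) (k : ℕ × ℕ → ℕ × ℕ → ℂ) : Prop where
  left₁ : ∀ r m i j : ℕ, ((Real.sqrt (r + 1) : ℝ) : ℂ) * k (r + 1, m) (i, j) =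
    s * (((Real.sqrt m : ℝ) : ℂ) * k (r, m - 1) (i, j)) +
      p * (((Real.sqrt i : ℝ) : ℂ) * k (r, m) (i - 1, j))
  left₂ : ∀ r m i j : ℕ, ((Real.sqrt (m + 1) : ℝ) : ℂ) * k (r, m + 1) (i, j) =
    s * (((Real.sqrt r : ℝ) : ℂ) * k (r - 1, m) (i, j)) +
      q * (((Real.sqrt j : ℝ) : ℂ) * k (r, m) (i, j - 1))
  right₁ : ∀ r m i j : ℕ, ((Real.sqrt (i + 1) : ℝ) : ℂ) * k (r, m) (i + 1, j) =
    s' * (((Real.sqrt j : ℝ) : ℂ) * k (r, m) (i, j - 1)) +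
      p * (((Real.sqrt r : ℝ) : ℂ) * k (r - 1, m) (i, j))
  right₂ : ∀ r m i j : ℕ, ((Real.sqrt (j + 1) : ℝ) : ℂ) * k (r, m) (i, j + 1) =
    s' * (((Real.sqrt i : ℝ) : ℂ) * k (r, m) (i - 1, j)) +
      q * (((Real.sqrt m : ℝ) : ℂ) * k (r, m - 1) (i, j))

theorem sqrt_succ_ne_zero (n : ℕ) : ((Real.sqrt (n + 1) : ℝ) : ℂ) ≠ 0 := by
  rw [Complex.ofReal_ne_zero]; positivity

namespace LadderRel

variable {p q s s' : ℂ} {k l : ℕ × ℕ → ℕ × ℕ → ℂ}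

/-- The four photon numbers are raised from zero one after another. While an index is still zero,
the terms that would lower it vanish, so each relation expresses the new entry by entries already
known. -/
theorem unique (hk : LadderRel p q s s' k) (hl : LadderRel p q s s' l)
    (h0 : k (0, 0) (0, 0) = l (0, 0) (0, 0)) : k = l := by
  have h1 : ∀ j, k (0, 0) (0, j) = l (0, 0) (0, j) := by
    intro j
    induction j with
    | zero => exact h0
    | succ j ih =>
      refine mul_left_cancel₀ (sqrt_succ_ne_zero j) ?_
      rw [hk.right₂, hl.right₂]; simp
  have h2 : ∀ i j, k (0, 0) (i, j) = l (0, 0) (i, j) := by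
    intro i
    induction i with
    | zero => exact h1
    | succ i ih =>
      intro j
      refine mul_left_cancel₀ (sqrt_succ_ne_zero i) ?_
      rw [hk.right₁, hl.right₁, ih]; simp
  have h3 : ∀ m i j, k (0, m) (i, j) = l (0, m) (i, j) := by
    intro m
    induction m with
    | zero => exact h2
    | succ m ih =>
      intro i j
      refine mul_left_cancel₀ (sqrt_succ_ne_zero m) ?_
      rw [hk.left₂, hl.left₂, ih]; simp [ih]
  have h4 : ∀ r m i j, k (r, m) (i, j) = l (r, m) (i, j) := by
    intro r
    induction r with
    | zero => exact h3
    | succ r ih =>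
      intro m i j
      refine mul_left_cancel₀ (sqrt_succ_ne_zero r) ?_
      rw [hk.left₁, hl.left₁, ih, ih]
  ext ⟨r, m⟩ ⟨i, j⟩
  exact h4 r m i j

theorem const_mul (hk : LadderRel p q s s' k) (c : ℂ) :
    LadderRel p q s s' (fun x y => c * k x y) where
  left₁ r m i j := by linear_combination c * hk.left₁ r m i j
  left₂ r m i j := by linear_combination c * hk.left₂ r m i j
  right₁ r m i j := by linear_combination c * hk.right₁ r m i j
  right₂ r m i j := by linear_combination c * hk.right₂ r m i j

end LadderRel

/-! ### Gaussian kernels -/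

/-- The operator `p ^ n₁ q ^ n₂` on sequences, with the number operators `n₁`, `n₂`. -/
def diag (p q : ℂ) (f : Seq) : Seq := fun w => p ^ w.1 * q ^ w.2 * f w

/-- The matrix elements of `exp (s a† b†) p ^ n₁ q ^ n₂ exp (s' a b)`. -/
def gker (s s' p q : ℂ) (x y : ℕ × ℕ) : ℂ := pair (coef s x) (diag p q (coef s' y))

theorem Rapid.of_finite_support {f : Seq} (x : ℕ × ℕ)
    (hf : ∀ w : ℕ × ℕ, x.1 < w.1 ∨ x.2 < w.2 → f w = 0) : Rapid f := by
  intro n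
  refine ⟨∑ w ∈ Finset.range (x.1 + 1) ×ˢ Finset.range (x.2 + 1), ‖f w‖ * (wt w * 1) ^ n,
    fun _ w => ?_⟩
  have hpos : ∀ w, 0 ≤ ‖f w‖ * (wt w * 1) ^ n := fun w => by have := wt_pos w; positivity
  by_cases h : x.1 < w.1 ∨ x.2 < w.2
  · simp only [hf w h, norm_zero, zero_mul]
    exact Finset.sum_nonneg fun w _ => hpos w
  · push Not at h
    refine Finset.single_le_sum (f := fun w => ‖f w‖ * (wt w * 1) ^ n) (fun w _ => hpos w) ?_
    simp only [Finset.mem_product, Finset.mem_range]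
    omega

theorem rapid_coef (s : ℂ) (x : ℕ × ℕ) : Rapid (coef s x) :=
  Rapid.of_finite_support x fun _ h => coef_eq_zero_of_lt h

theorem rapid_diag_coef (p q s : ℂ) (x : ℕ × ℕ) : Rapid (diag p q (coef s x)) :=
  Rapid.of_finite_support x fun _ h => by rw [diag, coef_eq_zero_of_lt h, mul_zero]

theorem pair_diag (p q : ℂ) (f g : Seq) : pair f (diag p q g) = pair (diag p q f) g :=
  tsum_congr fun w => by simp only [diag]; ring

theorem gker_symm (s s' p q : ℂ) (x y : ℕ × ℕ) : gker s s' p q x y = gker s' s p q y x := by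
  rw [gker, pair_diag, pair_comm, gker]

theorem lower₁_diag (p q : ℂ) (f : Seq) : lower₁ (diag p q f) = p • diag p q (lower₁ f) := by
  ext ⟨u, v⟩
  simp only [lower₁_apply, diag, Pi.smul_apply, smul_eq_mul, pow_succ]; ring

theorem lower₂_diag (p q : ℂ) (f : Seq) : lower₂ (diag p q f) = q • diag p q (lower₂ f) := by
  ext ⟨u, v⟩
  simp only [lower₂_apply, diag, Pi.smul_apply, smul_eq_mul, pow_succ]; ring

theorem diag_smul (p q c : ℂ) (f : Seq) : diag p q (c • f) = c • diag p q f := by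
  ext w; simp only [diag, Pi.smul_apply, smul_eq_mul]; ring

/-- The raising operator produced by the recursion of `coef` becomes a lowering operator on the
other side of the pairing, picks up `p` on passing `p^n₁`, and commutes with `exp (s' ab)`. -/
theorem gker_left₁ (s s' p q : ℂ) (r m i j : ℕ) :
    ((Real.sqrt (r + 1) : ℝ) : ℂ) * gker s s' p q (r + 1, m) (i, j) =
    s * (((Real.sqrt m : ℝ) : ℂ) * gker s s' p q (r, m - 1) (i, j)) +
      p * (((Real.sqrt i : ℝ) : ℂ) * gker s s' p q (r, m) (i - 1, j)) := by
  obtain ⟨B, hB⟩ := (rapid_diag_coef p q s' (i, j)).bounded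
  rw [gker, ← pair_smul_left, coef_succ_left,
    pair_add_left (rapid_coef _ _).raise₁ ((rapid_coef _ _).smul _) hB, pair_raise₁, lower₁_diag,
    lower₁_coef, diag_smul, pair_smul_right, pair_smul_right, pair_smul_left]
  simp only [gker]; ring

theorem gker_left₂ (s s' p q : ℂ) (r m i j : ℕ) :
    ((Real.sqrt (m + 1) : ℝ) : ℂ) * gker s s' p q (r, m + 1) (i, j) =
    s * (((Real.sqrt r : ℝ) : ℂ) * gker s s' p q (r - 1, m) (i, j)) +
      q * (((Real.sqrt j : ℝ) : ℂ) * gker s s' p q (r, m) (i, j - 1)) := by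
  obtain ⟨B, hB⟩ := (rapid_diag_coef p q s' (i, j)).bounded
  rw [gker, ← pair_smul_left, coef_succ_right,
    pair_add_left (rapid_coef _ _).raise₂ ((rapid_coef _ _).smul _) hB, pair_raise₂, lower₂_diag,
    lower₂_coef, diag_smul, pair_smul_right, pair_smul_right, pair_smul_left]
  simp only [gker]; ring

theorem ladderRel_gker (s s' p q : ℂ) : LadderRel p q s s' (gker s s' p q) where
  left₁ := gker_left₁ s s' p q
  left₂ := gker_left₂ s s' p q
  right₁ r m i j := by simpa only [gker_symm s s'] using gker_left₁ s' s p q i j r m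
  right₂ r m i j := by simpa only [gker_symm s s'] using gker_left₂ s' s p q i j r m

theorem gker_zero_left (s s' p q : ℂ) (y : ℕ × ℕ) : gker s s' p q (0, 0) y = coef s' y (0, 0) := by
  rw [gker, pair, tsum_eq_single (0, 0)]
  · simp [coef_zero_zero, diag]
  · intro w hw; simp [coef_zero_zero, hw]

theorem gker_zero_zero (s s' p q : ℂ) : gker s s' p q (0, 0) (0, 0) = 1 := by
  rw [gker_zero_left, coef_zero_zero, if_pos rfl]

theorem gker_of_zero (p q : ℂ) (x y : ℕ × ℕ) :
    gker 0 0 p q x y = if x = y then p ^ x.1 * q ^ x.2 else 0 := by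
  have hc : ∀ x w : ℕ × ℕ, coef 0 x w = if w = x then 1 else 0 := by
    rintro ⟨r, m⟩ ⟨u, v⟩
    by_cases h : (u, v) = (r, m)
    · obtain ⟨rfl, rfl⟩ := Prod.mk.inj h
      simp [coef, add_comm]
    · rw [if_neg h]
      by_cases h2 : r < u ∨ m < v
      · exact coef_eq_zero_of_lt h2
      · unfold coef
        push Not at h2
        split_ifs with h3
        · have : r - u ≠ 0 := by
            intro h4
            simp only at h2 h3
            exact h (Prod.ext (by simp; omega) (by simp; omega))
          simp [zero_pow this]
        · rfl
  rw [gker, pair, tsum_eq_single x]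
  · simp [hc, diag]
  · intro w hw; simp [hc, hw]

/-- Gaussian matrix elements are finite sums, so estimating, conjugating and differentiating them
involves no limit. -/
theorem pair_eq_sum_box {f : Seq} (x : ℕ × ℕ) (hf : ∀ w : ℕ × ℕ, x.1 < w.1 ∨ x.2 < w.2 → f w = 0)
    (g : Seq) : pair f g = ∑ w ∈ Finset.range (x.1 + 1) ×ˢ Finset.range (x.2 + 1), f w * g w := by
  rw [pair, tsum_eq_sum]
  intro w hw
  rw [hf w, zero_mul]
  simp only [Finset.mem_product, Finset.mem_range] at hw
  omega

/-- The product rule for `G = exp (s a†b†) p^n₁ q^n₂ exp (s' ab)`: the four partial derivatives are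
`a†b† G`, `G ab`, `a† G a` and `b† G b`. -/
theorem hasDerivAt_gker {s s' p q : ℝ → ℂ} {ds ds' dp dq : ℂ} {t : ℝ} (hs : HasDerivAt s ds t)
    (hs' : HasDerivAt s' ds' t) (hp : HasDerivAt p dp t) (hq : HasDerivAt q dq t) (r m i j : ℕ) :
    HasDerivAt (fun t => gker (s t) (s' t) (p t) (q t) (r, m) (i, j))
      (ds * (((Real.sqrt r : ℝ) : ℂ) * ((Real.sqrt m : ℝ) : ℂ) *
          gker (s t) (s' t) (p t) (q t) (r - 1, m - 1) (i, j)) +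
        ds' * (((Real.sqrt i : ℝ) : ℂ) * ((Real.sqrt j : ℝ) : ℂ) *
          gker (s t) (s' t) (p t) (q t) (r, m) (i - 1, j - 1)) +
        dp * (((Real.sqrt r : ℝ) : ℂ) * ((Real.sqrt i : ℝ) : ℂ) *
          gker (s t) (s' t) (p t) (q t) (r - 1, m) (i - 1, j)) +
        dq * (((Real.sqrt m : ℝ) : ℂ) * ((Real.sqrt j : ℝ) : ℂ) *
          gker (s t) (s' t) (p t) (q t) (r, m - 1) (i, j - 1))) t := by
  have hbox : ∀ (s : ℂ) (w : ℕ × ℕ), r < w.1 ∨ m < w.2 → coef s (r, m) w = 0 :=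
    fun s w h => coef_eq_zero_of_lt h
  have hbox' : ∀ (s : ℂ) (w : ℕ × ℕ), r < w.1 ∨ m < w.2 → coef s (r - 1, m - 1) w = 0 :=
    fun s w h => coef_eq_zero_of_lt (by simp only; omega)
  have e0 : (fun t => gker (s t) (s' t) (p t) (q t) (r, m) (i, j)) = fun t =>
      ∑ w ∈ Finset.range (r + 1) ×ˢ Finset.range (m + 1), coef (s t) (r, m) w *
        diag (p t) (q t) (coef (s' t) (i, j)) w :=
    funext fun t => pair_eq_sum_box (r, m) (hbox _) _
  -- The derivative of `p^n₁` is `n₁ p^(n₁ - 1) = a† p^n₁ a`, and the outer ladder operators pass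
  -- through the exponentials.
  have ep : ((Real.sqrt r : ℝ) : ℂ) * ((Real.sqrt i : ℝ) : ℂ) *
      gker (s t) (s' t) (p t) (q t) (r - 1, m) (i - 1, j) =
      ∑ w ∈ Finset.range (r + 1) ×ˢ Finset.range (m + 1), coef (s t) (r, m) w *
        ((w.1 : ℂ) * p t ^ (w.1 - 1) * q t ^ w.2 * coef (s' t) (i, j) w) := by
    rw [mul_assoc, gker, ← pair_smul_right, ← pair_smul_left, ← diag_smul, ← lower₁_coef,
      ← lower₁_coef, pair_lower₁, pair_eq_sum_box (r, m) (hbox _)]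
    refine Finset.sum_congr rfl fun w _ => ?_
    obtain ⟨_ | u, v⟩ := w
    · simp [raise₁_apply]
    · have h := sqrt_succ_mul_self_complex u
      simp only [raise₁_apply, diag, lower₁_apply, Nat.add_sub_cancel]
      push_cast
      linear_combination coef (s t) (r, m) (u + 1, v) * p t ^ u * q t ^ v *
        coef (s' t) (i, j) (u + 1, v) * h
  have eq : ((Real.sqrt m : ℝ) : ℂ) * ((Real.sqrt j : ℝ) : ℂ) *
      gker (s t) (s' t) (p t) (q t) (r, m - 1) (i, j - 1) =
      ∑ w ∈ Finset.range (r + 1) ×ˢ Finset.range (m + 1), coef (s t) (r, m) w *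
        (p t ^ w.1 * ((w.2 : ℂ) * q t ^ (w.2 - 1)) * coef (s' t) (i, j) w) := by
    rw [mul_assoc, gker, ← pair_smul_right, ← pair_smul_left, ← diag_smul, ← lower₂_coef,
      ← lower₂_coef, pair_lower₂, pair_eq_sum_box (r, m) (hbox _)]
    refine Finset.sum_congr rfl fun w _ => ?_
    obtain ⟨u, _ | v⟩ := w
    · simp [raise₂_apply]
    · have h := sqrt_succ_mul_self_complex v
      simp only [raise₂_apply, diag, lower₂_apply, Nat.add_sub_cancel]
      push_cast
      linear_combination coef (s t) (r, m) (u, v + 1) * p t ^ u * q t ^ v *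
        coef (s' t) (i, j) (u, v + 1) * h
  rw [e0, ep, eq, gker, pair_eq_sum_box (r, m) (hbox' _), gker, pair_eq_sum_box (r, m) (hbox _)]
  simp only [Finset.mul_sum, ← Finset.sum_add_distrib]
  refine HasDerivAt.fun_sum fun w _ => ?_
  have d1 : HasDerivAt (fun t => coef (s t) (r, m) w) _ t :=
    HasDerivAt.comp t (hasDerivAt_coef (s t) r m w) hs
  have d2 : HasDerivAt (fun t => coef (s' t) (i, j) w) _ t :=
    HasDerivAt.comp t (hasDerivAt_coef (s' t) i j w) hs'
  refine (d1.fun_mul (((hp.fun_pow w.1).fun_mul (hq.fun_pow w.2)).fun_mul d2)).congr_deriv ?_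
  simp only [diag]
  ring

/-! ### Decay of Gaussian kernels -/

theorem exists_bound_wt_pow {ρ : ℝ} (h0 : 0 ≤ ρ) (h1 : ρ < 1) (n : ℕ) :
    ∃ B, ∀ x : ℕ × ℕ, wt x ^ n * ρ ^ (x.1 + x.2) ≤ B := by
  have h := tendsto_pow_const_mul_const_pow_of_lt_one n h0 h1
  obtain ⟨B, hB⟩ := h.bddAbove_range
  by_cases hρ : ρ = 0
  · refine ⟨1, fun x => ?_⟩
    subst hρ
    by_cases hx : x.1 + x.2 = 0
    · have h1 : x.1 = 0 := by omega
      have h2 : x.2 = 0 := by omega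
      simp [wt, h1, h2]
    · simp [zero_pow hx]
  have hpos : 0 < ρ := lt_of_le_of_ne h0 (Ne.symm hρ)
  -- The bound for `n ↦ n^k ρ^n` is used at `x.1 + x.2 + 1`, which is the weight; dividing by `ρ`
  -- restores the exponent.
  refine ⟨B / ρ, fun x => ?_⟩
  rw [le_div_iff₀ hpos]
  have := hB ⟨x.1 + x.2 + 1, rfl⟩
  simp only at this
  push_cast at this
  rw [wt, mul_assoc, ← pow_succ]
  rwa [show (1 : ℝ) + x.1 + x.2 = x.1 + x.2 + 1 by ring]

/-- The weight `p₀^w.1 q₀^w.2` is shared equally between the squares of the two coefficients, so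
that each summand is a geometric mean of two quantities bounded by `norm_coef_sq_le`. There are at
most `wt x ^ 2` summands. -/
theorem norm_gker_le {s s' p q : ℂ} {p₀ q₀ δ ε ρ : ℝ} (hδ : 0 ≤ δ) (hε : 0 ≤ ε) (hρ : 0 ≤ ρ)
    (hs : ‖s‖ ^ 2 ≤ δ * ε) (hs' : ‖s'‖ ^ 2 ≤ δ * ε) (hp : ‖p‖ ≤ p₀) (hq : ‖q‖ ≤ q₀)
    (h1 : p₀ + δ ≤ ρ ^ 2) (h2 : q₀ + ε ≤ ρ ^ 2) (x y : ℕ × ℕ) :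
    ‖gker s s' p q x y‖ ≤ wt x ^ 2 * (ρ ^ (x.1 + x.2) * ρ ^ (y.1 + y.2)) := by
  have hp0 : 0 ≤ p₀ := (norm_nonneg _).trans hp
  have hq0 : 0 ≤ q₀ := (norm_nonneg _).trans hq
  have hb : ∀ (s : ℂ) (x w : ℕ × ℕ), ‖s‖ ^ 2 ≤ δ * ε →
      ‖coef s x w‖ ^ 2 * (p₀ ^ w.1 * q₀ ^ w.2) ≤ (ρ ^ (x.1 + x.2)) ^ 2 := by
    intro s x w hs
    refine (norm_coef_sq_le s x w hp0 hq0 hδ hε hs).trans ?_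
    calc (p₀ + δ) ^ x.1 * (q₀ + ε) ^ x.2 ≤ (ρ ^ 2) ^ x.1 * (ρ ^ 2) ^ x.2 := by gcongr
      _ = (ρ ^ (x.1 + x.2)) ^ 2 := by ring
  rw [gker, pair_eq_sum_box x (fun w h => coef_eq_zero_of_lt h)]
  have hterm : ∀ w ∈ Finset.range (x.1 + 1) ×ˢ Finset.range (x.2 + 1),
      ‖coef s x w * diag p q (coef s' y) w‖ ≤ ρ ^ (x.1 + x.2) * ρ ^ (y.1 + y.2) := by
    intro w _
    refine abs_le_of_sq_le_sq' ?_ (by positivity) |>.2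
    calc ‖coef s x w * diag p q (coef s' y) w‖ ^ 2
        = ‖coef s x w‖ ^ 2 * (‖p‖ ^ w.1 * ‖q‖ ^ w.2) ^ 2 * ‖coef s' y w‖ ^ 2 := by
          simp only [diag, norm_mul, norm_pow]; ring
      _ ≤ ‖coef s x w‖ ^ 2 * (p₀ ^ w.1 * q₀ ^ w.2) ^ 2 * ‖coef s' y w‖ ^ 2 := by gcongr
      _ = (‖coef s x w‖ ^ 2 * (p₀ ^ w.1 * q₀ ^ w.2)) *
            (‖coef s' y w‖ ^ 2 * (p₀ ^ w.1 * q₀ ^ w.2)) := by ring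
      _ ≤ (ρ ^ (x.1 + x.2)) ^ 2 * (ρ ^ (y.1 + y.2)) ^ 2 :=
          mul_le_mul (hb s x w hs) (hb s' y w hs') (by positivity) (by positivity)
      _ = _ := by ring
  refine (norm_sum_le_of_le _ hterm).trans ?_
  rw [Finset.sum_const, nsmul_eq_mul, Finset.card_product, Finset.card_range, Finset.card_range]
  gcongr
  push_cast
  rw [wt]
  nlinarith [Nat.cast_nonneg (α := ℝ) x.1, Nat.cast_nonneg (α := ℝ) x.2]

theorem rapidDecay_gker {U : Type*} {s s' p q : U → ℂ} {p₀ q₀ δ ε ρ : ℝ} (hδ : 0 ≤ δ) (hε : 0 ≤ ε)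
    (hρ : 0 ≤ ρ) (hρ1 : ρ < 1) (hs : ∀ u, ‖s u‖ ^ 2 ≤ δ * ε) (hs' : ∀ u, ‖s' u‖ ^ 2 ≤ δ * ε)
    (hp : ∀ u, ‖p u‖ ≤ p₀) (hq : ∀ u, ‖q u‖ ≤ q₀) (h1 : p₀ + δ ≤ ρ ^ 2) (h2 : q₀ + ε ≤ ρ ^ 2) :
    RapidDecay (fun t : U × (ℕ × ℕ) => wt t.2)
      (fun t x => gker (s t.1) (s' t.1) (p t.1) (q t.1) x t.2) := by
  intro n
  obtain ⟨B, hB⟩ := exists_bound_wt_pow hρ hρ1 (n + 2)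
  obtain ⟨B', hB'⟩ := exists_bound_wt_pow hρ hρ1 n
  refine ⟨B * B', fun t x => ?_⟩
  have w1 := wt_pos x
  have w2 := wt_pos t.2
  calc _ ≤ wt x ^ 2 * (ρ ^ (x.1 + x.2) * ρ ^ (t.2.1 + t.2.2)) * (wt x * wt t.2) ^ n := by
        gcongr
        exact norm_gker_le hδ hε hρ (hs _) (hs' _) (hp _) (hq _) h1 h2 x t.2
    _ = (wt x ^ (n + 2) * ρ ^ (x.1 + x.2)) * (wt t.2 ^ n * ρ ^ (t.2.1 + t.2.2)) := by ring
    _ ≤ B * B' := mul_le_mul (hB x) (hB' t.2) (by positivity) (le_trans (by positivity) (hB x))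

theorem rapid_coef_right {s : ℂ} (hs : ‖s‖ < 1) (w : ℕ × ℕ) : Rapid (fun x => coef s x w) := by
  -- With `δ = ε = ‖s‖` this `p` is positive and keeps `p + ‖s‖` below `1`.
  set p : ℝ := (1 - ‖s‖) / 2 with hp
  have hp0 : 0 < p := by rw [hp]; linarith
  set ρ : ℝ := Real.sqrt (p + ‖s‖) with hρ
  have hsum : 0 ≤ p + ‖s‖ := by positivity
  have hρ0 : 0 ≤ ρ := Real.sqrt_nonneg _
  have hρ1 : ρ < 1 := by
    rw [hρ, Real.sqrt_lt' one_pos]; rw [hp]; linarith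
  have hb : ∀ x : ℕ × ℕ, ‖coef s x w‖ ≤ (Real.sqrt (p ^ (w.1 + w.2)))⁻¹ * ρ ^ (x.1 + x.2) := by
    intro x
    have h := norm_coef_sq_le s x w hp0.le hp0.le (norm_nonneg s) (norm_nonneg s) (by rw [sq])
    rw [← pow_add, ← pow_add, ← Real.sq_sqrt hsum, ← hρ] at h
    have hq : 0 < p ^ (w.1 + w.2) := by positivity
    rw [inv_mul_eq_div, le_div_iff₀ (Real.sqrt_pos.mpr hq)]
    refine abs_le_of_sq_le_sq' ?_ (by positivity) |>.2
    rw [mul_pow, Real.sq_sqrt hq.le]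
    refine h.trans (le_of_eq ?_)
    ring
  intro n
  obtain ⟨B, hB⟩ := exists_bound_wt_pow hρ0 hρ1 n
  refine ⟨(Real.sqrt (p ^ (w.1 + w.2)))⁻¹ * B, fun _ x => ?_⟩
  have w1 := wt_pos x
  calc _ ≤ (Real.sqrt (p ^ (w.1 + w.2)))⁻¹ * ρ ^ (x.1 + x.2) * (wt x * 1) ^ n := by
        gcongr; exact hb x
    _ = (Real.sqrt (p ^ (w.1 + w.2)))⁻¹ * (wt x ^ n * ρ ^ (x.1 + x.2)) := by ring
    _ ≤ _ := by gcongr; exact hB x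

/-- For a fixed column only finitely many intermediate states contribute, so the decay comes from
`exp (s a†b†)` alone. The squeezers need this version: a unitary kernel cannot decay jointly in both
indices. -/
theorem rapid_gker {s s' p q : ℂ} (hs : ‖s‖ < 1) (y : ℕ × ℕ) :
    Rapid (fun x => gker s s' p q x y) := by
  have e : (fun x => gker s s' p q x y) = ∑ w ∈ Finset.range (y.1 + 1) ×ˢ Finset.range (y.2 + 1),
      (diag p q (coef s' y) w) • (fun x => coef s x w) := by
    ext x
    rw [gker, pair_comm, pair_eq_sum_box y
      (fun w h => by rw [diag, coef_eq_zero_of_lt h, mul_zero]), Finset.sum_apply]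
    rfl
  rw [e]
  refine Finset.sum_induction _ Rapid (fun _ _ h h' => h.add h') ?_
    (fun w _ => (rapid_coef_right hs w).smul _)
  exact Rapid.of_finite_support (0, 0) fun _ _ => rfl

/-! ### The two-mode squeezer: matrix elements -/

theorem conj_coef (s : ℝ) (x w : ℕ × ℕ) : (starRingEnd ℂ) (coef s x w) = coef s x w := by
  unfold coef; split_ifs <;> simp

theorem conj_gker (s s' p q : ℝ) (x y : ℕ × ℕ) :
    (starRingEnd ℂ) (gker s s' p q x y) = gker s s' p q x y := by
  rw [gker, pair_eq_sum_box x (fun w h => coef_eq_zero_of_lt h), map_sum]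
  refine Finset.sum_congr rfl fun w _ => ?_
  simp only [diag, map_mul, map_pow, Complex.conj_ofReal, conj_coef]

/-- The matrix elements `⟨x| S(ω) |y⟩` of the two-mode squeezer. -/
def sqk (ω : ℝ) (x y : ℕ × ℕ) : ℂ :=
  (((Real.cosh ω)⁻¹ : ℝ) : ℂ) * gker ((-Real.tanh ω : ℝ) : ℂ) ((Real.tanh ω : ℝ) : ℂ)
    (((Real.cosh ω)⁻¹ : ℝ) : ℂ) (((Real.cosh ω)⁻¹ : ℝ) : ℂ) x y

theorem ladderRel_sqk (ω : ℝ) : LadderRel (((Real.cosh ω)⁻¹ : ℝ) : ℂ) (((Real.cosh ω)⁻¹ : ℝ) : ℂ)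
    ((-Real.tanh ω : ℝ) : ℂ) ((Real.tanh ω : ℝ) : ℂ) (sqk ω) :=
  (ladderRel_gker _ _ _ _).const_mul _

theorem conj_sqk (ω : ℝ) (x y : ℕ × ℕ) : (starRingEnd ℂ) (sqk ω x y) = sqk ω x y := by
  rw [sqk, map_mul, conj_gker, Complex.conj_ofReal]

theorem sqk_neg (ω : ℝ) (x y : ℕ × ℕ) : sqk (-ω) x y = sqk ω y x := by
  rw [sqk, gker_symm, sqk, Real.cosh_neg, Real.tanh_neg, neg_neg]

theorem sqk_zero (x y : ℕ × ℕ) : sqk 0 x y = if x = y then 1 else 0 := by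
  simp [sqk, gker_of_zero]

theorem rapid_sqk (ω : ℝ) (y : ℕ × ℕ) : Rapid (fun x => sqk ω x y) := by
  refine (rapid_gker ?_ y).smul _
  rw [Complex.norm_real, norm_neg, Real.norm_eq_abs]
  exact Real.abs_tanh_lt_one ω

/-- The sequence of amplitudes of `S(ω) v`. -/
def sqSeq (ω : ℝ) : FinFock →ₗ[ℂ] Seq := Finsupp.linearCombination ℂ (fun y x => sqk ω x y)

theorem sqSeq_single (ω : ℝ) (y : ℕ × ℕ) (c : ℂ) :
    sqSeq ω (Finsupp.single y c) = c • fun x => sqk ω x y := by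
  simp [sqSeq]

theorem rapid_sqSeq (ω : ℝ) (v : FinFock) : Rapid (sqSeq ω v) := by
  induction v using Finsupp.induction_linear with
  | zero => rw [map_zero]; exact Rapid.of_finite_support (0, 0) fun _ _ => rfl
  | add v w hv hw => rw [map_add]; exact hv.add hw
  | single y c => rw [sqSeq_single]; exact (rapid_sqk ω y).smul c

theorem cosh_mul_inv_cosh (ω : ℝ) : (Real.cosh ω : ℂ) * (((Real.cosh ω)⁻¹ : ℝ) : ℂ) = 1 := by
  rw [← Complex.ofReal_mul, mul_inv_cancel₀ (Real.cosh_pos ω).ne', Complex.ofReal_one]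

theorem cosh_mul_tanh (ω : ℝ) : (Real.cosh ω : ℂ) * (Real.tanh ω : ℂ) = Real.sinh ω := by
  rw [← Complex.ofReal_mul, Real.tanh_eq_sinh_div_cosh, mul_div_cancel₀ _ (Real.cosh_pos ω).ne']

theorem cosh_sq_sub_sinh_sq_complex (ω : ℝ) : (Real.cosh ω : ℂ) ^ 2 - (Real.sinh ω : ℂ) ^ 2 = 1 := by
  rw [← Complex.ofReal_pow, ← Complex.ofReal_pow, ← Complex.ofReal_sub, Real.cosh_sq_sub_sinh_sq,
    Complex.ofReal_one]

/-- The Bogoliubov relation `a† S = S (cosh ω a† - sinh ω b)`, which is a ladder relation solved for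
the operator on the left of the kernel. -/
theorem raise₁_sqSeq (ω : ℝ) (v : FinFock) : raise₁ (sqSeq ω v) =
    sqSeq ω ((Real.cosh ω : ℂ) • cre₁ v - (Real.sinh ω : ℂ) • ann₂ v) := by
  induction v using Finsupp.induction_linear with
  | zero => simp
  | add v w hv hw => simp only [map_add, hv, hw, smul_add, map_sub]; abel
  | single y c =>
    obtain ⟨i, j⟩ := y
    simp only [cre₁_single, ann₂_single, map_sub, map_smul, sqSeq_single]
    ext ⟨r, m⟩
    simp only [raise₁_apply, Pi.smul_apply, Pi.sub_apply, smul_eq_mul]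
    have h := (ladderRel_sqk ω).right₁ r m i j
    linear_combination (-c * Real.cosh ω) * h -
      c * (((Real.sqrt r : ℝ) : ℂ) * sqk ω (r - 1, m) (i, j)) * cosh_mul_inv_cosh ω -
      c * (((Real.sqrt j : ℝ) : ℂ) * sqk ω (r, m) (i, j - 1)) * cosh_mul_tanh ω

theorem raise₂_sqSeq (ω : ℝ) (v : FinFock) : raise₂ (sqSeq ω v) =
    sqSeq ω ((Real.cosh ω : ℂ) • cre₂ v - (Real.sinh ω : ℂ) • ann₁ v) := by
  induction v using Finsupp.induction_linear with
  | zero => simp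
  | add v w hv hw => simp only [map_add, hv, hw, smul_add, map_sub]; abel
  | single y c =>
    obtain ⟨i, j⟩ := y
    simp only [cre₂_single, ann₁_single, map_sub, map_smul, sqSeq_single]
    ext ⟨r, m⟩
    simp only [raise₂_apply, Pi.smul_apply, Pi.sub_apply, smul_eq_mul]
    have h := (ladderRel_sqk ω).right₂ r m i j
    linear_combination (-c * Real.cosh ω) * h -
      c * (((Real.sqrt m : ℝ) : ℂ) * sqk ω (r, m - 1) (i, j)) * cosh_mul_inv_cosh ω -
      c * (((Real.sqrt i : ℝ) : ℂ) * sqk ω (r, m) (i - 1, j)) * cosh_mul_tanh ω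

theorem cosh_sub_sinh_mul_tanh (ω : ℝ) :
    (Real.cosh ω : ℂ) - Real.sinh ω * Real.tanh ω = (((Real.cosh ω)⁻¹ : ℝ) : ℂ) := by
  refine mul_left_cancel₀ (Complex.ofReal_ne_zero.mpr (Real.cosh_pos ω).ne') ?_
  linear_combination cosh_sq_sub_sinh_sq_complex ω - cosh_mul_inv_cosh ω -
    Real.sinh ω * cosh_mul_tanh ω

theorem inv_cosh_mul_sinh (ω : ℝ) :
    (((Real.cosh ω)⁻¹ : ℝ) : ℂ) * Real.sinh ω = Real.tanh ω := by
  rw [← Complex.ofReal_mul, Real.tanh_eq_sinh_div_cosh, inv_mul_eq_div]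

theorem lower₁_sqSeq (ω : ℝ) (v : FinFock) : lower₁ (sqSeq ω v) =
    sqSeq ω ((Real.cosh ω : ℂ) • ann₁ v - (Real.sinh ω : ℂ) • cre₂ v) := by
  induction v using Finsupp.induction_linear with
  | zero => simp
  | add v w hv hw => simp only [map_add, hv, hw, smul_add, map_sub]; abel
  | single y c =>
    obtain ⟨i, j⟩ := y
    simp only [cre₂_single, ann₁_single, map_sub, map_smul, sqSeq_single]
    ext ⟨r, m⟩
    simp only [lower₁_apply, Pi.smul_apply, Pi.sub_apply, smul_eq_mul]
    have h := (ladderRel_sqk ω).left₁ r m i j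
    have h' := (ladderRel_sqk ω).right₂ r m i j
    rw [Complex.ofReal_neg] at h
    linear_combination c * h + c * Real.sinh ω * h' -
      c * (((Real.sqrt i : ℝ) : ℂ) * sqk ω (r, m) (i - 1, j)) * cosh_sub_sinh_mul_tanh ω +
      c * (((Real.sqrt m : ℝ) : ℂ) * sqk ω (r, m - 1) (i, j)) * inv_cosh_mul_sinh ω

theorem lower₂_sqSeq (ω : ℝ) (v : FinFock) : lower₂ (sqSeq ω v) =
    sqSeq ω ((Real.cosh ω : ℂ) • ann₂ v - (Real.sinh ω : ℂ) • cre₁ v) := by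
  induction v using Finsupp.induction_linear with
  | zero => simp
  | add v w hv hw => simp only [map_add, hv, hw, smul_add, map_sub]; abel
  | single y c =>
    obtain ⟨i, j⟩ := y
    simp only [cre₁_single, ann₂_single, map_sub, map_smul, sqSeq_single]
    ext ⟨r, m⟩
    simp only [lower₂_apply, Pi.smul_apply, Pi.sub_apply, smul_eq_mul]
    have h := (ladderRel_sqk ω).left₂ r m i j
    have h' := (ladderRel_sqk ω).right₁ r m i j
    rw [Complex.ofReal_neg] at h
    linear_combination c * h + c * Real.sinh ω * h' -
      c * (((Real.sqrt j : ℝ) : ℂ) * sqk ω (r, m) (i, j - 1)) * cosh_sub_sinh_mul_tanh ω +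
      c * (((Real.sqrt r : ℝ) : ℂ) * sqk ω (r - 1, m) (i, j)) * inv_cosh_mul_sinh ω

theorem sqSeq_cre₁ (ω : ℝ) (v : FinFock) : sqSeq ω (cre₁ v) =
    (Real.cosh ω : ℂ) • raise₁ (sqSeq ω v) + (Real.sinh ω : ℂ) • lower₂ (sqSeq ω v) := by
  rw [raise₁_sqSeq, lower₂_sqSeq]
  simp only [map_sub, map_smul]
  have h := cosh_sq_sub_sinh_sq_complex ω
  linear_combination (norm := module) (-h) • sqSeq ω (cre₁ v)

theorem sqSeq_cre₂ (ω : ℝ) (v : FinFock) : sqSeq ω (cre₂ v) =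
    (Real.cosh ω : ℂ) • raise₂ (sqSeq ω v) + (Real.sinh ω : ℂ) • lower₁ (sqSeq ω v) := by
  rw [raise₂_sqSeq, lower₁_sqSeq]
  simp only [map_sub, map_smul]
  have h := cosh_sq_sub_sinh_sq_complex ω
  linear_combination (norm := module) (-h) • sqSeq ω (cre₂ v)

theorem sqSeq_ann₁ (ω : ℝ) (v : FinFock) : sqSeq ω (ann₁ v) =
    (Real.cosh ω : ℂ) • lower₁ (sqSeq ω v) + (Real.sinh ω : ℂ) • raise₂ (sqSeq ω v) := by
  rw [lower₁_sqSeq, raise₂_sqSeq]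
  simp only [map_sub, map_smul]
  have h := cosh_sq_sub_sinh_sq_complex ω
  linear_combination (norm := module) (-h) • sqSeq ω (ann₁ v)

theorem sqSeq_ann₂ (ω : ℝ) (v : FinFock) : sqSeq ω (ann₂ v) =
    (Real.cosh ω : ℂ) • lower₂ (sqSeq ω v) + (Real.sinh ω : ℂ) • raise₁ (sqSeq ω v) := by
  rw [lower₂_sqSeq, raise₁_sqSeq]
  simp only [map_sub, map_smul]
  have h := cosh_sq_sub_sinh_sq_complex ω
  linear_combination (norm := module) (-h) • sqSeq ω (ann₂ v)

theorem coef_right_zero (s : ℂ) (r m : ℕ) : coef s (r, m) (0, 0) = if r = m then s ^ r else 0 := by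
  simp [coef]

theorem sqk_right_zero (ω : ℝ) (x : ℕ × ℕ) : sqk ω x (0, 0) =
    (((Real.cosh ω)⁻¹ : ℝ) : ℂ) * coef ((-Real.tanh ω : ℝ) : ℂ) x (0, 0) := by
  rw [sqk, gker_symm, gker_zero_left]

/-- Squeezed vacua live on the diagonal `|j j⟩` with geometric amplitudes; the series in `tanh α
tanh β` is summed with the addition formula for `cosh (α - β)`. -/
theorem pair_sqk_zero (α β : ℝ) :
    pair (fun x => sqk α x (0, 0)) (fun x => sqk β x (0, 0)) = (((Real.cosh (β - α))⁻¹ : ℝ) : ℂ) := by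
  have hinj : Function.Injective fun j : ℕ => (j, j) := fun a b h => (Prod.mk.inj h).1
  have hlt : |Real.tanh α * Real.tanh β| < 1 := by
    rw [abs_mul]
    exact mul_lt_one_of_nonneg_of_lt_one_left (abs_nonneg _) (Real.abs_tanh_lt_one α)
      (Real.abs_tanh_lt_one β).le
  rw [pair, ← hinj.tsum_eq]
  · have e : ∀ j : ℕ, sqk α (j, j) (0, 0) * sqk β (j, j) (0, 0) =
        (((Real.cosh α)⁻¹ * (Real.cosh β)⁻¹ : ℝ) : ℂ) *
          ((Real.tanh α * Real.tanh β : ℝ) : ℂ) ^ j := by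
      intro j
      rw [sqk_right_zero, sqk_right_zero, coef_right_zero, coef_right_zero, if_pos rfl, if_pos rfl]
      push_cast
      rw [neg_pow, neg_pow (Complex.tanh β)]
      have : ((-1 : ℂ) ^ j) * (-1) ^ j = 1 := by rw [← mul_pow]; simp
      rw [mul_pow]
      linear_combination (Complex.cosh α)⁻¹ * (Complex.cosh β)⁻¹ * Complex.tanh α ^ j *
        Complex.tanh β ^ j * this
    rw [tsum_congr e, tsum_mul_left, tsum_geometric_of_norm_lt_one
      (by rw [Complex.norm_real]; exact hlt), ← Complex.ofReal_one, ← Complex.ofReal_sub,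
      ← Complex.ofReal_inv, ← Complex.ofReal_mul, Real.cosh_sub, ← mul_inv, ← mul_inv,
      Real.tanh_eq_sinh_div_cosh, Real.tanh_eq_sinh_div_cosh]
    congr 2
    have h1 := (Real.cosh_pos α).ne'
    have h2 := (Real.cosh_pos β).ne'
    field_simp
  · rintro ⟨r, m⟩ h
    by_cases hrm : r = m
    · exact ⟨r, by rw [hrm]⟩
    · simp [sqk_right_zero, coef_right_zero, hrm] at h

theorem pair_sqSeq_add_right (α β : ℝ) (v w w' : FinFock) :
    pair (sqSeq α v) (sqSeq β (w + w')) = pair (sqSeq α v) (sqSeq β w) +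
      pair (sqSeq α v) (sqSeq β w') := by
  obtain ⟨B, hB⟩ := (rapid_sqSeq α v).bounded
  rw [map_add, pair_add_right (rapid_sqSeq _ _) (rapid_sqSeq _ _) hB]

theorem pair_sqSeq_smul_right (α β : ℝ) (v w : FinFock) (c : ℂ) :
    pair (sqSeq α v) (sqSeq β (c • w)) = c * pair (sqSeq α v) (sqSeq β w) := by
  rw [map_smul, pair_smul_right]

/-- Moving a combination of a lowering and a raising operator across the pairing. -/
theorem pair_comb_left {f f' g g' h : Seq} (c d : ℂ) (hf : Rapid f) (hf' : Rapid f')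
    (hg : Rapid g) (hg' : Rapid g') (hh : Rapid h) {k : Seq} (hk : Rapid k)
    (h1 : pair f h = pair k g) (h2 : pair f' h = pair k g') :
    pair (c • f + d • f') h = pair k (c • g + d • g') := by
  obtain ⟨B, hB⟩ := hh.bounded
  obtain ⟨B', hB'⟩ := hk.bounded
  rw [pair_add_left (hf.smul _) (hf'.smul _) hB, pair_add_right (hg.smul _) (hg'.smul _) hB',
    pair_smul_left, pair_smul_left, pair_smul_right, pair_smul_right, h1, h2]

/-- Moving `a` from one squeezed state to the other composes two Bogoliubov transformations, and the
angles subtract. With its analogue it gives the ladder relations behind the group law. -/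
theorem pair_sqSeq_ann₁_left (α β : ℝ) (v w : FinFock) :
    pair (sqSeq α (ann₁ v)) (sqSeq β w) = (Real.cosh (β - α) : ℂ) * pair (sqSeq α v) (sqSeq β (cre₁ w))
      - (Real.sinh (β - α) : ℂ) * pair (sqSeq α v) (sqSeq β (ann₂ w)) := by
  have hv := rapid_sqSeq α v
  have hw := rapid_sqSeq β w
  rw [sqSeq_ann₁, pair_comb_left _ _ hv.lower₁ hv.raise₂ hw.raise₁ hw.lower₂ hw hv
    (pair_lower₁ _ _) (pair_raise₂ _ _), raise₁_sqSeq, lower₂_sqSeq, ← map_smul (sqSeq β),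
    ← map_smul (sqSeq β), ← map_add (sqSeq β), sub_eq_add_neg ((Real.cosh (β - α) : ℂ) * _), ← neg_mul, ← pair_sqSeq_smul_right,
    ← pair_sqSeq_smul_right, ← pair_sqSeq_add_right]
  congr 2
  rw [Real.cosh_sub, Real.sinh_sub]
  push_cast
  simp only [smul_sub, smul_smul]
  module

theorem pair_sqSeq_ann₂_left (α β : ℝ) (v w : FinFock) :
    pair (sqSeq α (ann₂ v)) (sqSeq β w) = (Real.cosh (β - α) : ℂ) * pair (sqSeq α v) (sqSeq β (cre₂ w))
      - (Real.sinh (β - α) : ℂ) * pair (sqSeq α v) (sqSeq β (ann₁ w)) := by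
  have hv := rapid_sqSeq α v
  have hw := rapid_sqSeq β w
  rw [sqSeq_ann₂, pair_comb_left _ _ hv.lower₂ hv.raise₁ hw.raise₂ hw.lower₁ hw hv
    (pair_lower₂ _ _) (pair_raise₁ _ _), raise₂_sqSeq, lower₁_sqSeq, ← map_smul (sqSeq β),
    ← map_smul (sqSeq β), ← map_add (sqSeq β), sub_eq_add_neg ((Real.cosh (β - α) : ℂ) * _), ← neg_mul, ← pair_sqSeq_smul_right,
    ← pair_sqSeq_smul_right, ← pair_sqSeq_add_right]
  congr 2
  rw [Real.cosh_sub, Real.sinh_sub]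
  push_cast
  simp only [smul_sub, smul_smul]
  module

theorem pair_sqSeq_single (α β : ℝ) (x y : ℕ × ℕ) (c d : ℂ) :
    pair (sqSeq α (Finsupp.single x c)) (sqSeq β (Finsupp.single y d)) =
      c * (d * pair (fun z => sqk α z x) (fun z => sqk β z y)) := by
  rw [sqSeq_single, sqSeq_single, pair_smul_left, pair_smul_right]

theorem pair_sqk_right₁ (α β : ℝ) (r m i j : ℕ) :
    ((Real.sqrt (i + 1) : ℝ) : ℂ) * pair (fun z => sqk α z (r, m)) (fun z => sqk β z (i + 1, j)) =
    (Real.tanh (β - α) : ℂ) * (((Real.sqrt j : ℝ) : ℂ) *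
      pair (fun z => sqk α z (r, m)) (fun z => sqk β z (i, j - 1))) +
    (((Real.cosh (β - α))⁻¹ : ℝ) : ℂ) * (((Real.sqrt r : ℝ) : ℂ) *
      pair (fun z => sqk α z (r - 1, m)) (fun z => sqk β z (i, j))) := by
  have h := pair_sqSeq_ann₁_left α β (Finsupp.single (r, m) 1) (Finsupp.single (i, j) 1)
  simp only [ann₁_single, cre₁_single, ann₂_single, pair_sqSeq_single, one_mul] at h
  refine mul_left_cancel₀ (Complex.ofReal_ne_zero.mpr (Real.cosh_pos (β - α)).ne') ?_
  linear_combination -h - (((Real.sqrt r : ℝ) : ℂ) *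
      pair (fun z => sqk α z (r - 1, m)) (fun z => sqk β z (i, j))) * cosh_mul_inv_cosh (β - α) -
    (((Real.sqrt j : ℝ) : ℂ) *
      pair (fun z => sqk α z (r, m)) (fun z => sqk β z (i, j - 1))) * cosh_mul_tanh (β - α)

theorem pair_sqk_right₂ (α β : ℝ) (r m i j : ℕ) :
    ((Real.sqrt (j + 1) : ℝ) : ℂ) * pair (fun z => sqk α z (r, m)) (fun z => sqk β z (i, j + 1)) =
    (Real.tanh (β - α) : ℂ) * (((Real.sqrt i : ℝ) : ℂ) *
      pair (fun z => sqk α z (r, m)) (fun z => sqk β z (i - 1, j))) +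
    (((Real.cosh (β - α))⁻¹ : ℝ) : ℂ) * (((Real.sqrt m : ℝ) : ℂ) *
      pair (fun z => sqk α z (r, m - 1)) (fun z => sqk β z (i, j))) := by
  have h := pair_sqSeq_ann₂_left α β (Finsupp.single (r, m) 1) (Finsupp.single (i, j) 1)
  simp only [ann₁_single, cre₂_single, ann₂_single, pair_sqSeq_single, one_mul] at h
  refine mul_left_cancel₀ (Complex.ofReal_ne_zero.mpr (Real.cosh_pos (β - α)).ne') ?_
  linear_combination -h - (((Real.sqrt m : ℝ) : ℂ) *
      pair (fun z => sqk α z (r, m - 1)) (fun z => sqk β z (i, j))) * cosh_mul_inv_cosh (β - α) -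
    (((Real.sqrt i : ℝ) : ℂ) *
      pair (fun z => sqk α z (r, m)) (fun z => sqk β z (i - 1, j))) * cosh_mul_tanh (β - α)

/-- The group law of the squeezers, in matrix elements. -/
theorem pair_sqk (α β : ℝ) (x y : ℕ × ℕ) :
    pair (fun z => sqk α z x) (fun z => sqk β z y) = sqk (β - α) x y := by
  have h : LadderRel (((Real.cosh (β - α))⁻¹ : ℝ) : ℂ) (((Real.cosh (β - α))⁻¹ : ℝ) : ℂ)
      ((-Real.tanh (β - α) : ℝ) : ℂ) ((Real.tanh (β - α) : ℝ) : ℂ)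
      (fun x y => pair (fun z => sqk α z x) (fun z => sqk β z y)) := by
    refine ⟨fun r m i j => ?_, fun r m i j => ?_, pair_sqk_right₁ α β, pair_sqk_right₂ α β⟩
    -- The left relations are the right relations with the two squeezers exchanged; `tanh` changes
    -- its sign.
    · have := pair_sqk_right₁ β α i j r m
      rw [← neg_sub β α, Real.tanh_neg, Real.cosh_neg] at this
      simpa only [pair_comm (fun z => sqk α z _)] using this
    · have := pair_sqk_right₂ β α i j r m
      rw [← neg_sub β α, Real.tanh_neg, Real.cosh_neg] at this
      simpa only [pair_comm (fun z => sqk α z _)] using this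
  refine congrFun (congrFun (h.unique (ladderRel_sqk (β - α)) ?_) x) y
  rw [pair_sqk_zero, sqk, gker_zero_zero, mul_one]

/-! ### The two-mode squeezer: operator -/

/-- A rapidly decreasing sequence as an element of the Fock space. -/
def Rapid.toFock {f : Seq} (hf : Rapid f) : Fock := ⟨f, hf.memℓp⟩

theorem Rapid.coe_toFock {f : Seq} (hf : Rapid f) : (⇑hf.toFock : Seq) = f := rfl

theorem inner_eq_pair (φ ψ : Fock) :
    ⟪φ, ψ⟫_ℂ = pair (fun x => (starRingEnd ℂ) (φ x)) ⇑ψ := by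
  rw [lp.inner_eq_tsum, pair]
  exact tsum_congr fun x => by rw [RCLike.inner_apply, mul_comm]

theorem orthonormal_sqk (ω : ℝ) : Orthonormal ℂ fun y => (rapid_sqk ω y).toFock := by
  rw [orthonormal_iff_ite]
  intro x y
  rw [inner_eq_pair]
  simp only [Rapid.coe_toFock, conj_sqk]
  rw [pair_sqk, sub_self, sqk_zero]

/-- The two-mode squeezer. -/
def sqOp (ω : ℝ) : Fock →L[ℂ] Fock :=
  (orthonormal_sqk ω).orthogonalFamily.linearIsometry.toContinuousLinearMap

theorem fock_eq_single (x : ℕ × ℕ) : fock x = lp.single 2 x (1 : ℂ) := by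
  rw [← HilbertBasis.repr_symm_single]; rfl

theorem sqOp_fock (ω : ℝ) (y : ℕ × ℕ) : sqOp ω (fock y) = (rapid_sqk ω y).toFock := by
  rw [fock_eq_single]
  refine ((orthonormal_sqk ω).orthogonalFamily.linearIsometry_apply_single (1 : ℂ)).trans ?_
  simp

theorem norm_sqOp (ω : ℝ) (φ : Fock) : ‖sqOp ω φ‖ = ‖φ‖ := LinearIsometry.norm_map _ φ

theorem coe_sqOp_incl (ω : ℝ) (v : FinFock) : (⇑(sqOp ω (incl v)) : Seq) = sqSeq ω v := by
  induction v using Finsupp.induction_linear with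
  | zero => simp only [map_zero]; rfl
  | add v w hv hw => rw [map_add, map_add, map_add, lp.coeFn_add, hv, hw]
  | single y c => rw [incl_single, map_smul, lp.coeFn_smul, sqOp_fock, Rapid.coe_toFock, sqSeq_single]

theorem inner_sqOp (ω : ℝ) (x y : ℕ × ℕ) : ⟪fock x, sqOp ω (fock y)⟫_ℂ = sqk ω x y := by
  rw [inner_fock, sqOp_fock, Rapid.coe_toFock]

theorem star_sqOp (ω : ℝ) : star (sqOp ω) = sqOp (-ω) := by
  refine clm_ext fun x y => ?_
  rw [ContinuousLinearMap.star_eq_adjoint, ContinuousLinearMap.adjoint_inner_right, inner_sqOp,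
    ← inner_conj_symm, inner_sqOp, conj_sqk, sqk_neg]

theorem sqOp_mul (α β : ℝ) : sqOp α * sqOp β = sqOp (α + β) := by
  refine clm_ext fun x y => ?_
  rw [mul_apply_eq_comp, ← ContinuousLinearMap.adjoint_inner_left,
    ← ContinuousLinearMap.star_eq_adjoint, star_sqOp, inner_sqOp, inner_eq_pair, sqOp_fock,
    sqOp_fock]
  simp only [Rapid.coe_toFock, conj_sqk]
  rw [pair_sqk, sub_neg_eq_add, add_comm]

theorem sqOp_zero : sqOp 0 = 1 := by
  refine clm_ext fun x y => ?_
  rw [inner_sqOp, sqk_zero, one_apply_eq_self, inner_fock, fock_apply]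

theorem sqOp_apply_neg (ω : ℝ) (φ : Fock) : sqOp ω (sqOp (-ω) φ) = φ := by
  rw [← mul_apply_eq_comp, sqOp_mul, add_neg_cancel, sqOp_zero,
    one_apply_eq_self]

theorem sqOp_neg_apply (ω : ℝ) (φ : Fock) : sqOp (-ω) (sqOp ω φ) = φ := by
  rw [← mul_apply_eq_comp, sqOp_mul, neg_add_cancel, sqOp_zero,
    one_apply_eq_self]

theorem sqOp_mem_unitary (ω : ℝ) : sqOp ω ∈ unitary (Fock →L[ℂ] Fock) := by
  rw [Unitary.mem_iff, star_sqOp, sqOp_mul, sqOp_mul, neg_add_cancel, add_neg_cancel, sqOp_zero]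
  exact ⟨rfl, rfl⟩

section

/-! ### Quadratic operators and their maximal domain -/

/-- The formal operator `C a†a + D b†b + E a†b† + E' ab + F`. -/
def quad (C D E E' F : ℂ) : Module.End ℂ Seq :=
  C • (raise₁ * lower₁) + D • (raise₂ * lower₂) + E • (raise₁ * raise₂) + E' • (lower₁ * lower₂) +
    F • 1

/-- The operator `C a†a + D b†b + E a†b† + E' ab + F` on finite combinations of Fock states. -/
def finQuad (C D E E' F : ℂ) : Module.End ℂ FinFock :=
  C • (cre₁ * ann₁) + D • (cre₂ * ann₂) + E • (cre₁ * cre₂) + E' • (ann₁ * ann₂) + F • 1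

theorem coe_finQuad (C D E E' F : ℂ) (v : FinFock) :
    (⇑(finQuad C D E E' F v) : Seq) = quad C D E E' F ⇑v := by
  simp only [finQuad, quad, LinearMap.add_apply, LinearMap.smul_apply, Module.End.mul_apply,
    Module.End.one_apply, Finsupp.coe_add, Finsupp.coe_smul, coe_ann₁, coe_ann₂, coe_cre₁, coe_cre₂]

theorem quad_apply (C D E E' F : ℂ) (f : Seq) (r m : ℕ) : quad C D E E' F f (r, m) =
    (C * r + D * m + F) * f (r, m) +
      E * (((Real.sqrt r : ℝ) : ℂ) * ((Real.sqrt m : ℝ) : ℂ) * f (r - 1, m - 1)) +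
      E' * (((Real.sqrt (r + 1) : ℝ) : ℂ) * ((Real.sqrt (m + 1) : ℝ) : ℂ) * f (r + 1, m + 1)) := by
  have h1 : raise₁ (lower₁ f) (r, m) = r * f (r, m) := by
    rcases r with _ | r
    · simp [raise₁_apply]
    · have h := sqrt_succ_mul_self_complex r
      simp only [raise₁_apply, lower₁_apply, Nat.add_sub_cancel]
      push_cast
      linear_combination f (r + 1, m) * h
  have h2 : raise₂ (lower₂ f) (r, m) = m * f (r, m) := by
    rcases m with _ | m
    · simp [raise₂_apply]
    · have h := sqrt_succ_mul_self_complex m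
      simp only [raise₂_apply, lower₂_apply, Nat.add_sub_cancel]
      push_cast
      linear_combination f (r, m + 1) * h
  simp only [quad, LinearMap.add_apply, LinearMap.smul_apply, Module.End.mul_apply,
    Module.End.one_apply, Pi.add_apply, Pi.smul_apply, smul_eq_mul, h1, h2]
  simp only [raise₁_apply, raise₂_apply, lower₁_apply, lower₂_apply]
  ring

/-! ### Linear cutoffs and the core of finite combinations -/

theorem tendsto_of_dominated {f : ℕ → Fock} {φ : Fock} {g : ℕ × ℕ → ℝ}
    (hg : Summable fun x => g x ^ 2) (hb : ∀ n x, ‖f n x‖ ≤ g x)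
    (hf : ∀ x, Tendsto (fun n => f n x) atTop (𝓝 (φ x))) : Tendsto f atTop (𝓝 φ) := by
  have hφ : ∀ x, ‖φ x‖ ≤ g x := fun x => le_of_tendsto' (hf x).norm fun n => hb n x
  have hnorm : ∀ ψ : Fock, ‖ψ‖ ^ 2 = ∑' x, ‖ψ x‖ ^ 2 := by
    intro ψ
    have := lp.norm_rpow_eq_tsum (p := 2) (by simp) ψ
    simpa using this
  have h : Tendsto (fun n => ∑' x, ‖(f n - φ) x‖ ^ 2) atTop (𝓝 (∑' _ : ℕ × ℕ, (0 : ℝ))) := by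
    refine tendsto_tsum_of_dominated_convergence (bound := fun x => 4 * g x ^ 2) (hg.mul_left 4)
      (fun x => ?_) (Eventually.of_forall fun n x => ?_)
    · have h1 : Tendsto (fun n => ‖f n x - φ x‖ ^ 2) atTop (𝓝 (‖φ x - φ x‖ ^ 2)) :=
        (((hf x).sub_const _).norm).pow 2
      simpa using h1
    · rw [Real.norm_of_nonneg (by positivity), lp.coeFn_sub, Pi.sub_apply]
      have h1 := norm_sub_le (f n x) (φ x)
      have h2 := hb n x
      have h3 := hφ x
      calc ‖f n x - φ x‖ ^ 2 ≤ (2 * g x) ^ 2 := by gcongr; linarith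
        _ = 4 * g x ^ 2 := by ring
  simp only [tsum_zero, ← hnorm] at h
  rw [tendsto_iff_norm_sub_tendsto_zero]
  have := h.sqrt
  simpa using this

/-- A linear cutoff function. -/
def cutoff (N : ℕ) (x : ℕ × ℕ) : ℝ := max 0 (1 - (x.1 + x.2) / (N + 1))

theorem cutoff_nonneg (N : ℕ) (x : ℕ × ℕ) : 0 ≤ cutoff N x := le_max_left _ _

theorem cutoff_le_one (N : ℕ) (x : ℕ × ℕ) : cutoff N x ≤ 1 := by
  refine max_le zero_le_one ?_
  have : (0 : ℝ) ≤ (x.1 + x.2) / (N + 1) := by positivity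
  linarith

theorem cutoff_eq_zero {N : ℕ} {x : ℕ × ℕ} (h : N + 1 ≤ x.1 + x.2) : cutoff N x = 0 := by
  refine max_eq_left ?_
  have h' : (N : ℝ) + 1 ≤ x.1 + x.2 := by exact_mod_cast h
  have : 1 ≤ ((x.1 : ℝ) + x.2) / (N + 1) := by rwa [le_div_iff₀ (by positivity), one_mul]
  linarith

theorem tendsto_cutoff (x : ℕ × ℕ) : Tendsto (fun N => cutoff N x) atTop (𝓝 1) := by
  have h : Tendsto (fun N : ℕ => ((x.1 : ℝ) + x.2) / (N + 1)) atTop (𝓝 0) := by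
    have h1 := tendsto_one_div_add_atTop_nhds_zero_nat (𝕜 := ℝ)
    simpa [div_eq_mul_inv] using h1.const_mul ((x.1 : ℝ) + x.2)
  have := (tendsto_const_nhds (x := (0 : ℝ))).max ((tendsto_const_nhds (x := (1 : ℝ))).sub h)
  simpa [cutoff] using this

/-- The off-diagonal coefficient grows linearly in `r + m`, while the cutoff has slope of order `1 /
N` and vanishes for `r + m > N`. Hence the commutator with the cutoff stays bounded uniformly in
`N`; a sharp cutoff would not do. -/
theorem sqrt_mul_cutoff_sub_le (N r m : ℕ) :
    Real.sqrt (r + 1) * Real.sqrt (m + 1) * |cutoff N (r + 1, m + 1) - cutoff N (r, m)| ≤ 3 := by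
  by_cases h : N + 1 ≤ r + m
  · rw [cutoff_eq_zero (x := (r, m)) h, cutoff_eq_zero (x := (r + 1, m + 1)) (by simp only; omega)]
    simp
  have h' : (r : ℝ) + m ≤ N := by
    have : r + m ≤ N := by omega
    exact_mod_cast this
  have hN : (0 : ℝ) < N + 1 := by positivity
  have hd : |cutoff N (r + 1, m + 1) - cutoff N (r, m)| ≤ 2 / (N + 1) := by
    unfold cutoff
    refine (abs_max_sub_max_le_max _ _ _ _).trans ?_
    rw [sub_self, abs_zero]
    refine max_le (by positivity) (le_of_eq ?_)
    push_cast
    rw [show (1 : ℝ) - (r + 1 + (m + 1)) / (N + 1) - (1 - (r + m) / (N + 1)) = -(2 / (N + 1)) by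
      field_simp; ring, abs_neg, abs_of_pos (by positivity)]
  have hs : Real.sqrt (r + 1) * Real.sqrt (m + 1) ≤ (r + 1 + (m + 1)) / 2 := by
    have h1 : (0 : ℝ) ≤ (r : ℝ) + 1 := by positivity
    have h2 : (0 : ℝ) ≤ (m : ℝ) + 1 := by positivity
    nlinarith [Real.sq_sqrt h1, Real.sq_sqrt h2, sq_nonneg (Real.sqrt ((r : ℝ) + 1) - Real.sqrt ((m : ℝ) + 1))]
  calc _ ≤ (r + 1 + (m + 1)) / 2 * (2 / ((N : ℝ) + 1)) := by gcongr
    _ = (r + m + 2) / ((N : ℝ) + 1) := by field_simp; ring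
    _ ≤ 3 := by rw [div_le_iff₀ hN]; linarith [Nat.cast_nonneg (α := ℝ) N]

/-- The truncation of a sequence by the cutoff function. -/
def truncate (N : ℕ) (f : Seq) : FinFock :=
  Finsupp.onFinset (Finset.range (N + 1) ×ˢ Finset.range (N + 1)) (fun x => (cutoff N x : ℂ) * f x)
    (fun x hx => by
      by_contra h
      simp only [Finset.mem_product, Finset.mem_range, not_and_or, not_lt] at h
      exact hx (by rw [cutoff_eq_zero (by omega)]; simp))

theorem truncate_apply (N : ℕ) (f : Seq) (x : ℕ × ℕ) : truncate N f x = (cutoff N x : ℂ) * f x := rfl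

/-- The shift `(r, m) ↦ (r - 1, m - 1)`, zero on the boundary. -/
def shiftDown (f : Seq) : Seq := fun x => if x.1 = 0 ∨ x.2 = 0 then 0 else f (x.1 - 1, x.2 - 1)

theorem injective_succ_succ : Function.Injective fun x : ℕ × ℕ => (x.1 + 1, x.2 + 1) := by
  rintro ⟨a, b⟩ ⟨c, d⟩ h; simpa using h

theorem summable_sq_shiftDown (φ : Fock) : Summable fun x => ‖shiftDown ⇑φ x‖ ^ 2 := by
  have h : Summable fun x => ‖φ x‖ ^ 2 := by
    have := (lp.memℓp φ).summable (by simp)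
    simpa using this
  rw [← injective_succ_succ.summable_iff]
  · refine h.congr fun x => ?_
    simp [shiftDown]
  · intro x hx
    by_cases h0 : x.1 = 0 ∨ x.2 = 0
    · simp [shiftDown, h0]
    · push Not at h0
      exact absurd ⟨(x.1 - 1, x.2 - 1), by ext <;> simp <;> omega⟩ hx

theorem summable_sq_coe (φ : Fock) : Summable fun x => ‖φ x‖ ^ 2 := by
  have := (lp.memℓp φ).summable (by simp)
  simpa using this

variable (C D E E' F : ℂ)

/-- With the cutoff `χ`, `quad (χ f)` is `χ quad f` plus the commutator, whose two off-diagonal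
parts are controlled by shifted copies of `f`. The bound is independent of `N`. -/
theorem norm_quad_truncate_le (f : Seq) (N : ℕ) (x : ℕ × ℕ) :
    ‖quad C D E E' F ⇑(truncate N f) x‖ ≤ ‖quad C D E E' F f x‖ + 3 * ‖E‖ * ‖shiftDown f x‖ +
      3 * ‖E'‖ * ‖f (x.1 + 1, x.2 + 1)‖ := by
  obtain ⟨r, m⟩ := x
  have e : quad C D E E' F ⇑(truncate N f) (r, m) = (cutoff N (r, m) : ℂ) * quad C D E E' F f (r, m) +
      E * (((Real.sqrt r : ℝ) : ℂ) * ((Real.sqrt m : ℝ) : ℂ) *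
        ((cutoff N (r - 1, m - 1) - cutoff N (r, m) : ℝ) : ℂ) * f (r - 1, m - 1)) +
      E' * (((Real.sqrt (r + 1) : ℝ) : ℂ) * ((Real.sqrt (m + 1) : ℝ) : ℂ) *
        ((cutoff N (r + 1, m + 1) - cutoff N (r, m) : ℝ) : ℂ) * f (r + 1, m + 1)) := by
    simp only [quad_apply, truncate_apply]
    push_cast
    ring
  rw [e]
  refine (norm_add_le _ _).trans (add_le_add ((norm_add_le _ _).trans (add_le_add ?_ ?_)) ?_)
  · rw [norm_mul, Complex.norm_real, Real.norm_of_nonneg (cutoff_nonneg _ _)]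
    exact mul_le_of_le_one_left (norm_nonneg _) (cutoff_le_one _ _)
  · by_cases h0 : r = 0 ∨ m = 0
    · have : ((Real.sqrt r : ℝ) : ℂ) * ((Real.sqrt m : ℝ) : ℂ) = 0 := by
        rcases h0 with h | h <;> simp [h]
      rw [this]
      simp only [zero_mul, mul_zero, norm_zero]
      positivity
    · have h1 : shiftDown f (r, m) = f (r - 1, m - 1) := by simp [shiftDown, h0]
      push Not at h0
      obtain ⟨r, rfl⟩ := Nat.exists_eq_succ_of_ne_zero h0.1
      obtain ⟨m, rfl⟩ := Nat.exists_eq_succ_of_ne_zero h0.2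
      rw [h1]
      simp only [norm_mul, Complex.norm_real, Real.norm_eq_abs, abs_of_nonneg (Real.sqrt_nonneg _),
        Nat.succ_eq_add_one, Nat.add_sub_cancel]
      have h2 := sqrt_mul_cutoff_sub_le N r m
      rw [abs_sub_comm] at h2
      push_cast
      calc _ = ‖E‖ * (Real.sqrt (r + 1) * Real.sqrt (m + 1) *
              |cutoff N (r, m) - cutoff N (r + 1, m + 1)|) * ‖f (r, m)‖ := by ring
        _ ≤ ‖E‖ * 3 * ‖f (r, m)‖ := by gcongr
        _ = _ := by ring
  · simp only [norm_mul, Complex.norm_real, Real.norm_eq_abs, abs_of_nonneg (Real.sqrt_nonneg _)]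
    have h2 := sqrt_mul_cutoff_sub_le N r m
    calc _ = ‖E'‖ * (Real.sqrt (r + 1) * Real.sqrt (m + 1) *
            |cutoff N (r + 1, m + 1) - cutoff N (r, m)|) * ‖f (r + 1, m + 1)‖ := by ring
      _ ≤ ‖E'‖ * 3 * ‖f (r + 1, m + 1)‖ := by gcongr
      _ = _ := by ring

theorem summable_sq_add {f g : ℕ × ℕ → ℝ} (hf : Summable fun x => f x ^ 2)
    (hg : Summable fun x => g x ^ 2) : Summable fun x => (f x + g x) ^ 2 := by
  refine ((hf.mul_left 2).add (hg.mul_left 2)).of_nonneg_of_le (fun x => sq_nonneg _) fun x => ?_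
  nlinarith [sq_nonneg (f x - g x)]

theorem tendsto_truncate (φ : Fock) : Tendsto (fun N => incl (truncate N ⇑φ)) atTop (𝓝 φ) := by
  refine tendsto_of_dominated (summable_sq_coe φ) (fun N x => ?_) (fun x => ?_)
  · rw [coe_incl, truncate_apply, norm_mul, Complex.norm_real,
      Real.norm_of_nonneg (cutoff_nonneg _ _)]
    exact mul_le_of_le_one_left (norm_nonneg _) (cutoff_le_one _ _)
  · simp only [coe_incl, truncate_apply]
    have h := ((Complex.continuous_ofReal.tendsto 1).comp (tendsto_cutoff x)).mul_const (φ x)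
    simpa using h

/-- Truncations converge in the graph norm, by dominated convergence. This core property is what
lets identities on finite combinations pass to unbounded operators. -/
theorem tendsto_finQuad_truncate {φ ψ : Fock} (h : (⇑ψ : Seq) = quad C D E E' F ⇑φ) :
    Tendsto (fun N => incl (finQuad C D E E' F (truncate N ⇑φ))) atTop (𝓝 ψ) := by
  have hs : Summable fun x : ℕ × ℕ => (‖quad C D E E' F ⇑φ x‖ + 3 * ‖E‖ * ‖shiftDown ⇑φ x‖ +
      3 * ‖E'‖ * ‖φ (x.1 + 1, x.2 + 1)‖) ^ 2 := by
    refine summable_sq_add (summable_sq_add ?_ ?_) ?_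
    · rw [← h]; exact summable_sq_coe ψ
    · simp only [mul_pow]; exact (summable_sq_shiftDown φ).mul_left _
    · simp only [mul_pow]
      exact ((summable_sq_coe φ).comp_injective injective_succ_succ).mul_left _
  refine tendsto_of_dominated hs (fun N x => ?_) (fun x => ?_)
  · rw [coe_incl, coe_finQuad]; exact norm_quad_truncate_le C D E E' F ⇑φ N x
  · obtain ⟨r, m⟩ := x
    have hx : ∀ y, Tendsto (fun N => truncate N ⇑φ y) atTop (𝓝 (φ y)) := fun y => by
      simp only [truncate_apply]
      have h := ((Complex.continuous_ofReal.tendsto 1).comp (tendsto_cutoff y)).mul_const (φ y)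
      simpa using h
    simp only [coe_incl, coe_finQuad, h, quad_apply]
    exact (((hx _).const_mul _).add (((hx _).const_mul _).const_mul _)).add
      (((hx _).const_mul _).const_mul _)

/-- The operator `C a†a + D b†b + E a†b† + E' ab + F` on its maximal domain. -/
def maxOp : Fock →ₗ.[ℂ] Fock where
  domain :=
    { carrier := {φ | Memℓp (quad C D E E' F ⇑φ) 2}
      add_mem' := fun {φ ψ} hφ hψ => by
        simp only [Set.mem_ofPred_eq, lp.coeFn_add] at *
        rw [map_add]; exact hφ.add hψ
      zero_mem' := by
        simp only [Set.mem_ofPred_eq]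
        rw [lp.coeFn_zero, map_zero]; exact zero_memℓp
      smul_mem' := fun c φ hφ => by
        simp only [Set.mem_ofPred_eq, lp.coeFn_smul] at *
        rw [map_smul]; exact hφ.const_smul c }
  toFun :=
    { toFun := fun φ => ⟨quad C D E E' F ⇑(φ : Fock), φ.2⟩
      map_add' := fun φ ψ => by
        ext1
        simp only [Submodule.coe_add, lp.coeFn_add]
        rw [map_add]
      map_smul' := fun c φ => by
        ext1
        simp only [Submodule.coe_smul, lp.coeFn_smul, RingHom.id_apply]
        rw [map_smul] }

variable {C D E E' F}

theorem mem_maxOp_domain {φ ψ : Fock} (h : (⇑ψ : Seq) = quad C D E E' F ⇑φ) :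
    φ ∈ (maxOp C D E E' F).domain := by
  change Memℓp _ _
  rw [← h]; exact lp.memℓp ψ

theorem coe_maxOp (φ : (maxOp C D E E' F).domain) :
    (⇑(maxOp C D E E' F φ) : Seq) = quad C D E E' F ⇑(φ : Fock) := rfl

theorem maxOp_apply {φ ψ : Fock} (h : (⇑ψ : Seq) = quad C D E E' F ⇑φ) :
    maxOp C D E E' F ⟨φ, mem_maxOp_domain h⟩ = ψ := by
  ext1; rw [coe_maxOp, h]

theorem mem_graph_maxOp {φ ψ : Fock} :
    (φ, ψ) ∈ (maxOp C D E E' F).graph ↔ (⇑ψ : Seq) = quad C D E E' F ⇑φ := by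
  rw [LinearPMap.mem_graph_iff]
  constructor
  · rintro ⟨y, h1, h2⟩
    simp only at h1 h2
    rw [← h2, coe_maxOp, h1]
  · intro h
    exact ⟨⟨φ, mem_maxOp_domain h⟩, rfl, maxOp_apply h⟩

theorem toPMap_incl (X : Module.End ℂ FinFock) (v : FinFock) (h : incl v ∈ (toPMap X).domain) :
    toPMap X ⟨incl v, h⟩ = incl (X v) := by
  have : (LinearEquiv.ofInjective incl incl_injective).symm ⟨incl v, h⟩ = v := by
    rw [LinearEquiv.symm_apply_eq]; rfl
  change incl (X ((LinearEquiv.ofInjective incl incl_injective).symm ⟨incl v, h⟩)) = _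
  rw [this]

theorem mem_graph_toPMap (X : Module.End ℂ FinFock) (z : Fock × Fock) :
    z ∈ (toPMap X).graph ↔ ∃ v, z = (incl v, incl (X v)) := by
  rw [LinearPMap.mem_graph_iff]
  constructor
  · rintro ⟨⟨_, v, rfl⟩, h1, h2⟩
    refine ⟨v, Prod.ext h1.symm ?_⟩
    rw [← h2]
    exact toPMap_incl X v _
  · rintro ⟨v, rfl⟩
    exact ⟨⟨incl v, v, rfl⟩, rfl, toPMap_incl X v _⟩

theorem continuous_coe_apply (x : ℕ × ℕ) : Continuous fun φ : Fock => φ x := by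
  have : (fun φ : Fock => φ x) = fun φ => ⟪fock x, φ⟫_ℂ := funext fun φ => (inner_fock x φ).symm
  rw [this]
  fun_prop

/-- The maximal graph is closed because it is cut out by coordinate equations, each involving
finitely many coordinates; truncation makes the finite graph dense in it. No sign condition on the
coefficients is needed. -/
theorem closure_graph_finQuad : (toPMap (finQuad C D E E' F)).graph.topologicalClosure =
    (maxOp C D E E' F).graph := by
  apply le_antisymm
  · refine Submodule.topologicalClosure_minimal _ ?_ ?_
    · intro z hz
      obtain ⟨v, rfl⟩ := (mem_graph_toPMap _ z).mp hz
      rw [mem_graph_maxOp, coe_incl, coe_incl, coe_finQuad]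
    · have : ((maxOp C D E E' F).graph : Set (Fock × Fock)) =
          ⋂ x : ℕ × ℕ, {z : Fock × Fock | z.2 x = quad C D E E' F ⇑z.1 x} := by
        ext ⟨φ, ψ⟩
        simp only [SetLike.mem_coe, mem_graph_maxOp, Set.mem_iInter, Set.mem_ofPred_eq]
        exact funext_iff
      rw [this]
      refine isClosed_iInter fun x => isClosed_eq ((continuous_coe_apply x).comp continuous_snd) ?_
      obtain ⟨r, m⟩ := x
      simp only [quad_apply]
      have h := fun y => (continuous_coe_apply y).comp (continuous_fst (X := Fock) (Y := Fock))
      exact ((continuous_const.mul (h _)).add (continuous_const.mul (continuous_const.mul (h _)))).add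
        (continuous_const.mul (continuous_const.mul (h _)))
  · rintro ⟨φ, ψ⟩ hz
    rw [mem_graph_maxOp] at hz
    refine mem_closure_of_tendsto ((tendsto_truncate φ).prodMk_nhds
      (tendsto_finQuad_truncate C D E E' F hz)) (Eventually.of_forall fun N => ?_)
    exact (mem_graph_toPMap _ _).mpr ⟨_, rfl⟩

theorem closure_finQuad : (toPMap (finQuad C D E E' F)).closure = maxOp C D E E' F := by
  have hcl : (toPMap (finQuad C D E E' F)).IsClosable := ⟨_, closure_graph_finQuad⟩
  apply LinearPMap.eq_of_eq_graph
  rw [← hcl.graph_closure_eq_closure_graph, closure_graph_finQuad]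

end

section

/-! ### Self-adjointness -/

theorem inner_incl_single (φ : Fock) (x : ℕ × ℕ) (c : ℂ) :
    ⟪φ, incl (Finsupp.single x c)⟫_ℂ = c * (starRingEnd ℂ) (φ x) := by
  rw [incl_single, inner_smul_right, ← inner_conj_symm, inner_fock]

theorem inner_finQuad_single (C D E F : ℝ) (φ : Fock) (x : ℕ × ℕ) (c : ℂ) :
    ⟪φ, incl (finQuad C D E E F (Finsupp.single x c))⟫_ℂ =
      c * (starRingEnd ℂ) (quad C D E E F ⇑φ x) := by
  obtain ⟨r, m⟩ := x
  have h1 : cre₁ (ann₁ (Finsupp.single (r, m) c)) = Finsupp.single (r, m) (c * r) := by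
    rcases r with _ | r
    · simp [ann₁_single]
    · simp only [ann₁_single, cre₁_single, Nat.add_sub_cancel]
      rw [mul_assoc]
      push_cast
      rw [sqrt_succ_mul_self_complex]
  have h2 : cre₂ (ann₂ (Finsupp.single (r, m) c)) = Finsupp.single (r, m) (c * m) := by
    rcases m with _ | m
    · simp [ann₂_single]
    · simp only [ann₂_single, cre₂_single, Nat.add_sub_cancel]
      rw [mul_assoc]
      push_cast
      rw [sqrt_succ_mul_self_complex]
  simp only [finQuad, LinearMap.add_apply, LinearMap.smul_apply, Module.End.mul_apply,
    Module.End.one_apply]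
  rw [h1, h2]
  simp only [map_add, map_smul, inner_add_right, inner_smul_right, cre₂_single, cre₁_single,
    ann₁_single, ann₂_single, inner_incl_single, quad_apply, map_mul, Complex.conj_ofReal,
    map_natCast]
  ring

theorem dense_maxOp_domain (C D E E' F : ℂ) : Dense ((maxOp C D E E' F).domain : Set Fock) := by
  refine denseRange_incl.mono ?_
  rintro _ ⟨v, rfl⟩
  exact mem_maxOp_domain (ψ := incl (finQuad C D E E' F v)) (by rw [coe_incl, coe_incl, coe_finQuad])

/-- Against a finite combination the identity is a computation with matrix elements; the truncations
of the second vector converge in the graph norm. -/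
theorem inner_quad_symm {C D E F : ℝ} {φ ψ φ' ψ' : Fock} (h : (⇑ψ : Seq) = quad C D E E F ⇑φ)
    (h' : (⇑ψ' : Seq) = quad C D E E F ⇑φ') : ⟪ψ, φ'⟫_ℂ = ⟪φ, ψ'⟫_ℂ := by
  have hfin : ∀ v, ⟪ψ, incl v⟫_ℂ = ⟪φ, incl (finQuad C D E E F v)⟫_ℂ := by
    intro v
    induction v using Finsupp.induction_linear with
    | zero => simp
    | add v w hv hw => simp only [map_add, inner_add_right, hv, hw]
    | single x c => rw [inner_finQuad_single, inner_incl_single, h]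
  have l1 : Tendsto (fun N => ⟪ψ, incl (truncate N ⇑φ')⟫_ℂ) atTop (𝓝 ⟪ψ, φ'⟫_ℂ) :=
    tendsto_const_nhds.inner (tendsto_truncate φ')
  have l2 : Tendsto (fun N => ⟪φ, incl (finQuad C D E E F (truncate N ⇑φ'))⟫_ℂ) atTop
      (𝓝 ⟪φ, ψ'⟫_ℂ) := tendsto_const_nhds.inner (tendsto_finQuad_truncate _ _ _ _ _ h')
  simp only [← hfin] at l2
  exact tendsto_nhds_unique l1 l2

/-- Tested on Fock states, the adjoint can only act by the formal quadratic expression, so it lies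
inside the maximal operator. The reverse inclusion is symmetry. -/
theorem isSelfAdjoint_maxOp (C D E F : ℝ) : IsSelfAdjoint (maxOp (C : ℂ) D E E F) := by
  rw [LinearPMap.isSelfAdjoint_def]
  have hd := dense_maxOp_domain (C : ℂ) D E E F
  apply le_antisymm
  · refine LinearPMap.le_of_le_graph ?_
    rintro ⟨φ, ψ⟩ hz
    rw [LinearPMap.mem_graph_iff] at hz
    obtain ⟨y, h1, h2⟩ := hz
    simp only at h1 h2
    rw [mem_graph_maxOp]
    ext x
    have hx : (⇑(incl (finQuad C D E E F (Finsupp.single x 1))) : Seq) =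
        quad C D E E F ⇑(incl (Finsupp.single x 1)) := by rw [coe_incl, coe_incl, coe_finQuad]
    have := LinearPMap.adjoint_isFormalAdjoint hd y ⟨incl (Finsupp.single x 1), mem_maxOp_domain hx⟩
    rw [maxOp_apply hx, h1, h2, inner_finQuad_single, inner_incl_single, one_mul, one_mul] at this
    exact (starRingEnd ℂ).injective this
  · refine LinearPMap.IsFormalAdjoint.le_adjoint hd fun x y => ?_
    exact inner_quad_symm (coe_maxOp x) (coe_maxOp y)

/-! ### Quadratic operators under squeezing -/

/-- The transformation of the coefficients of `C a†a + D b†b + E (a†b† + ab) + F` under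
conjugation by the squeezer `S(ω)`. -/
structure SqueezeRel (ω C D E F C' D' E' F' : ℝ) : Prop where
  fst : C' = C * Real.cosh ω ^ 2 + D * Real.sinh ω ^ 2 - 2 * Real.cosh ω * Real.sinh ω * E
  snd : D' = D * Real.cosh ω ^ 2 + C * Real.sinh ω ^ 2 - 2 * Real.cosh ω * Real.sinh ω * E
  cross : E' = (Real.cosh ω ^ 2 + Real.sinh ω ^ 2) * E - Real.cosh ω * Real.sinh ω * (C + D)
  const : F' = F + Real.sinh ω ^ 2 * (C + D) - 2 * Real.cosh ω * Real.sinh ω * E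

variable {ω C D E F C' D' E' F' : ℝ}

theorem SqueezeRel.symm (h : SqueezeRel ω C D E F C' D' E' F') :
    SqueezeRel (-ω) C' D' E' F' C D E F := by
  obtain ⟨rfl, rfl, rfl, rfl⟩ := h
  have hc := Real.cosh_sq ω
  constructor <;> rw [Real.cosh_neg, Real.sinh_neg]
  · linear_combination (-C * Real.cosh ω ^ 2 + C * Real.sinh ω ^ 2 - C) * hc
  · linear_combination (-D * Real.cosh ω ^ 2 + D * Real.sinh ω ^ 2 - D) * hc
  · linear_combination (-E * Real.cosh ω ^ 2 + E * Real.sinh ω ^ 2 - E) * hc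
  · linear_combination (Real.sinh ω ^ 2 * (C + D) - 2 * Real.cosh ω * Real.sinh ω * E) * hc

theorem quad_sqSeq (h : SqueezeRel ω C D E F C' D' E' F') (v : FinFock) :
    quad C D E E F (sqSeq ω v) = sqSeq ω (finQuad C' D' E' E' F' v) := by
  obtain ⟨rfl, rfl, rfl, rfl⟩ := h
  have hc : (Real.cosh ω : ℂ) ^ 2 = Real.sinh ω ^ 2 + 1 := by
    exact_mod_cast congrArg (fun t : ℝ => (t : ℂ)) (Real.cosh_sq ω)
  simp only [quad, finQuad, LinearMap.add_apply, LinearMap.smul_apply, Module.End.mul_apply,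
    Module.End.one_apply, lower₁_sqSeq, lower₂_sqSeq, raise₁_sqSeq, raise₂_sqSeq, map_sub, map_smul,
    map_add, ann₁_cre₁, ann₂_cre₂, ann₁_ann₂, cre₁_cre₂]
  push_cast
  module

/-- On finite combinations this is the Bogoliubov computation of `quad_sqSeq`. It extends because
truncations converge in the graph norm and the target graph is closed. -/
theorem quad_sqOp (h : SqueezeRel ω C D E F C' D' E' F') {φ ψ : Fock}
    (hφ : (⇑ψ : Seq) = quad C' D' E' E' F' ⇑φ) :
    (⇑(sqOp ω ψ) : Seq) = quad C D E E F ⇑(sqOp ω φ) := by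
  rw [← mem_graph_maxOp]
  have hcl : IsClosed ((maxOp (C : ℂ) D E E F).graph : Set (Fock × Fock)) := by
    rw [← closure_graph_finQuad]; exact Submodule.isClosed_topologicalClosure _
  refine hcl.mem_of_tendsto (((sqOp ω).continuous.tendsto _).comp (tendsto_truncate φ) |>.prodMk_nhds
    (((sqOp ω).continuous.tendsto _).comp (tendsto_finQuad_truncate _ _ _ _ _ hφ)))
    (Eventually.of_forall fun N => ?_)
  rw [SetLike.mem_coe, mem_graph_maxOp]
  simp only [Function.comp]
  rw [coe_sqOp_incl, coe_sqOp_incl, quad_sqSeq h]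

/-- The rule `quad_sqOp` for `ω` and for `-ω` gives the two inclusions of graphs, so the domains
agree as well. -/
theorem conjugate_maxOp (h : SqueezeRel ω C D E F C' D' E' F') :
    conjugate (sqOp ω) (maxOp (C : ℂ) D E E F) = maxOp (C' : ℂ) D' E' E' F' := by
  apply LinearPMap.eq_of_eq_graph
  ext ⟨φ, ψ⟩
  rw [mem_graph_maxOp, LinearPMap.mem_graph_iff]
  constructor
  · rintro ⟨⟨y, hy⟩, h1, h2⟩
    simp only at h1 h2
    subst h1
    have hy' : sqOp ω y ∈ (maxOp (C : ℂ) D E E F).domain := hy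
    have h3 : ψ = sqOp (-ω) (maxOp (C : ℂ) D E E F ⟨sqOp ω y, hy'⟩) := by
      rw [← h2, ← star_sqOp]; rfl
    have := quad_sqOp h.symm (φ := sqOp ω y) (coe_maxOp ⟨sqOp ω y, hy'⟩)
    rw [sqOp_neg_apply] at this
    rw [h3, this]
  · intro hφ
    have h1 := quad_sqOp h hφ
    have hm : φ ∈ (conjugate (sqOp ω) (maxOp (C : ℂ) D E E F)).domain :=
      Submodule.mem_comap.mpr (mem_maxOp_domain h1)
    refine ⟨⟨φ, hm⟩, rfl, ?_⟩
    have : conjugate (sqOp ω) (maxOp (C : ℂ) D E E F) ⟨φ, hm⟩ =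
      star (sqOp ω) (maxOp (C : ℂ) D E E F ⟨sqOp ω φ, mem_maxOp_domain h1⟩) := rfl
    rw [this, maxOp_apply h1, star_sqOp, sqOp_neg_apply]

end

/-! ### The squeezers form the one-parameter group generated by `ab - a†b†` -/

theorem hasDerivAt_tanh (t : ℝ) :
    HasDerivAt (fun t => ((Real.tanh t : ℝ) : ℂ)) ((((Real.cosh t)⁻¹ : ℝ) : ℂ) ^ 2) t := by
  have h : HasDerivAt (fun t => Real.sinh t / Real.cosh t) (((Real.cosh t)⁻¹) ^ 2) t := by
    refine ((Real.hasDerivAt_sinh t).fun_div (Real.hasDerivAt_cosh t)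
      (Real.cosh_pos t).ne').congr_deriv ?_
    rw [← sq, ← sq, Real.cosh_sq_sub_sinh_sq, inv_pow, one_div]
  simp only [← Real.tanh_eq_sinh_div_cosh] at h
  exact_mod_cast h.ofReal_comp

theorem hasDerivAt_inv_cosh (t : ℝ) :
    HasDerivAt (fun t => (((Real.cosh t)⁻¹ : ℝ) : ℂ))
      (-(((Real.tanh t : ℝ) : ℂ) * (((Real.cosh t)⁻¹ : ℝ) : ℂ))) t := by
  have h : HasDerivAt (fun t => (Real.cosh t)⁻¹) (-(Real.tanh t * (Real.cosh t)⁻¹)) t := by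
    refine ((Real.hasDerivAt_cosh t).fun_inv (Real.cosh_pos t).ne').congr_deriv ?_
    rw [Real.tanh_eq_sinh_div_cosh]
    have := (Real.cosh_pos t).ne'
    field_simp
  exact_mod_cast h.ofReal_comp

/-- Entrywise `S' = S (ab - a†b†)`: the derivatives with respect to the four Gaussian parameters
recombine through the ladder relations and `1 / cosh² + tanh² = 1`. -/
theorem hasDerivAt_sqk (t : ℝ) (r m i j : ℕ) : HasDerivAt (fun t => sqk t (r, m) (i, j))
    (((Real.sqrt i : ℝ) : ℂ) * ((Real.sqrt j : ℝ) : ℂ) * sqk t (r, m) (i - 1, j - 1) -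
      ((Real.sqrt (i + 1) : ℝ) : ℂ) * ((Real.sqrt (j + 1) : ℝ) : ℂ) * sqk t (r, m) (i + 1, j + 1)) t := by
  have hneg : HasDerivAt (fun t => ((-Real.tanh t : ℝ) : ℂ)) (-(((Real.cosh t)⁻¹ : ℝ) : ℂ) ^ 2) t := by
    simpa only [Complex.ofReal_neg] using (hasDerivAt_tanh t).fun_neg
  have hg := hasDerivAt_gker hneg (hasDerivAt_tanh t) (hasDerivAt_inv_cosh t)
    (hasDerivAt_inv_cosh t) r m i j
  refine ((hasDerivAt_inv_cosh t).fun_mul hg).congr_deriv ?_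
  have R := ladderRel_gker ((-Real.tanh t : ℝ) : ℂ) ((Real.tanh t : ℝ) : ℂ)
    (((Real.cosh t)⁻¹ : ℝ) : ℂ) (((Real.cosh t)⁻¹ : ℝ) : ℂ)
  simp only [sqk]
  set G := gker ((-Real.tanh t : ℝ) : ℂ) ((Real.tanh t : ℝ) : ℂ)
    (((Real.cosh t)⁻¹ : ℝ) : ℂ) (((Real.cosh t)⁻¹ : ℝ) : ℂ)
  have hgt : (((Real.cosh t)⁻¹ : ℝ) : ℂ) ^ 2 + ((Real.tanh t : ℝ) : ℂ) ^ 2 = 1 := by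
    have : (Real.cosh t)⁻¹ ^ 2 + Real.tanh t ^ 2 = 1 := by
      rw [Real.tanh_eq_sinh_div_cosh]
      have := (Real.cosh_pos t).ne'
      field_simp
      linarith [Real.cosh_sq t]
    exact_mod_cast congrArg (fun t : ℝ => (t : ℂ)) this
  set g : ℂ := (((Real.cosh t)⁻¹ : ℝ) : ℂ)
  set τ : ℂ := ((Real.tanh t : ℝ) : ℂ)
  have e1 := R.right₁ r m i (j + 1)
  have e2 := R.right₂ (r - 1) m i j
  -- The relation for lowering `j`, kept multiplied by `√j` so that it also holds at `j = 0`.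
  have e3 : ((Real.sqrt j : ℝ) : ℂ) * (((Real.sqrt j : ℝ) : ℂ) * G (r, m) (i, j)) =
      ((Real.sqrt j : ℝ) : ℂ) * (τ * (((Real.sqrt i : ℝ) : ℂ) * G (r, m) (i - 1, j - 1)) +
      g * (((Real.sqrt m : ℝ) : ℂ) * G (r, m - 1) (i, j - 1))) := by
    rcases j with _ | j
    · simp
    · have := R.right₂ r m i j
      simp only [Nat.add_sub_cancel]
      push_cast
      rw [this]
  simp only [Nat.add_sub_cancel] at e1
  push_cast at e1
  have hj := sqrt_mul_self_complex j
  have hj1 := sqrt_succ_mul_self_complex j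
  linear_combination g * ((Real.sqrt (j + 1) : ℝ) : ℂ) * e1 + g ^ 2 * ((Real.sqrt r : ℝ) : ℂ) * e2 +
    g * τ * e3 + g * τ * G (r, m) (i, j) * (hj1 - hj) +
    g * ((Real.sqrt i : ℝ) : ℂ) * ((Real.sqrt j : ℝ) : ℂ) * G (r, m) (i - 1, j - 1) * hgt

/-- The generator `ab - a†b†` of the squeezers. -/
def sqGen : Module.End ℂ FinFock := ann₁ * ann₂ - cre₁ * cre₂

theorem hasDerivAt_sqSeq (t : ℝ) (v : FinFock) (x : ℕ × ℕ) :
    HasDerivAt (fun t => sqSeq t v x) (sqSeq t (sqGen v) x) t := by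
  induction v using Finsupp.induction_linear with
  | zero => simpa using hasDerivAt_const t (0 : ℂ)
  | add v w hv hw => simpa only [map_add, Pi.add_apply] using hv.fun_add hw
  | single y c =>
    obtain ⟨r, m⟩ := x
    obtain ⟨i, j⟩ := y
    simp only [sqGen, LinearMap.sub_apply, Module.End.mul_apply, ann₁_single, ann₂_single, cre₁_single,
      cre₂_single, map_sub, sqSeq_single, Pi.sub_apply, Pi.smul_apply, smul_eq_mul]
    refine ((hasDerivAt_sqk t r m i j).const_mul c).congr_deriv ?_
    ring

theorem inner_incl (w : FinFock) (φ : Fock) :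
    ⟪incl w, φ⟫_ℂ = w.sum fun x c => (starRingEnd ℂ) c * φ x := by
  rw [incl, Finsupp.linearCombination_apply, Finsupp.sum_inner]
  simp only [inner_smul_left, inner_fock]

theorem hasDerivAt_inner_sqOp (t : ℝ) (v w : FinFock) :
    HasDerivAt (fun t => ⟪incl w, sqOp t (incl v)⟫_ℂ) ⟪incl w, sqOp t (incl (sqGen v))⟫_ℂ t := by
  simp only [inner_incl, coe_sqOp_incl, Finsupp.sum]
  exact HasDerivAt.fun_sum fun x _ => (hasDerivAt_sqSeq t v x).const_mul _

theorem norm_le_of_forall_incl {ψ : Fock} {M : ℝ} (hM : 0 ≤ M)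
    (h : ∀ w, ‖⟪incl w, ψ⟫_ℂ‖ ≤ M * ‖incl w‖) : ‖ψ‖ ≤ M := by
  have h' : ∀ φ : Fock, ‖⟪φ, ψ⟫_ℂ‖ ≤ M * ‖φ‖ := by
    intro φ
    refine denseRange_incl.induction_on (p := fun φ => ‖⟪φ, ψ⟫_ℂ‖ ≤ M * ‖φ‖) φ ?_ h
    exact isClosed_le (by fun_prop) (by fun_prop)
  by_cases h0 : ‖ψ‖ = 0
  · rw [h0]; exact hM
  have := h' ψ
  rw [inner_self_eq_norm_sq_to_K, norm_pow, RCLike.norm_ofReal, abs_norm, sq] at this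
  exact le_of_mul_le_mul_right this (lt_of_le_of_ne (norm_nonneg _) (Ne.symm h0))

theorem norm_inner_le' (t : ℝ) (v w : FinFock) :
    ‖⟪incl w, sqOp t (incl v)⟫_ℂ‖ ≤ ‖incl v‖ * ‖incl w‖ := by
  refine (norm_inner_le_norm _ _).trans ?_
  rw [norm_sqOp, mul_comm]

/-- Only matrix elements are known to be differentiable here. The scalar mean value inequality is
applied to each of them, and isometry makes the bound uniform in the test vector. -/
theorem norm_sqOp_sub_le (t : ℝ) (v : FinFock) :
    ‖sqOp t (incl v) - incl v‖ ≤ ‖incl (sqGen v)‖ * |t| := by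
  refine norm_le_of_forall_incl (by positivity) fun w => ?_
  have := Convex.norm_image_sub_le_of_norm_hasDerivWithin_le (s := Set.univ)
    (f := fun t => ⟪incl w, sqOp t (incl v)⟫_ℂ)
    (f' := fun t => ⟪incl w, sqOp t (incl (sqGen v))⟫_ℂ) (C := ‖incl (sqGen v)‖ * ‖incl w‖)
    (fun u _ => (hasDerivAt_inner_sqOp u v w).hasDerivWithinAt)
    (fun u _ => norm_inner_le' u (sqGen v) w) convex_univ (Set.mem_univ 0) (Set.mem_univ t)
  rw [sub_zero, Real.norm_eq_abs, sqOp_zero, one_apply_eq_self, ← inner_sub_right] at this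
  linarith

/-- The mean value inequality once more, with the previous estimate for the derivative. A quadratic
remainder upgrades the weak derivative at zero to a norm derivative. -/
theorem norm_sqOp_sub_sub_le (t : ℝ) (v : FinFock) :
    ‖sqOp t (incl v) - incl v - t • incl (sqGen v)‖ ≤ ‖incl (sqGen (sqGen v))‖ * |t| ^ 2 := by
  refine norm_le_of_forall_incl (by positivity) fun w => ?_
  have hd : ∀ u : ℝ, HasDerivAt (fun u : ℝ => ⟪incl w, sqOp u (incl v)⟫_ℂ - u • ⟪incl w, incl (sqGen v)⟫_ℂ)
      (⟪incl w, sqOp u (incl (sqGen v))⟫_ℂ - (1 : ℝ) • ⟪incl w, incl (sqGen v)⟫_ℂ) u := fun u =>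
    (hasDerivAt_inner_sqOp u v w).fun_sub ((hasDerivAt_id u).smul_const _)
  have := Convex.norm_image_sub_le_of_norm_hasDerivWithin_le (s := Set.Icc (-|t|) |t|)
    (C := ‖incl (sqGen (sqGen v))‖ * |t| * ‖incl w‖) (fun u _ => (hd u).hasDerivWithinAt)
    (fun u hu => ?_) (convex_Icc _ _) (x := 0) (y := t)
    ⟨by linarith [abs_nonneg t], abs_nonneg t⟩ ⟨neg_abs_le t, le_abs_self t⟩
  · rw [sub_zero, Real.norm_eq_abs, sqOp_zero, one_apply_eq_self, zero_smul, sub_zero] at this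
    have e : ⟪incl w, sqOp t (incl v) - incl v - t • incl (sqGen v)⟫_ℂ =
        ⟪incl w, sqOp t (incl v)⟫_ℂ - t • ⟪incl w, incl (sqGen v)⟫_ℂ - ⟪incl w, incl v⟫_ℂ := by
      rw [inner_sub_right, inner_sub_right, inner_smul_right_eq_smul]
      ring
    rw [e]
    linarith
  · rw [one_smul, ← inner_sub_right]
    refine (norm_inner_le_norm _ _).trans ?_
    rw [mul_comm]
    gcongr
    refine (norm_sqOp_sub_le u (sqGen v)).trans ?_
    exact mul_le_mul_of_nonneg_left (abs_le.mpr hu) (norm_nonneg _)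

theorem hasDerivAt_sqOp_zero (v : FinFock) :
    HasDerivAt (fun t => sqOp t (incl v)) (incl (sqGen v)) 0 := by
  rw [hasDerivAt_iff_isLittleO_nhds_zero]
  refine Asymptotics.IsBigO.trans_isLittleO (g := fun h : ℝ => h ^ 2) ?_ ?_
  · refine Asymptotics.IsBigO.of_bound ‖incl (sqGen (sqGen v))‖ (Eventually.of_forall fun h => ?_)
    rw [zero_add, sqOp_zero, one_apply_eq_self, norm_pow, Real.norm_eq_abs]
    exact norm_sqOp_sub_sub_le h v
  · simpa using Asymptotics.isLittleO_pow_pow (𝕜 := ℝ) (show 1 < 2 by norm_num)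

theorem hasDerivAt_sqOp (t : ℝ) (v : FinFock) :
    HasDerivAt (fun t => sqOp t (incl v)) (sqOp t (incl (sqGen v))) t := by
  have h0 : HasDerivAt (fun u => sqOp u (incl v)) (incl (sqGen v)) (t - t) := by
    rw [sub_self]; exact hasDerivAt_sqOp_zero v
  have h1 := h0.comp_sub_const t t
  have h2 := ((sqOp t).restrictScalars ℝ).hasFDerivAt.comp_hasDerivAt t h1
  refine h2.congr_of_eventuallyEq (Eventually.of_forall fun u => ?_)
  simp only [Function.comp, ContinuousLinearMap.coe_restrictScalars']
  rw [← mul_apply_eq_comp, sqOp_mul, add_sub_cancel]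

theorem continuous_sqOp (φ : Fock) : Continuous fun t => sqOp t φ := by
  refine continuous_of_uniform_approx_of_continuous fun u hu => ?_
  obtain ⟨ε, hε, hu⟩ := Metric.mem_uniformity_dist.mp hu
  obtain ⟨_, ⟨v, rfl⟩, hv⟩ := Metric.dense_iff.mp denseRange_incl φ ε hε |>.imp
    fun _ h => And.intro h.2 h.1
  refine ⟨fun t => sqOp t (incl v),
    continuous_iff_continuousAt.mpr fun t => (hasDerivAt_sqOp t v).continuousAt, fun t => hu ?_⟩
  rw [dist_eq_norm, ← map_sub, norm_sqOp, ← dist_eq_norm, dist_comm]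
  exact Metric.mem_ball.mp hv

theorem squeeze_generator (ω : ℝ) :
    (starRingEnd ℂ) (ω : ℂ) • (ann₁ * ann₂) - (ω : ℂ) • (cre₁ * cre₂) = (ω : ℂ) • sqGen := by
  rw [Complex.conj_ofReal]
  exact LinearMap.ext fun v => by simp [sqGen, smul_sub]

theorem isTwoModeSqueezer_sqOp (ω : ℝ) : IsTwoModeSqueezer (ω : ℂ) (sqOp ω) := by
  refine ⟨fun t => sqOp (ω * t), fun t => sqOp_mem_unitary _, by simp [sqOp_zero],
    fun s t => by simp only [sqOp_mul, mul_add], fun φ => (continuous_sqOp φ).comp (by fun_prop),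
    fun v => ?_, by simp⟩
  rw [squeeze_generator, LinearMap.smul_apply, map_smul]
  have h0 : HasDerivAt (fun u => sqOp u (incl v)) (incl (sqGen v)) (ω * 0) := by
    rw [mul_zero]; exact hasDerivAt_sqOp_zero v
  have h1 : HasDerivAt (fun t : ℝ => ω * t) ω 0 := by simpa using (hasDerivAt_id (0 : ℝ)).const_mul ω
  have := h0.scomp (0 : ℝ) h1
  rw [Complex.coe_smul]
  exact this

theorem finQuad_sqGen (v : FinFock) : finQuad 0 0 (-1) 1 0 v = sqGen v := by
  simp only [finQuad, sqGen, LinearMap.add_apply, LinearMap.smul_apply, LinearMap.sub_apply]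
  module

/-- The generator commutes with the group. The squeezed vector is no longer a finite combination, so
the left action is the formal one on sequences. -/
theorem sqSeq_sqGen (t : ℝ) (v : FinFock) :
    sqSeq t (sqGen v) = quad 0 0 (-1) 1 0 (sqSeq t v) := by
  have hc := cosh_sq_sub_sinh_sq_complex t
  simp only [quad, sqGen, LinearMap.add_apply, LinearMap.smul_apply, Module.End.mul_apply,
    LinearMap.sub_apply, Module.End.one_apply, lower₁_sqSeq, lower₂_sqSeq, raise₁_sqSeq,
    raise₂_sqSeq, map_sub, map_smul, map_add, ann₁_cre₁, ann₂_cre₂, ann₁_ann₂, cre₁_cre₂]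
  linear_combination (norm := module)
    (-hc) • (sqSeq t (ann₂ (ann₁ v)) - sqSeq t (cre₂ (cre₁ v)))

theorem norm_of_mem_unitary {U : Fock →L[ℂ] Fock} (hU : U ∈ unitary (Fock →L[ℂ] Fock)) (φ ψ : Fock) :
    ⟪U φ, U ψ⟫_ℂ = ⟪φ, ψ⟫_ℂ := by
  rw [← ContinuousLinearMap.adjoint_inner_right, ← ContinuousLinearMap.star_eq_adjoint,
    ← mul_apply_eq_comp, Unitary.star_mul_self_of_mem hU, one_apply_eq_self]

/-- For any other group `U` with the same generator on finite combinations, `⟨U t w, S (ω t) v⟩`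
should be constant. Its derivative vanishes once the generator may be moved across this inner
product, although neither vector is finite; the core property of the generator along `S (ω t) v`
allows it. -/
theorem eq_sqOp_of_isTwoModeSqueezer {ω : ℝ} {S : Fock →L[ℂ] Fock}
    (h : IsTwoModeSqueezer (ω : ℂ) S) : S = sqOp ω := by
  obtain ⟨U, hU, hU0, hadd, -, hder, rfl⟩ := h
  rw [squeeze_generator] at hder
  have hder' : ∀ (t : ℝ) (v : FinFock),
      HasDerivAt (fun t => U t (incl v)) (U t (incl (((ω : ℂ) • sqGen) v))) t := by
    intro t v
    have h0 : HasDerivAt (fun u => U u (incl v)) (incl (((ω : ℂ) • sqGen) v)) (t - t) := by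
      rw [sub_self]; exact hder v
    have h2 := ((U t).restrictScalars ℝ).hasFDerivAt.comp_hasDerivAt t (h0.comp_sub_const t t)
    refine h2.congr_of_eventuallyEq (Eventually.of_forall fun u => ?_)
    simp only [Function.comp, ContinuousLinearMap.coe_restrictScalars']
    rw [← mul_apply_eq_comp, ← hadd, add_sub_cancel]
  -- Differentiating the invariance `⟨U (t + r) w, U r u⟩ = ⟨U t w, u⟩` at `r = 0` moves the
  -- generator when one vector is finite.
  have hskew : ∀ (t : ℝ) (w u : FinFock), ⟪U t (incl w), incl (((ω : ℂ) • sqGen) u)⟫_ℂ +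
      ⟪U t (incl (((ω : ℂ) • sqGen) w)), incl u⟫_ℂ = 0 := by
    intro t w u
    have h1 : HasDerivAt (fun r => U (t + r) (incl w)) (U t (incl (((ω : ℂ) • sqGen) w))) 0 := by
      have := HasDerivAt.comp_const_add t 0 (f := fun t => U t (incl w)) (by
        rw [add_zero]; exact hder' t w)
      exact this
    have h2 := h1.inner ℂ (hder u)
    have h3 : (fun r => ⟪U (t + r) (incl w), U r (incl u)⟫_ℂ) = fun _ => ⟪U t (incl w), incl u⟫_ℂ := by
      ext r
      rw [add_comm, hadd, mul_apply_eq_comp, norm_of_mem_unitary (hU r)]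
    rw [h3, add_zero, hU0, one_apply_eq_self] at h2
    exact h2.unique (hasDerivAt_const _ _)
  have hlim : ∀ (t : ℝ) (w v : FinFock), ⟪U t (incl w), sqOp (ω * t) (incl (((ω : ℂ) • sqGen) v))⟫_ℂ +
      ⟪U t (incl (((ω : ℂ) • sqGen) w)), sqOp (ω * t) (incl v)⟫_ℂ = 0 := by
    intro t w v
    have e : (⇑(sqOp (ω * t) (incl (sqGen v))) : Seq) =
        quad 0 0 (-1) 1 0 ⇑(sqOp (ω * t) (incl v)) := by
      rw [coe_sqOp_incl, coe_sqOp_incl, sqSeq_sqGen]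
    -- The finite vector in `hskew` is replaced by truncations of `S (ω t) v`, along which the
    -- generator converges too.
    have l1 := tendsto_finQuad_truncate _ _ _ _ _ e
    simp only [finQuad_sqGen] at l1
    have l2 := l1.const_smul (ω : ℂ)
    have l3 := tendsto_truncate (sqOp (ω * t) (incl v))
    have l4 := (tendsto_const_nhds (x := U t (incl w)).inner (𝕜 := ℂ) l2).add
      (tendsto_const_nhds (x := U t (incl (((ω : ℂ) • sqGen) w))).inner (𝕜 := ℂ) l3)
    simp only [LinearMap.smul_apply, map_smul] at hskew l4 ⊢
    simp only [hskew] at l4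
    exact tendsto_nhds_unique l4 tendsto_const_nhds
  have hconst : ∀ w v : FinFock, ⟪U 1 (incl w), sqOp ω (incl v)⟫_ℂ = ⟪incl w, incl v⟫_ℂ := by
    intro w v
    have hd : ∀ t, HasDerivAt (fun t => ⟪U t (incl w), sqOp (ω * t) (incl v)⟫_ℂ) 0 t := by
      intro t
      have h1 : HasDerivAt (fun t : ℝ => ω * t) ω t := by simpa using (hasDerivAt_id t).const_mul ω
      have h2 : HasDerivAt (fun t : ℝ => sqOp (ω * t) (incl v))
          (ω • sqOp (ω * t) (incl (sqGen v))) t := (hasDerivAt_sqOp (ω * t) v).scomp t h1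
      refine ((hder' t w).inner ℂ h2).congr_deriv ?_
      have := hlim t w v
      simp only [LinearMap.smul_apply, map_smul] at this ⊢
      rw [Complex.coe_smul ω (sqOp (ω * t) (incl (sqGen v)))] at this
      exact this
    have := is_const_of_deriv_eq_zero (fun t => (hd t).differentiableAt) (fun t => (hd t).deriv) 1 0
    simpa [hU0, sqOp_zero] using this
  have : star (U 1) * sqOp ω = 1 := by
    refine clm_ext fun x y => ?_
    have h1 := hconst (Finsupp.single x 1) (Finsupp.single y 1)
    rw [incl_single, incl_single, one_smul, one_smul] at h1
    rw [mul_apply_eq_comp, ContinuousLinearMap.star_eq_adjoint,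
      ContinuousLinearMap.adjoint_inner_right, h1, one_apply_eq_self]
  calc U 1 = U 1 * (star (U 1) * sqOp ω) := by rw [this, mul_one]
    _ = sqOp ω := by rw [← mul_assoc, Unitary.mul_star_self_of_mem (hU 1), one_mul]

theorem existsUnique_squeezer (ω : ℝ) :
    ∃! S : Fock →L[ℂ] Fock, IsTwoModeSqueezer (ω : ℂ) S :=
  ⟨sqOp ω, isTwoModeSqueezer_sqOp ω, fun _ h => eq_sqOp_of_isTwoModeSqueezer h⟩

theorem squeezer_eq (ω : ℝ) : squeezer ω = sqOp ω :=
  eq_sqOp_of_isTwoModeSqueezer (Classical.epsilon_spec ⟨sqOp ω, isTwoModeSqueezer_sqOp ω⟩)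

/-! ### The beam splitter -/

/-- The image `√θ a† - √(1-θ) e†` of the signal creation operator. -/
def bsX (θ : ℝ) : Module.End ℂ FinFock :=
  (Real.sqrt θ : ℂ) • cre₁ - (Real.sqrt (1 - θ) : ℂ) • cre₂

/-- The image `√(1-θ) a† + √θ e†` of the environment creation operator. -/
def bsY (θ : ℝ) : Module.End ℂ FinFock :=
  (Real.sqrt (1 - θ) : ℂ) • cre₁ + (Real.sqrt θ : ℂ) • cre₂

theorem bsX_apply (θ : ℝ) (v : FinFock) :
    bsX θ v = (Real.sqrt θ : ℂ) • cre₁ v - (Real.sqrt (1 - θ) : ℂ) • cre₂ v := rfl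

theorem bsY_apply (θ : ℝ) (v : FinFock) :
    bsY θ v = (Real.sqrt (1 - θ) : ℂ) • cre₁ v + (Real.sqrt θ : ℂ) • cre₂ v := rfl

theorem commute_bsX_bsY (θ : ℝ) : Commute (bsX θ) (bsY θ) := by
  refine LinearMap.ext fun v => ?_
  simp only [Module.End.mul_apply, bsX_apply, bsY_apply, map_add, map_sub, map_smul, cre₁_cre₂]
  module

theorem beamSplitter_eq (θ : ℝ) (n e : ℕ) : beamSplitter θ n e =
    (((Real.sqrt (n.factorial * e.factorial))⁻¹ : ℝ) : ℂ) •
      (bsX θ ^ n * bsY θ ^ e) (Finsupp.single (0, 0) 1) := rfl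

theorem beamSplitter_zero_zero (θ : ℝ) : beamSplitter θ 0 0 = Finsupp.single (0, 0) 1 := by
  simp [beamSplitter]

theorem sqrt_succ_mul_inv_factorial (n : ℕ) (b : ℝ) :
    ((Real.sqrt (n + 1) : ℝ) : ℂ) * (((Real.sqrt ((n + 1).factorial * b))⁻¹ : ℝ) : ℂ) =
      (((Real.sqrt (n.factorial * b))⁻¹ : ℝ) : ℂ) := by
  rw [← Complex.ofReal_mul]
  congr 1
  have h : (0 : ℝ) < n + 1 := by positivity
  rw [Nat.factorial_succ]
  push_cast
  rw [mul_assoc, Real.sqrt_mul h.le, mul_inv, ← mul_assoc,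
    mul_inv_cancel₀ (Real.sqrt_pos.mpr h).ne', one_mul]

theorem beamSplitter_succ_left (θ : ℝ) (n e : ℕ) :
    ((Real.sqrt (n + 1) : ℝ) : ℂ) • beamSplitter θ (n + 1) e = bsX θ (beamSplitter θ n e) := by
  rw [beamSplitter_eq, beamSplitter_eq, smul_smul, sqrt_succ_mul_inv_factorial, map_smul, pow_succ',
    mul_assoc, Module.End.mul_apply (bsX θ)]

theorem beamSplitter_succ_right (θ : ℝ) (n e : ℕ) :
    ((Real.sqrt (e + 1) : ℝ) : ℂ) • beamSplitter θ n (e + 1) = bsY θ (beamSplitter θ n e) := by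
  rw [beamSplitter_eq, beamSplitter_eq, smul_smul, mul_comm (n.factorial : ℝ),
    sqrt_succ_mul_inv_factorial, map_smul, mul_comm (n.factorial : ℝ), pow_succ', ← mul_assoc,
    ((commute_bsX_bsY θ).pow_left n).eq, mul_assoc, Module.End.mul_apply (bsY θ)]

/-- `√n X |n-1, e⟩ = n |n e⟩`, also for `n = 0`. -/
theorem sqrt_smul_bsX (θ : ℝ) (n e : ℕ) :
    ((Real.sqrt n : ℝ) : ℂ) • bsX θ (beamSplitter θ (n - 1) e) = (n : ℂ) • beamSplitter θ n e := by
  rcases n with _ | n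
  · simp
  · rw [Nat.add_sub_cancel, ← beamSplitter_succ_left, smul_smul]
    push_cast
    rw [sqrt_succ_mul_self_complex]

theorem sqrt_smul_bsY (θ : ℝ) (n e : ℕ) :
    ((Real.sqrt e : ℝ) : ℂ) • bsY θ (beamSplitter θ n (e - 1)) = (e : ℂ) • beamSplitter θ n e := by
  rcases e with _ | e
  · simp
  · rw [Nat.add_sub_cancel, ← beamSplitter_succ_right, smul_smul]
    push_cast
    rw [sqrt_succ_mul_self_complex]

theorem smul_right_injective' {v w : FinFock} (n : ℕ)
    (h : ((Real.sqrt (n + 1) : ℝ) : ℂ) • v = ((Real.sqrt (n + 1) : ℝ) : ℂ) • w) : v = w :=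
  smul_right_injective _ (sqrt_succ_ne_zero n) h

theorem ann₁_bsX (θ : ℝ) (v : FinFock) : ann₁ (bsX θ v) = bsX θ (ann₁ v) + (Real.sqrt θ : ℂ) • v := by
  simp only [bsX_apply, map_sub, map_smul, ann₁_cre₁, ann₁_cre₂]; module
theorem ann₂_bsX (θ : ℝ) (v : FinFock) :
    ann₂ (bsX θ v) = bsX θ (ann₂ v) - (Real.sqrt (1 - θ) : ℂ) • v := by
  simp only [bsX_apply, map_sub, map_smul, ann₂_cre₂, ann₂_cre₁]; module
theorem ann₁_bsY (θ : ℝ) (v : FinFock) :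
    ann₁ (bsY θ v) = bsY θ (ann₁ v) + (Real.sqrt (1 - θ) : ℂ) • v := by
  simp only [bsY_apply, map_add, map_smul, ann₁_cre₁, ann₁_cre₂]; module
theorem ann₂_bsY (θ : ℝ) (v : FinFock) : ann₂ (bsY θ v) = bsY θ (ann₂ v) + (Real.sqrt θ : ℂ) • v := by
  simp only [bsY_apply, map_add, map_smul, ann₂_cre₂, ann₂_cre₁]; module

/-- An operator `A` that kills the vacuum and has scalar commutators `c`, `d` with the images of
the creation operators acts on the beam splitter outputs as an annihilation operator. -/
theorem beamSplitter_ann_aux {θ : ℝ} {A : Module.End ℂ FinFock} {c d : ℂ}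
    (h0 : A (Finsupp.single (0, 0) 1) = 0) (hX : ∀ v, A (bsX θ v) = bsX θ (A v) + c • v)
    (hY : ∀ v, A (bsY θ v) = bsY θ (A v) + d • v) (n e : ℕ) :
    A (beamSplitter θ n e) = (c * ((Real.sqrt n : ℝ) : ℂ)) • beamSplitter θ (n - 1) e +
      (d * ((Real.sqrt e : ℝ) : ℂ)) • beamSplitter θ n (e - 1) := by
  induction n with
  | zero =>
    induction e with
    | zero => rw [beamSplitter_zero_zero, h0]; simp
    | succ e ih =>
      refine smul_right_injective' e ?_
      rw [← map_smul, beamSplitter_succ_right, hY, ih]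
      have := sqrt_smul_bsY θ 0 e
      have h1 := sqrt_succ_mul_self_complex e
      simp only [map_smul, Nat.add_sub_cancel, Nat.cast_zero, Real.sqrt_zero,
        Complex.ofReal_zero, mul_zero, zero_smul, zero_add]
      push_cast
      linear_combination (norm := module) d • this - (d * h1) • beamSplitter θ 0 e
  | succ n ih =>
    refine smul_right_injective' n ?_
    rw [← map_smul, beamSplitter_succ_left, hX, ih]
    have h1 := sqrt_smul_bsX θ n e
    have h2 := beamSplitter_succ_left θ n (e - 1)
    have h3 := sqrt_succ_mul_self_complex n
    simp only [map_add, map_smul, Nat.add_sub_cancel]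
    push_cast
    linear_combination (norm := module) c • h1 - (d * ((Real.sqrt e : ℝ) : ℂ)) • h2 -
      (c * h3) • beamSplitter θ n e

theorem ann₁_beamSplitter (θ : ℝ) (n e : ℕ) : ann₁ (beamSplitter θ n e) =
    ((Real.sqrt θ : ℂ) * ((Real.sqrt n : ℝ) : ℂ)) • beamSplitter θ (n - 1) e +
      ((Real.sqrt (1 - θ) : ℂ) * ((Real.sqrt e : ℝ) : ℂ)) • beamSplitter θ n (e - 1) :=
  beamSplitter_ann_aux (by simp [ann₁_single]) (ann₁_bsX θ) (ann₁_bsY θ) n e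

theorem ann₂_beamSplitter (θ : ℝ) (n e : ℕ) : ann₂ (beamSplitter θ n e) =
    (-(Real.sqrt (1 - θ) : ℂ) * ((Real.sqrt n : ℝ) : ℂ)) • beamSplitter θ (n - 1) e +
      ((Real.sqrt θ : ℂ) * ((Real.sqrt e : ℝ) : ℂ)) • beamSplitter θ n (e - 1) :=
  beamSplitter_ann_aux (by simp [ann₂_single])
    (fun v => by rw [ann₂_bsX, neg_smul, sub_eq_add_neg]) (ann₂_bsY θ) n e

theorem conj_beamSplitter (θ : ℝ) (n e : ℕ) (x : ℕ × ℕ) :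
    (starRingEnd ℂ) (beamSplitter θ n e x) = beamSplitter θ n e x := by
  have hre : ∀ (k : ℕ) (z : ℂ), (starRingEnd ℂ) (((Real.sqrt (k + 1) : ℝ) : ℂ) * z) =
      ((Real.sqrt (k + 1) : ℝ) : ℂ) * z → (starRingEnd ℂ) z = z := by
    intro k z h
    rw [map_mul, Complex.conj_ofReal] at h
    exact mul_left_cancel₀ (sqrt_succ_ne_zero k) h
  induction n generalizing x with
  | zero =>
    induction e generalizing x with
    | zero => rw [beamSplitter_zero_zero, Finsupp.single_apply]; split_ifs <;> simp
    | succ e ih =>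
      refine hre e _ ?_
      have h := DFunLike.congr_fun (beamSplitter_succ_right θ 0 e) x
      rw [Finsupp.smul_apply, smul_eq_mul] at h
      obtain ⟨r, l⟩ := x
      rw [h]
      simp only [bsY_apply, Finsupp.add_apply, Finsupp.smul_apply, coe_cre₁, coe_cre₂, raise₁_apply,
        raise₂_apply, smul_eq_mul, map_add, map_mul, Complex.conj_ofReal, ih]
  | succ n ih =>
    refine hre n _ ?_
    have h := DFunLike.congr_fun (beamSplitter_succ_left θ n e) x
    rw [Finsupp.smul_apply, smul_eq_mul] at h
    obtain ⟨r, l⟩ := x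
    rw [h]
    simp only [bsX_apply, Finsupp.sub_apply, Finsupp.smul_apply, coe_cre₁, coe_cre₂, raise₁_apply,
      raise₂_apply, smul_eq_mul, map_sub, map_mul, Complex.conj_ofReal, ih]

theorem rapid_coe (v : FinFock) : Rapid ⇑v := by
  induction v using Finsupp.induction_linear with
  | zero => exact Rapid.of_finite_support (0, 0) fun _ _ => rfl
  | add v w hv hw => rw [Finsupp.coe_add]; exact hv.add hw
  | single x c =>
    refine Rapid.of_finite_support x fun w h => ?_
    rw [Finsupp.single_apply, if_neg]
    rintro rfl
    omega

theorem sqrt_sq_add_sqrt_sq {θ : ℝ} (h0 : 0 ≤ θ) (h1 : θ ≤ 1) :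
    (Real.sqrt θ : ℂ) ^ 2 + (Real.sqrt (1 - θ) : ℂ) ^ 2 = 1 := by
  have : Real.sqrt θ ^ 2 + Real.sqrt (1 - θ) ^ 2 = 1 := by
    rw [Real.sq_sqrt h0, Real.sq_sqrt (by linarith)]; ring
  exact_mod_cast congrArg (fun t : ℝ => (t : ℂ)) this

/-- Unitarity of the beam splitter: the adjoint of each rotated creation operator returns the
previous vector with the right factor, because `√θ² + √(1-θ)² = 1`. -/
theorem pair_beamSplitter_self {θ : ℝ} (h0 : 0 ≤ θ) (h1 : θ ≤ 1) (n e : ℕ) :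
    pair ⇑(beamSplitter θ n e) ⇑(beamSplitter θ n e) = 1 := by
  have hcd := sqrt_sq_add_sqrt_sq h0 h1
  have hbd : ∀ v : FinFock, ∃ B, ∀ x, ‖v x‖ ≤ B := fun v => (rapid_coe v).bounded
  have step : ∀ (k : ℕ) (c d : ℂ) (v w : FinFock),
      ((Real.sqrt (k + 1) : ℝ) : ℂ) • w = c • cre₁ v + d • cre₂ v →
      c • ann₁ w + d • ann₂ w = ((Real.sqrt (k + 1) : ℝ) : ℂ) • v → pair ⇑v ⇑v = 1 →
      pair ⇑w ⇑w = 1 := by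
    intro k c d v w hw hv h
    refine mul_left_cancel₀ (sqrt_succ_ne_zero k) ?_
    obtain ⟨B, hB⟩ := hbd w
    obtain ⟨B', hB'⟩ := hbd v
    rw [← pair_smul_left, ← Finsupp.coe_smul, hw, Finsupp.coe_add, Finsupp.coe_smul,
      Finsupp.coe_smul, coe_cre₁, coe_cre₂, pair_add_left ((rapid_coe v).raise₁.smul _)
      ((rapid_coe v).raise₂.smul _) hB, pair_smul_left, pair_smul_left, pair_raise₁, pair_raise₂,
      ← pair_smul_right, ← pair_smul_right, ← pair_add_right ((rapid_coe w).lower₁.smul _)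
      ((rapid_coe w).lower₂.smul _) hB', ← coe_ann₁, ← coe_ann₂, ← Finsupp.coe_smul,
      ← Finsupp.coe_smul, ← Finsupp.coe_add, hv, Finsupp.coe_smul, pair_smul_right, h]
  induction n with
  | zero =>
    induction e with
    | zero =>
      rw [beamSplitter_zero_zero, pair, tsum_eq_single (0, 0)]
      · simp
      · intro x hx; simp [hx.symm]
    | succ e ih =>
      refine step e _ _ _ _ (beamSplitter_succ_right θ 0 e) ?_ ih
      rw [ann₁_beamSplitter, ann₂_beamSplitter]
      push_cast
      linear_combination (norm := (simp; module)) (hcd * ((Real.sqrt (e + 1) : ℝ) : ℂ)) • beamSplitter θ 0 e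
  | succ n ih =>
    refine step n (Real.sqrt θ : ℂ) (-(Real.sqrt (1 - θ) : ℂ)) _ _
      (by rw [beamSplitter_succ_left, bsX_apply, neg_smul, sub_eq_add_neg]) ?_ ih
    rw [ann₁_beamSplitter, ann₂_beamSplitter]
    push_cast
    linear_combination (norm := module) (hcd * ((Real.sqrt (n + 1) : ℝ) : ℂ)) • beamSplitter θ n e

/-! ### Partial trace over the environment -/

/-- The matrix element `⟨r| Tr_E |v⟩⟨w| |r'⟩` for real vectors `v`, `w`. -/
def envPair (v w : FinFock) (r r' : ℕ) : ℂ := ∑' l : ℕ, v (r, l) * w (r', l)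

theorem summable_slice (v : FinFock) (f : ℕ → ℂ) (r : ℕ) : Summable fun l => v (r, l) * f l := by
  have hinj : Function.Injective (fun l : ℕ => (r, l)) := fun a b h => (Prod.mk.inj h).2
  refine summable_of_hasFiniteSupport ((v.hasFiniteSupport.preimage hinj.injOn).subset ?_)
  intro l hl
  simp only [Function.mem_support] at hl
  exact left_ne_zero_of_mul hl

theorem envPair_comm (v w : FinFock) (r r' : ℕ) : envPair v w r r' = envPair w v r' r :=
  tsum_congr fun _ => mul_comm _ _

theorem envPair_add_left (v v' w : FinFock) (r r' : ℕ) :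
    envPair (v + v') w r r' = envPair v w r r' + envPair v' w r r' := by
  simp only [envPair, Finsupp.add_apply, add_mul]
  exact (summable_slice v _ r).tsum_add (summable_slice v' _ r)

theorem envPair_smul_left (c : ℂ) (v w : FinFock) (r r' : ℕ) :
    envPair (c • v) w r r' = c * envPair v w r r' := by
  simp only [envPair, Finsupp.smul_apply, smul_eq_mul, mul_assoc, tsum_mul_left]

theorem envPair_add_right (v w w' : FinFock) (r r' : ℕ) :
    envPair v (w + w') r r' = envPair v w r r' + envPair v w' r r' := by
  rw [envPair_comm, envPair_add_left, envPair_comm w, envPair_comm w']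

theorem envPair_smul_right (c : ℂ) (v w : FinFock) (r r' : ℕ) :
    envPair v (c • w) r r' = c * envPair v w r r' := by
  rw [envPair_comm, envPair_smul_left, envPair_comm]

theorem envPair_ann₁_left (v w : FinFock) (r r' : ℕ) :
    envPair (ann₁ v) w r r' = ((Real.sqrt (r + 1) : ℝ) : ℂ) * envPair v w (r + 1) r' := by
  simp only [envPair, coe_ann₁, lower₁_apply, mul_assoc, tsum_mul_left]

theorem envPair_cre₁_left (v w : FinFock) (r r' : ℕ) :
    envPair (cre₁ v) w r r' = ((Real.sqrt r : ℝ) : ℂ) * envPair v w (r - 1) r' := by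
  simp only [envPair, coe_cre₁, raise₁_apply, mul_assoc, tsum_mul_left]

theorem envPair_cre₁_right (v w : FinFock) (r r' : ℕ) :
    envPair v (cre₁ w) r r' = ((Real.sqrt r' : ℝ) : ℂ) * envPair v w r (r' - 1) := by
  rw [envPair_comm, envPair_cre₁_left, envPair_comm]

/-- Cyclicity of the partial trace for environment operators. This is how environment creation
operators are removed from the channel. -/
theorem envPair_cre₂_left (v w : FinFock) (r r' : ℕ) :
    envPair (cre₂ v) w r r' = envPair v (ann₂ w) r r' := by
  have hinj : Function.Injective (fun l : ℕ => l + 1) := add_left_injective 1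
  rw [envPair, ← hinj.tsum_eq, envPair]
  · refine tsum_congr fun l => ?_
    simp only [coe_cre₂, coe_ann₂, raise₂_apply, lower₂_apply, Nat.add_sub_cancel]
    push_cast; ring
  · rintro (_ | l) h
    · simp [coe_cre₂, raise₂_apply] at h
    · exact ⟨l, rfl⟩

theorem envPair_cre₂_right (v w : FinFock) (r r' : ℕ) :
    envPair v (cre₂ w) r r' = envPair (ann₂ v) w r r' := by
  rw [envPair_comm, envPair_cre₂_left, envPair_comm]

/-- Both vectors have norm one, so each slice has square sum at most one, and `2xy ≤ x² + y²`
suffices. It makes the thermal sums converge. -/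
theorem norm_envPair_beamSplitter_le {θ : ℝ} (h0 : 0 ≤ θ) (h1 : θ ≤ 1) (n e n' e' r r' : ℕ) :
    ‖envPair (beamSplitter θ n e) (beamSplitter θ n' e') r r'‖ ≤ 1 := by
  have hs : ∀ n e : ℕ, HasSum (fun x => ‖beamSplitter θ n e x‖ ^ 2) 1 := by
    intro n e
    have h : Summable fun x => ‖beamSplitter θ n e x‖ ^ 2 := by
      have := summable_sq_coe (incl (beamSplitter θ n e))
      rwa [coe_incl] at this
    have hp := pair_beamSplitter_self h0 h1 n e
    have e1 : ∀ x, beamSplitter θ n e x * beamSplitter θ n e x =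
        ((‖beamSplitter θ n e x‖ ^ 2 : ℝ) : ℂ) := by
      intro x
      rw [Complex.ofReal_pow, ← Complex.conj_mul', conj_beamSplitter]
    rw [pair, tsum_congr e1, ← Complex.ofReal_tsum] at hp
    have h2 : ∑' x, ‖beamSplitter θ n e x‖ ^ 2 = 1 := by exact_mod_cast hp
    rw [← h2]; exact h.hasSum
  have hinj : ∀ r : ℕ, Function.Injective (fun l : ℕ => (r, l)) := fun r a b h => (Prod.mk.inj h).2
  have hsl : ∀ n e r : ℕ, Summable (fun l => ‖beamSplitter θ n e (r, l)‖ ^ 2) := fun n e r =>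
    (hs n e).summable.comp_injective (hinj r)
  have hle : ∀ n e r : ℕ, ∑' l, ‖beamSplitter θ n e (r, l)‖ ^ 2 ≤ 1 := by
    intro n e r
    rw [← (hs n e).tsum_eq]
    exact tsum_comp_le_tsum_of_inj (hs n e).summable (fun x => by positivity) (hinj r)
  have hb : ∀ l, ‖beamSplitter θ n e (r, l) * beamSplitter θ n' e' (r', l)‖ ≤
      (‖beamSplitter θ n e (r, l)‖ ^ 2 + ‖beamSplitter θ n' e' (r', l)‖ ^ 2) / 2 := by
    intro l
    rw [norm_mul]
    nlinarith [sq_nonneg (‖beamSplitter θ n e (r, l)‖ - ‖beamSplitter θ n' e' (r', l)‖)]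
  refine (tsum_of_norm_bounded (((hsl n e r).add (hsl n' e' r')).div_const 2).hasSum hb).trans ?_
  rw [tsum_div_const, (hsl n e r).tsum_add (hsl n' e' r')]
  linarith [hle n e r, hle n' e' r']

theorem channelMatrix_eq (nT θ : ℝ) (n n' r r' : ℕ) : channelMatrix nT θ n n' r r' =
    ∑' e : ℕ, (boseEinstein e nT : ℂ) * envPair (beamSplitter θ n e) (beamSplitter θ n' e) r r' := by
  simp only [channelMatrix, envPair, conj_beamSplitter]

theorem channelMatrix_symm (nT θ : ℝ) (n n' r r' : ℕ) :
    channelMatrix nT θ n n' r r' = channelMatrix nT θ n' n r' r := by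
  simp only [channelMatrix_eq]
  exact tsum_congr fun e => by rw [envPair_comm]

/-! ### Ladder relations of the thermal-loss channel -/

section Channel

variable {nT θ : ℝ}

theorem boseEinstein_eq (e : ℕ) (n : ℝ) : boseEinstein e n = (1 + n)⁻¹ * (n / (1 + n)) ^ e := by
  rw [boseEinstein, div_pow, pow_succ, div_eq_mul_inv, mul_inv, div_eq_mul_inv]; ring

theorem boseEinstein_succ (e : ℕ) (n : ℝ) :
    boseEinstein (e + 1) n = n / (1 + n) * boseEinstein e n := by
  rw [boseEinstein_eq, boseEinstein_eq, pow_succ]; ring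

theorem summable_boseEinstein_mul (hT : 0 < nT) {f : ℕ → ℂ} (hf : ∀ e, ‖f e‖ ≤ e + 1) :
    Summable fun e => (boseEinstein e nT : ℂ) * f e := by
  have hy0 : 0 ≤ nT / (1 + nT) := by positivity
  have hy1 : nT / (1 + nT) < 1 := by rw [div_lt_one (by positivity)]; linarith
  have hs1 : Summable fun e : ℕ => (e : ℝ) * (nT / (1 + nT)) ^ e := by
    simpa using summable_pow_mul_geometric_of_norm_lt_one 1
      (r := nT / (1 + nT)) (by rwa [Real.norm_of_nonneg hy0])
  have hs := ((hs1.add (summable_geometric_of_lt_one hy0 hy1)).mul_left (1 + nT)⁻¹)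
  refine Summable.of_norm_bounded hs fun e => ?_
  have hpos : 0 ≤ (1 + nT)⁻¹ * (nT / (1 + nT)) ^ e := by positivity
  rw [norm_mul, Complex.norm_real, boseEinstein_eq, Real.norm_of_nonneg hpos]
  calc _ ≤ (1 + nT)⁻¹ * (nT / (1 + nT)) ^ e * (e + 1) := by gcongr; exact hf e
    _ = _ := by ring

theorem summable_channel (hT : 0 < nT) (h0 : 0 ≤ θ) (h1 : θ ≤ 1) (n n' r r' : ℕ) : Summable fun e : ℕ =>
    (boseEinstein e nT : ℂ) * envPair (beamSplitter θ n e) (beamSplitter θ n' e) r r' :=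
  summable_boseEinstein_mul hT fun e => (norm_envPair_beamSplitter_le h0 h1 _ _ _ _ _ _).trans
    (by linarith [Nat.cast_nonneg (α := ℝ) e])

/-- The correlation of neighbouring environment inputs. -/
def envCorr (nT θ : ℝ) (n n' r r' : ℕ) : ℂ := ∑' e : ℕ, (boseEinstein e nT : ℂ) *
  (((Real.sqrt (e + 1) : ℝ) : ℂ) * envPair (beamSplitter θ n e) (beamSplitter θ n' (e + 1)) r r')

theorem summable_envCorr (hT : 0 < nT) (h0 : 0 ≤ θ) (h1 : θ ≤ 1) (n n' r r' : ℕ) : Summable fun e : ℕ => (boseEinstein e nT : ℂ) *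
    (((Real.sqrt (e + 1) : ℝ) : ℂ) * envPair (beamSplitter θ n e) (beamSplitter θ n' (e + 1)) r r') := by
  refine summable_boseEinstein_mul hT fun e => ?_
  rw [norm_mul, norm_sqrt_cast]
  have hb := norm_envPair_beamSplitter_le h0 h1 n e n' (e + 1) r r'
  have he : (1 : ℝ) ≤ e + 1 := by linarith [Nat.cast_nonneg (α := ℝ) e]
  calc _ ≤ ((e : ℝ) + 1) * 1 := by
        gcongr
        exact sqrt_le_of_le he le_rfl
    _ = _ := mul_one _

/-- Thermal weights are geometric, so lowering the environment index costs the factor `nT / (1 +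
nT)`. This is the only place where thermality enters the recursions. -/
theorem hasSum_envCorr_shift (hT : 0 < nT) (h0 : 0 ≤ θ) (h1 : θ ≤ 1) (n n' r r' : ℕ) : HasSum (fun e : ℕ => (boseEinstein e nT : ℂ) *
    (((Real.sqrt e : ℝ) : ℂ) * envPair (beamSplitter θ n (e - 1)) (beamSplitter θ n' e) r r'))
    (((nT / (1 + nT) : ℝ) : ℂ) * envCorr nT θ n n' r r') := by
  have h := (summable_envCorr hT h0 h1 n n' r r').hasSum.mul_left ((nT / (1 + nT) : ℝ) : ℂ)
  rw [← envCorr] at h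
  have hinj : Function.Injective (fun e : ℕ => e + 1) := add_left_injective 1
  rw [← hinj.hasSum_iff]
  · refine h.congr_fun fun e => ?_
    simp only [Function.comp, boseEinstein_succ, Nat.add_sub_cancel]
    push_cast; ring
  · rintro (_ | e) he
    · simp
    · exact absurd ⟨e, rfl⟩ he

theorem hasSum_channel (hT : 0 < nT) (h0 : 0 ≤ θ) (h1 : θ ≤ 1) (n n' r r' : ℕ) : HasSum (fun e : ℕ =>
    (boseEinstein e nT : ℂ) * envPair (beamSplitter θ n e) (beamSplitter θ n' e) r r')
    (channelMatrix nT θ n n' r r') := by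
  rw [channelMatrix_eq]; exact (summable_channel hT h0 h1 n n' r r').hasSum

theorem hasSum_envPair_ann₂ (hT : 0 < nT) (h0 : 0 ≤ θ) (h1 : θ ≤ 1) (n n' r r' : ℕ) : HasSum (fun e : ℕ => (boseEinstein e nT : ℂ) *
    envPair (ann₂ (beamSplitter θ n e)) (beamSplitter θ n' e) r r')
    ((Real.sqrt θ : ℂ) * (((nT / (1 + nT) : ℝ) : ℂ) * envCorr nT θ n n' r r') -
      (Real.sqrt (1 - θ) : ℂ) * (((Real.sqrt n : ℝ) : ℂ) * channelMatrix nT θ (n - 1) n' r r')) := by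
  have h := ((hasSum_envCorr_shift hT h0 h1 n n' r r').mul_left (Real.sqrt θ : ℂ)).sub
    (((hasSum_channel hT h0 h1 (n - 1) n' r r').mul_left ((Real.sqrt n : ℝ) : ℂ)).mul_left
      (Real.sqrt (1 - θ) : ℂ))
  refine h.congr_fun fun e => ?_
  rw [ann₂_beamSplitter, envPair_add_left, envPair_smul_left, envPair_smul_left]
  ring

/-- Expanding `|n', e + 1⟩` brings the same correlation back with the factor `θ nT / (1 + nT)`.
Solving for it closes the recursions within the channel entries. -/
theorem envCorr_eq (hT : 0 < nT) (h0 : 0 ≤ θ) (h1 : θ ≤ 1) (n n' r r' : ℕ) :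
    envCorr nT θ n n' r r' * (1 - (Real.sqrt θ : ℂ) ^ 2 * ((nT / (1 + nT) : ℝ) : ℂ)) =
      (Real.sqrt (1 - θ) : ℂ) * (((Real.sqrt r' : ℝ) : ℂ) * channelMatrix nT θ n n' r (r' - 1)) -
      (Real.sqrt θ : ℂ) * (Real.sqrt (1 - θ) : ℂ) *
        (((Real.sqrt n : ℝ) : ℂ) * channelMatrix nT θ (n - 1) n' r r') := by
  have h := ((hasSum_channel hT h0 h1 n n' r (r' - 1)).mul_left
    ((Real.sqrt (1 - θ) : ℂ) * ((Real.sqrt r' : ℝ) : ℂ))).add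
    ((hasSum_envPair_ann₂ hT h0 h1 n n' r r').mul_left (Real.sqrt θ : ℂ))
  have h' : HasSum (fun e : ℕ => (boseEinstein e nT : ℂ) * (((Real.sqrt (e + 1) : ℝ) : ℂ) *
      envPair (beamSplitter θ n e) (beamSplitter θ n' (e + 1)) r r')) (envCorr nT θ n n' r r') :=
    (summable_envCorr hT h0 h1 n n' r r').hasSum
  have := h'.unique (h.congr_fun fun e => by
    rw [← envPair_smul_right, beamSplitter_succ_right, bsY_apply, envPair_add_right,
      envPair_smul_right, envPair_smul_right, envPair_cre₁_right, envPair_cre₂_right]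
    ring)
  linear_combination this

theorem channelMatrix_succ_out (hT : 0 < nT) (h0 : 0 ≤ θ) (h1 : θ ≤ 1) (n n' r r' : ℕ) :
    ((Real.sqrt (r + 1) : ℝ) : ℂ) * channelMatrix nT θ n n' (r + 1) r' =
      (Real.sqrt θ : ℂ) * (((Real.sqrt n : ℝ) : ℂ) * channelMatrix nT θ (n - 1) n' r r') +
      (Real.sqrt (1 - θ) : ℂ) * (((nT / (1 + nT) : ℝ) : ℂ) * envCorr nT θ n n' r r') := by
  have h := (((hasSum_channel hT h0 h1 (n - 1) n' r r').mul_left ((Real.sqrt n : ℝ) : ℂ)).mul_left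
      (Real.sqrt θ : ℂ)).add
    ((hasSum_envCorr_shift hT h0 h1 n n' r r').mul_left (Real.sqrt (1 - θ) : ℂ))
  refine ((hasSum_channel hT h0 h1 n n' (r + 1) r').mul_left
    ((Real.sqrt (r + 1) : ℝ) : ℂ)).unique (h.congr_fun fun e => ?_)
  rw [mul_left_comm, ← envPair_ann₁_left, ann₁_beamSplitter, envPair_add_left, envPair_smul_left,
    envPair_smul_left]
  ring

theorem channelMatrix_succ_in (hT : 0 < nT) (h0 : 0 ≤ θ) (h1 : θ ≤ 1) (n n' r r' : ℕ) :
    ((Real.sqrt (n + 1) : ℝ) : ℂ) * channelMatrix nT θ (n + 1) n' r r' =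
      (Real.sqrt θ : ℂ) * (((Real.sqrt r : ℝ) : ℂ) * channelMatrix nT θ n n' (r - 1) r') -
      (Real.sqrt (1 - θ) : ℂ) * ((Real.sqrt θ : ℂ) * (((nT / (1 + nT) : ℝ) : ℂ) *
        envCorr nT θ n' n r' r) - (Real.sqrt (1 - θ) : ℂ) *
          (((Real.sqrt n' : ℝ) : ℂ) * channelMatrix nT θ n (n' - 1) r r')) := by
  have h := ((hasSum_channel hT h0 h1 n n' (r - 1) r').mul_left
      ((Real.sqrt θ : ℂ) * ((Real.sqrt r : ℝ) : ℂ))).sub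
    ((hasSum_envPair_ann₂ hT h0 h1 n' n r' r).mul_left (Real.sqrt (1 - θ) : ℂ))
  rw [channelMatrix_symm _ _ (n' - 1)] at h
  rw [← mul_assoc (Real.sqrt θ : ℂ) ((Real.sqrt r : ℝ) : ℂ)]
  refine ((hasSum_channel hT h0 h1 (n + 1) n' r r').mul_left
    ((Real.sqrt (n + 1) : ℝ) : ℂ)).unique (h.congr_fun fun e => ?_)
  rw [mul_left_comm, ← envPair_smul_left, beamSplitter_succ_left, bsX_apply, sub_eq_add_neg,
    ← neg_smul, envPair_add_left, envPair_smul_left, envPair_smul_left, envPair_cre₁_left,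
    envPair_cre₂_left, envPair_comm (ann₂ _)]
  ring

theorem channelMatrix_zero (hT : 0 < nT) (h0 : 0 ≤ θ) (h1 : θ ≤ 1) : channelMatrix nT θ 0 0 0 0 =
    (((1 + nT)⁻¹ * (1 - nT / (1 + nT) * θ)⁻¹ : ℝ) : ℂ) := by
  -- With vacuum at the signal input, `θ^e` is the probability that all `e` thermal photons leave
  -- through the environment port.
  have hj : ∀ e : ℕ, envPair (beamSplitter θ 0 e) (beamSplitter θ 0 e) 0 0 = (θ : ℂ) ^ e := by
    intro e
    induction e with
    | zero =>
      rw [beamSplitter_zero_zero, envPair, tsum_eq_single 0]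
      · simp
      · intro l hl; simp [hl.symm]
    | succ e ih =>
      refine mul_left_cancel₀ (sqrt_succ_ne_zero e) ?_
      rw [← envPair_smul_left, beamSplitter_succ_right, bsY_apply, envPair_add_left,
        envPair_smul_left, envPair_smul_left, envPair_cre₁_left, envPair_cre₂_left,
        ann₂_beamSplitter, envPair_add_right, envPair_smul_right, envPair_smul_right]
      have hθ : (Real.sqrt θ : ℂ) * (Real.sqrt θ : ℂ) = θ := by
        rw [← Complex.ofReal_mul, Real.mul_self_sqrt h0]
      simp only [Nat.add_sub_cancel, ih]
      push_cast
      rw [Real.sqrt_zero]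
      push_cast
      rw [pow_succ]
      linear_combination ((Real.sqrt (e + 1) : ℝ) : ℂ) * (θ : ℂ) ^ e * hθ
  have hy0 : 0 ≤ nT / (1 + nT) := by positivity
  have hy1 : nT / (1 + nT) < 1 := by rw [div_lt_one (by positivity)]; linarith
  have hlt : nT / (1 + nT) * θ < 1 := by nlinarith
  have hsum := (hasSum_geometric_of_lt_one (mul_nonneg hy0 h0) hlt).mul_left (1 + nT)⁻¹
  have hc := (Complex.hasSum_ofReal).mpr hsum
  refine (hasSum_channel hT h0 h1 0 0 0 0).unique (hc.congr_fun fun e => ?_)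
  rw [hj, boseEinstein_eq, mul_pow]
  push_cast; ring

end Channel

/-! ### The output state is Gaussian -/

/-- The coefficient of `a† G a` in the ladder relations of the output state. -/
def gaussP (nB : ℝ) : ℝ := nB / (1 + nB)

/-- The coefficient of `b† G b` in the ladder relations of the output state. -/
def gaussQ (nS nB θ : ℝ) : ℝ := nS / (1 + nS) * (1 - θ / (1 + nB))

/-- The correlation coefficient in the ladder relations of the output state. -/
def gaussS (nS nB θ : ℝ) : ℝ := Real.sqrt (nS / (1 + nS)) * Real.sqrt θ / (1 + nB)

/-- The vacuum probability of the output state. -/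
def vacProb (nS nB : ℝ) : ℝ := (1 + nS)⁻¹ * (1 + nB)⁻¹

/-- The choice `nT = nB / (1 - θ)` cancels the dependence on `θ` of the added noise: neither
`gaussP` nor the vacuum factor depends on `θ`, and they contribute nothing to the derivative of the
state. -/
theorem envCorr_ratio {nB θ : ℝ} (hB : 0 < nB) (h1 : θ < 1) :
    (1 - θ) * (nB / (1 - θ) / (1 + nB / (1 - θ))) =
      gaussP nB * (1 - θ * (nB / (1 - θ) / (1 + nB / (1 - θ)))) ∧
    (1 + nB / (1 - θ))⁻¹ * (1 - nB / (1 - θ) / (1 + nB / (1 - θ)) * θ)⁻¹ = (1 + nB)⁻¹ ∧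
    0 < 1 - θ * (nB / (1 - θ) / (1 + nB / (1 - θ))) := by
  have hθ : 0 < 1 - θ := by linarith
  have h2 : 0 < 1 - θ + nB := by linarith
  have hy : nB / (1 - θ) / (1 + nB / (1 - θ)) = nB / (1 - θ + nB) := by
    field_simp
  have h3 : 1 - θ * (nB / (1 - θ + nB)) = (1 - θ) * (1 + nB) / (1 - θ + nB) := by
    field_simp; ring
  rw [hy, h3]
  refine ⟨?_, ?_, by positivity⟩
  · rw [gaussP]; field_simp
  · rw [mul_comm _ θ, h3]; field_simp

section

variable {nS nB θ : ℝ}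

theorem channelMatrix_out (hB : 0 < nB) (h0 : 0 < θ) (h1 : θ < 1) (n n' r r' : ℕ) :
    ((Real.sqrt (r + 1) : ℝ) : ℂ) * channelMatrix (nB / (1 - θ)) θ n n' (r + 1) r' =
      ((Real.sqrt θ / (1 + nB) : ℝ) : ℂ) *
        (((Real.sqrt n : ℝ) : ℂ) * channelMatrix (nB / (1 - θ)) θ (n - 1) n' r r') +
      (gaussP nB : ℂ) *
        (((Real.sqrt r' : ℝ) : ℂ) * channelMatrix (nB / (1 - θ)) θ n n' r (r' - 1)) := by
  have hT : 0 < nB / (1 - θ) := div_pos hB (by linarith)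
  obtain ⟨e1, -, e3⟩ := envCorr_ratio hB h1
  set y := nB / (1 - θ) / (1 + nB / (1 - θ)) with hy
  have ha := channelMatrix_succ_out hT h0.le h1.le n n' r r'
  have hb := envCorr_eq hT h0.le h1.le n n' r r'
  rw [← hy] at ha hb
  have q1 : (Real.sqrt θ : ℂ) * (Real.sqrt θ : ℂ) = θ := by
    rw [← Complex.ofReal_mul, Real.mul_self_sqrt h0.le]
  have q2 : (Real.sqrt (1 - θ) : ℂ) * (Real.sqrt (1 - θ) : ℂ) = 1 - θ := by
    rw [← Complex.ofReal_mul, Real.mul_self_sqrt (by linarith)]; push_cast; ring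
  have e1' : (1 - (θ : ℂ)) * y = gaussP nB * (1 - θ * y) := by exact_mod_cast e1
  have e3' : (1 - (θ : ℂ) * y) ≠ 0 := by exact_mod_cast e3.ne'
  have hp : ((Real.sqrt θ / (1 + nB) : ℝ) : ℂ) = Real.sqrt θ * (1 - gaussP nB) := by
    have : Real.sqrt θ / (1 + nB) = Real.sqrt θ * (1 - gaussP nB) := by
      rw [gaussP]; field_simp; ring
    rw [this]; push_cast; ring
  rw [hp, ha]
  set U := ((Real.sqrt n : ℝ) : ℂ) * channelMatrix (nB / (1 - θ)) θ (n - 1) n' r r'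
  set V := ((Real.sqrt r' : ℝ) : ℂ) * channelMatrix (nB / (1 - θ)) θ n n' r (r' - 1)
  rw [sq, q1] at hb
  -- Multiplying by the positive factor in front of `envCorr` makes its elimination polynomial.
  refine mul_right_cancel₀ e3' ?_
  linear_combination (Real.sqrt (1 - θ) : ℂ) * y * hb + (V - Real.sqrt θ * U) * e1' +
    (y * V - y * Real.sqrt θ * U) * q2

theorem channelMatrix_in (hB : 0 < nB) (h0 : 0 < θ) (h1 : θ < 1) (n n' r r' : ℕ) :
    ((Real.sqrt (n + 1) : ℝ) : ℂ) * channelMatrix (nB / (1 - θ)) θ (n + 1) n' r r' =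
      ((Real.sqrt θ / (1 + nB) : ℝ) : ℂ) *
        (((Real.sqrt r : ℝ) : ℂ) * channelMatrix (nB / (1 - θ)) θ n n' (r - 1) r') +
      ((1 - θ / (1 + nB) : ℝ) : ℂ) *
        (((Real.sqrt n' : ℝ) : ℂ) * channelMatrix (nB / (1 - θ)) θ n (n' - 1) r r') := by
  have hT : 0 < nB / (1 - θ) := div_pos hB (by linarith)
  obtain ⟨e1, -, e3⟩ := envCorr_ratio hB h1
  set y := nB / (1 - θ) / (1 + nB / (1 - θ)) with hy
  have ha := channelMatrix_succ_in hT h0.le h1.le n n' r r'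
  have hb := envCorr_eq hT h0.le h1.le n' n r' r
  rw [← hy] at ha hb
  have q1 : (Real.sqrt θ : ℂ) * (Real.sqrt θ : ℂ) = θ := by
    rw [← Complex.ofReal_mul, Real.mul_self_sqrt h0.le]
  have q2 : (Real.sqrt (1 - θ) : ℂ) * (Real.sqrt (1 - θ) : ℂ) = 1 - θ := by
    rw [← Complex.ofReal_mul, Real.mul_self_sqrt (by linarith)]; push_cast; ring
  have e1' : (1 - (θ : ℂ)) * y = gaussP nB * (1 - θ * y) := by exact_mod_cast e1
  have e3' : (1 - (θ : ℂ) * y) ≠ 0 := by exact_mod_cast e3.ne'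
  have hp : ((Real.sqrt θ / (1 + nB) : ℝ) : ℂ) = Real.sqrt θ * (1 - gaussP nB) := by
    have : Real.sqrt θ / (1 + nB) = Real.sqrt θ * (1 - gaussP nB) := by
      rw [gaussP]; field_simp; ring
    rw [this]; push_cast; ring
  have hq : ((1 - θ / (1 + nB) : ℝ) : ℂ) = 1 - θ + θ * gaussP nB := by
    have : 1 - θ / (1 + nB) = 1 - θ + θ * gaussP nB := by
      rw [gaussP]; field_simp; ring
    rw [this]; push_cast; ring
  rw [channelMatrix_symm _ _ n' n, channelMatrix_symm _ _ (n' - 1)] at hb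
  rw [hp, hq, ha]
  set U := ((Real.sqrt r : ℝ) : ℂ) * channelMatrix (nB / (1 - θ)) θ n n' (r - 1) r'
  set V := ((Real.sqrt n' : ℝ) : ℂ) * channelMatrix (nB / (1 - θ)) θ n (n' - 1) r r'
  rw [sq, q1] at hb
  refine mul_right_cancel₀ e3' ?_
  linear_combination (-(Real.sqrt (1 - θ) : ℂ) * Real.sqrt θ * y) * hb +
    (θ * V - Real.sqrt θ * U) * e1' + ((1 - θ) * V * y) * q1 +
    (Real.sqrt θ * Real.sqrt θ * y * V - Real.sqrt θ * y * U + V * (1 - θ * y)) * q2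

theorem sqrt_boseEinstein (hS : 0 < nS) (m : ℕ) : Real.sqrt (boseEinstein m nS) =
    Real.sqrt (1 + nS)⁻¹ * Real.sqrt (nS / (1 + nS)) ^ m := by
  rw [boseEinstein_eq, Real.sqrt_mul (by positivity)]
  congr 1
  rw [Real.sqrt_eq_iff_mul_self_eq (by positivity) (by positivity), ← mul_pow,
    Real.mul_self_sqrt (by positivity)]

/-- Perfect photon-number correlation of the squeezed vacuum collapses both sums: the idler indices
are the channel inputs. -/
theorem outputMatrix_eq (hS : 0 < nS) (x y : ℕ × ℕ) : outputMatrix nS nB θ x y =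
    (((1 + nS)⁻¹ * Real.sqrt (nS / (1 + nS)) ^ (x.2 + y.2) : ℝ) : ℂ) *
      channelMatrix (nB / (1 - θ)) θ x.2 y.2 x.1 y.1 := by
  rw [outputMatrix, tsum_eq_single x.2, tsum_eq_single y.2]
  · simp only [tmsv, if_true, Complex.conj_ofReal]
    rw [← Complex.ofReal_mul, sqrt_boseEinstein hS, sqrt_boseEinstein hS]
    congr 2
    rw [pow_add]
    linear_combination (Real.sqrt (nS / (1 + nS)) ^ x.2 * Real.sqrt (nS / (1 + nS)) ^ y.2) *
      Real.mul_self_sqrt (show 0 ≤ (1 + nS)⁻¹ by positivity)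
  · intro n' hn'
    simp [tmsv, hn']
  · intro n hn
    simp [tmsv, hn]

theorem outputMatrix_symm (hS : 0 < nS) (x y : ℕ × ℕ) :
    outputMatrix nS nB θ x y = outputMatrix nS nB θ y x := by
  rw [outputMatrix_eq hS, outputMatrix_eq hS, channelMatrix_symm, add_comm x.2]

theorem outputMatrix_left₁ (hS : 0 < nS) (hB : 0 < nB) (h0 : 0 < θ) (h1 : θ < 1) (r m i j : ℕ) :
    ((Real.sqrt (r + 1) : ℝ) : ℂ) * outputMatrix nS nB θ (r + 1, m) (i, j) =
    (gaussS nS nB θ : ℂ) * (((Real.sqrt m : ℝ) : ℂ) * outputMatrix nS nB θ (r, m - 1) (i, j)) +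
      (gaussP nB : ℂ) * (((Real.sqrt i : ℝ) : ℂ) * outputMatrix nS nB θ (r, m) (i - 1, j)) := by
  simp only [outputMatrix_eq hS]
  rw [mul_left_comm, channelMatrix_out hB h0 h1]
  have : ((Real.sqrt (nS / (1 + nS)) ^ (m + j) : ℝ) : ℂ) * ((Real.sqrt m : ℝ) : ℂ) =
      ((Real.sqrt (nS / (1 + nS)) : ℝ) : ℂ) * ((Real.sqrt (nS / (1 + nS)) ^ (m - 1 + j) : ℝ) : ℂ) *
        ((Real.sqrt m : ℝ) : ℂ) := by
    rcases m with _ | m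
    · simp
    · rw [show m + 1 + j = (m + 1 - 1 + j) + 1 by omega, pow_succ]; push_cast; ring
  rw [gaussS]
  push_cast at this ⊢
  linear_combination ((1 + nS : ℂ)⁻¹ * (Real.sqrt θ / (1 + nB)) *
    channelMatrix (nB / (1 - θ)) θ (m - 1) j r i) * this

theorem outputMatrix_left₂ (hS : 0 < nS) (hB : 0 < nB) (h0 : 0 < θ) (h1 : θ < 1) (r m i j : ℕ) :
    ((Real.sqrt (m + 1) : ℝ) : ℂ) * outputMatrix nS nB θ (r, m + 1) (i, j) =
    (gaussS nS nB θ : ℂ) * (((Real.sqrt r : ℝ) : ℂ) * outputMatrix nS nB θ (r - 1, m) (i, j)) +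
      (gaussQ nS nB θ : ℂ) * (((Real.sqrt j : ℝ) : ℂ) * outputMatrix nS nB θ (r, m) (i, j - 1)) := by
  simp only [outputMatrix_eq hS]
  rw [mul_left_comm, channelMatrix_in hB h0 h1]
  have hχ : (Real.sqrt (nS / (1 + nS)) : ℂ) * (Real.sqrt (nS / (1 + nS)) : ℂ) =
      ((nS / (1 + nS) : ℝ) : ℂ) := by
    rw [← Complex.ofReal_mul, Real.mul_self_sqrt (by positivity)]
  have : ((Real.sqrt (nS / (1 + nS)) ^ (m + 1 + j) : ℝ) : ℂ) * ((Real.sqrt j : ℝ) : ℂ) =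
      ((nS / (1 + nS) : ℝ) : ℂ) * ((Real.sqrt (nS / (1 + nS)) ^ (m + (j - 1)) : ℝ) : ℂ) *
        ((Real.sqrt j : ℝ) : ℂ) := by
    rcases j with _ | j
    · simp
    · rw [show m + 1 + (j + 1) = (m + (j + 1 - 1)) + 1 + 1 by omega, pow_succ, pow_succ, ← hχ]
      push_cast; ring
  have e : ((Real.sqrt (nS / (1 + nS)) ^ (m + 1 + j) : ℝ) : ℂ) =
      (Real.sqrt (nS / (1 + nS)) : ℂ) * ((Real.sqrt (nS / (1 + nS)) ^ (m + j) : ℝ) : ℂ) := by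
    rw [show m + 1 + j = (m + j) + 1 by omega, pow_succ]; push_cast; ring
  rw [gaussS, gaussQ]
  push_cast at this e ⊢
  linear_combination ((1 + nS : ℂ)⁻¹ * (1 - θ / (1 + nB)) *
    channelMatrix (nB / (1 - θ)) θ m (j - 1) r i) * this +
    ((1 + nS : ℂ)⁻¹ * (Real.sqrt θ / (1 + nB)) * ((Real.sqrt r : ℝ) : ℂ) *
    channelMatrix (nB / (1 - θ)) θ m j (r - 1) i) * e

theorem ladderRel_outputMatrix (hS : 0 < nS) (hB : 0 < nB) (h0 : 0 < θ) (h1 : θ < 1) :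
    LadderRel (gaussP nB : ℂ) (gaussQ nS nB θ : ℂ) (gaussS nS nB θ : ℂ) (gaussS nS nB θ : ℂ)
      (outputMatrix nS nB θ) where
  left₁ := outputMatrix_left₁ hS hB h0 h1
  left₂ := outputMatrix_left₂ hS hB h0 h1
  right₁ r m i j := by
    simp only [outputMatrix_symm hS (_, m)]
    exact outputMatrix_left₁ hS hB h0 h1 i j r m
  right₂ r m i j := by
    simp only [outputMatrix_symm hS (r, _)]
    exact outputMatrix_left₂ hS hB h0 h1 i j r m

theorem outputMatrix_eq_gker (hS : 0 < nS) (hB : 0 < nB) (h0 : 0 < θ) (h1 : θ < 1) :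
    outputMatrix nS nB θ = fun x y => (vacProb nS nB : ℂ) *
      gker (gaussS nS nB θ) (gaussS nS nB θ) (gaussP nB) (gaussQ nS nB θ) x y := by
  refine (ladderRel_outputMatrix hS hB h0 h1).unique ((ladderRel_gker _ _ _ _).const_mul _) ?_
  obtain ⟨-, e2, -⟩ := envCorr_ratio hB h1
  rw [gker_zero_zero, mul_one, outputMatrix_eq hS,
    channelMatrix_zero (div_pos hB (by linarith)) h0.le h1.le, e2, vacProb]
  push_cast; simp

end

/-! ### Operators with a summable kernel -/

/-- The operator with the matrix elements `k x y`. -/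
def opOf (k : ℕ × ℕ → ℕ × ℕ → ℂ) : Fock →L[ℂ] Fock :=
  ∑' z : (ℕ × ℕ) × (ℕ × ℕ), k z.1 z.2 • InnerProductSpace.rankOne ℂ (fock z.1) (fock z.2)

/-- A kernel whose matrix elements are absolutely summable. -/
def SummableKernel (k : ℕ × ℕ → ℕ × ℕ → ℂ) : Prop :=
  Summable fun z : (ℕ × ℕ) × (ℕ × ℕ) => ‖k z.1 z.2‖

theorem norm_rankOne_fock (x y : ℕ × ℕ) :
    ‖InnerProductSpace.rankOne ℂ (fock x) (fock y)‖ = 1 := by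
  rw [InnerProductSpace.norm_rankOne, fock.orthonormal.1, fock.orthonormal.1, one_mul]

theorem summable_wt_prod : Summable fun z : (ℕ × ℕ) × (ℕ × ℕ) => (wt z.1 ^ 4)⁻¹ * (wt z.2 ^ 4)⁻¹ :=
  summable_wt.mul_of_nonneg summable_wt (fun x => by have := wt_pos x; positivity)
    (fun x => by have := wt_pos x; positivity)

theorem RapidDecay.summableKernel {k : ℕ × ℕ → ℕ × ℕ → ℂ}
    (hk : RapidDecay wt (fun y x => k x y)) : SummableKernel k := by
  obtain ⟨B, hB⟩ := hk.exists_bound one_le_wt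
  exact (summable_wt_prod.mul_left B).of_nonneg_of_le (fun _ => norm_nonneg _) fun z => hB z.2 z.1

namespace SummableKernel

variable {k : ℕ × ℕ → ℕ × ℕ → ℂ}

theorem summable_rankOne (hk : SummableKernel k) : Summable fun z : (ℕ × ℕ) × (ℕ × ℕ) =>
    k z.1 z.2 • InnerProductSpace.rankOne ℂ (fock z.1) (fock z.2) :=
  Summable.of_norm_bounded hk fun z => by rw [norm_smul, norm_rankOne_fock, mul_one]

theorem hasSum_inner (hk : SummableKernel k) (φ ψ : Fock) :
    HasSum (fun z : (ℕ × ℕ) × (ℕ × ℕ) => k z.1 z.2 * (⟪φ, fock z.1⟫_ℂ * ⟪fock z.2, ψ⟫_ℂ))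
      ⟪φ, opOf k ψ⟫_ℂ := by
  have h := (hk.summable_rankOne.hasSum.mapL (ContinuousLinearMap.apply ℂ Fock ψ)).mapL
    (innerSL ℂ φ)
  refine h.congr_fun fun z => ?_
  simp only [innerSL_apply_apply, ContinuousLinearMap.apply_apply, smul_apply,
    InnerProductSpace.rankOne_apply, inner_smul_right]
  ring

theorem inner_opOf (hk : SummableKernel k) (x y : ℕ × ℕ) :
    ⟪fock x, opOf k (fock y)⟫_ℂ = k x y := by
  refine (hk.hasSum_inner (fock x) (fock y)).unique ?_
  have e : k x y = (fun z : (ℕ × ℕ) × (ℕ × ℕ) =>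
      k z.1 z.2 * (⟪fock x, fock z.1⟫_ℂ * ⟪fock z.2, fock y⟫_ℂ)) (x, y) := by
    simp only [inner_fock, fock_apply, if_true, mul_one]
  rw [e]
  refine hasSum_single (x, y) ?_
  rintro ⟨x', y'⟩ h
  simp only [inner_fock, fock_apply]
  by_cases h1 : x' = x
  · have h2 : y' ≠ y := fun h2 => h (by rw [h1, h2])
    simp [h2]
  · simp [Ne.symm h1]

theorem opOf_apply (hk : SummableKernel k) (φ : Fock) (x : ℕ × ℕ) :
    HasSum (fun y => k x y * φ y) (opOf k φ x) := by
  have h := (fock.hasSum_repr φ).mapL ((innerSL ℂ (fock x)).comp (opOf k))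
  simp only [ContinuousLinearMap.comp_apply, innerSL_apply_apply, inner_fock] at h
  refine h.congr_fun fun y => ?_
  rw [map_smul, ← inner_fock x, inner_smul_right, hk.inner_opOf, fock.repr_apply_apply, inner_fock]
  ring

theorem eq_opOf (hk : SummableKernel k) {A : Fock →L[ℂ] Fock}
    (h : ∀ x y, ⟪fock x, A (fock y)⟫_ℂ = k x y) : A = opOf k :=
  clm_ext fun x y => by rw [h, hk.inner_opOf]

/-- Parseval and `2xy ≤ x² + y²`; the uniform bound dominates the double sum in the proof that the
trace is independent of the basis. -/
theorem norm_inner_mul_inner_le (b : HilbertBasis (ℕ × ℕ) ℂ Fock) (x y : ℕ × ℕ) :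
    Summable (fun i => ‖⟪b i, fock x⟫_ℂ * ⟪fock y, b i⟫_ℂ‖) ∧
      ∑' i, ‖⟪b i, fock x⟫_ℂ * ⟪fock y, b i⟫_ℂ‖ ≤ 1 := by
  have hs : ∀ x, HasSum (fun i => ‖⟪b i, fock x⟫_ℂ‖ ^ 2) 1 := by
    intro x
    have h := b.hasSum_inner_mul_inner (fock x) (fock x)
    rw [inner_self_eq_norm_sq_to_K, fock.orthonormal.1] at h
    have h2 : HasSum (fun i => ((‖⟪b i, fock x⟫_ℂ‖ ^ 2 : ℝ) : ℂ)) ((1 : ℝ) : ℂ) := by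
      simp only [RCLike.ofReal_one, one_pow] at h
      convert! h using 1
      ext i
      rw [Complex.ofReal_pow, ← Complex.conj_mul', inner_conj_symm]
    exact Complex.hasSum_ofReal.mp h2
  have hb : ∀ i, ‖⟪b i, fock x⟫_ℂ * ⟪fock y, b i⟫_ℂ‖ ≤
      (‖⟪b i, fock x⟫_ℂ‖ ^ 2 + ‖⟪b i, fock y⟫_ℂ‖ ^ 2) / 2 := by
    intro i
    rw [norm_mul, norm_inner_symm (fock y)]
    nlinarith [sq_nonneg (‖⟪b i, fock x⟫_ℂ‖ - ‖⟪b i, fock y⟫_ℂ‖)]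
  have h1 := ((hs x).add (hs y)).div_const 2
  have h2 := h1.summable.of_nonneg_of_le (fun _ => norm_nonneg _) hb
  refine ⟨h2, ?_⟩
  refine (h2.tsum_le_tsum hb h1.summable).trans ?_
  rw [h1.tsum_eq]; norm_num

/-- The trace of an operator with a summable kernel does not depend on the basis. -/
theorem exists_trace (hk : SummableKernel k) :
    ∃ τ : ℂ, ∀ b : HilbertBasis (ℕ × ℕ) ℂ Fock, HasSum (fun i => ⟪b i, opOf k (b i)⟫_ℂ) τ := by
  refine ⟨∑' z : (ℕ × ℕ) × (ℕ × ℕ), k z.1 z.2 * ⟪fock z.2, fock z.1⟫_ℂ, fun b => ?_⟩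
  set f : ((ℕ × ℕ) × (ℕ × ℕ)) × (ℕ × ℕ) → ℂ := fun w =>
    k w.1.1 w.1.2 * (⟪b w.2, fock w.1.1⟫_ℂ * ⟪fock w.1.2, b w.2⟫_ℂ) with hf
  have hsum : Summable f := by
    refine Summable.of_norm ?_
    rw [summable_prod_of_nonneg (fun _ => norm_nonneg _)]
    refine ⟨fun z => ?_, ?_⟩
    · simp only [hf, norm_mul (k _ _)]
      exact (norm_inner_mul_inner_le b z.1 z.2).1.mul_left _
    · refine hk.of_nonneg_of_le (fun z => tsum_nonneg fun _ => norm_nonneg _) fun z => ?_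
      simp only [hf, norm_mul (k _ _), tsum_mul_left]
      exact mul_le_of_le_one_right (norm_nonneg _) (norm_inner_mul_inner_le b z.1 z.2).2
  have h1 : HasSum f (∑' z : (ℕ × ℕ) × (ℕ × ℕ), k z.1 z.2 * ⟪fock z.2, fock z.1⟫_ℂ) := by
    have e : ∀ z : (ℕ × ℕ) × (ℕ × ℕ), HasSum (fun i => f (z, i)) (k z.1 z.2 * ⟪fock z.2, fock z.1⟫_ℂ) := by
      intro z
      refine ((b.hasSum_inner_mul_inner (fock z.2) (fock z.1)).mul_left (k z.1 z.2)).congr_fun fun i => ?_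
      simp only [hf]; ring
    have := (hsum.hasSum.prod_fiberwise e).tsum_eq
    rw [this]; exact hsum.hasSum
  -- The same absolutely convergent double sum, with the basis index now outermost, consists of the
  -- diagonal elements in `b`.
  have h2 := (Equiv.prodComm (ℕ × ℕ) ((ℕ × ℕ) × (ℕ × ℕ))).hasSum_iff.mpr h1
  exact h2.prod_fiberwise fun i => hk.hasSum_inner (b i) (b i)

end SummableKernel

/-- A quadratic operator acts on the first index of the kernel and mixes at most three rows, so it
preserves joint decay and commutes with the sum over the second index. In particular the range of
`opOf k` lies in its maximal domain. -/
theorem quad_opOf {k : ℕ × ℕ → ℕ × ℕ → ℂ} (hk : RapidDecay wt (fun y x => k x y)) (C D E E' F : ℂ) :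
    RapidDecay wt (fun y x => quad C D E E' F (fun x' => k x' y) x) ∧
    ∀ φ : Fock, (⇑(opOf (fun x y => quad C D E E' F (fun x' => k x' y) x) φ) : Seq) =
      quad C D E E' F ⇑(opOf k φ) := by
  have w0 : ∀ y, 0 ≤ wt y := fun y => (wt_pos y).le
  have hr : RapidDecay wt (fun y x => quad C D E E' F (fun x' => k x' y) x) := by
    have h1 := ((hk.lower₁ one_le_wt).raise₁ one_le_wt).smul (fun _ => C) (fun _ => le_rfl) w0
    have h2 := ((hk.lower₂ one_le_wt).raise₂ one_le_wt).smul (fun _ => D) (fun _ => le_rfl) w0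
    have h3 := ((hk.raise₂ one_le_wt).raise₁ one_le_wt).smul (fun _ => E) (fun _ => le_rfl) w0
    have h4 := ((hk.lower₂ one_le_wt).lower₁ one_le_wt).smul (fun _ => E') (fun _ => le_rfl) w0
    have h5 := hk.smul (fun _ => F) (fun _ => le_rfl) w0
    exact (((h1.add w0 h2).add w0 h3).add w0 h4).add w0 h5
  refine ⟨hr, fun φ => ?_⟩
  ext ⟨r, m⟩
  rw [quad_apply]
  refine (hr.summableKernel.opOf_apply φ (r, m)).unique ?_
  have h := hk.summableKernel.opOf_apply φ
  refine ((((h (r, m)).mul_left (C * r + D * m + F)).add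
    (((h (r - 1, m - 1)).mul_left (((Real.sqrt r : ℝ) : ℂ) * ((Real.sqrt m : ℝ) : ℂ))).mul_left E)).add
    (((h (r + 1, m + 1)).mul_left
      (((Real.sqrt (r + 1) : ℝ) : ℂ) * ((Real.sqrt (m + 1) : ℝ) : ℂ))).mul_left E')).congr_fun
    fun y => ?_
  rw [quad_apply]; ring

theorem hasDerivAt_smul_const {f : ℝ → ℂ} {f' : ℂ} {t : ℝ} (hf : HasDerivAt f f' t)
    (A : Fock →L[ℂ] Fock) : HasDerivAt (fun u => f u • A) (f' • A) t :=
  hf.smul_const A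

set_option maxHeartbeats 1000000 in
/-- Entrywise differentiation of an operator family with uniformly summable kernels. -/
theorem hasDerivAt_opOf {k k' : ℝ → ℕ × ℕ → ℕ × ℕ → ℂ} {I : Set ℝ} {θ : ℝ} (hI : IsOpen I)
    (hI' : IsPreconnected I) (hθ : θ ∈ I)
    (hk : SummableKernel (k θ)) {B : ℝ}
    (hB : ∀ t ∈ I, ∀ x y, ‖k' t x y‖ ≤ B * ((wt x ^ 4)⁻¹ * (wt y ^ 4)⁻¹))
    (hd : ∀ t ∈ I, ∀ x y, HasDerivAt (fun u => k u x y) (k' t x y) t) :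
    HasDerivAt (fun t => opOf (k t)) (opOf (k' θ)) θ := by
  simp only [opOf]
  refine hasDerivAt_tsum_of_isPreconnected (y := θ) (y₀ := θ)
    (g := fun (z : (ℕ × ℕ) × (ℕ × ℕ)) t =>
      k t z.1 z.2 • InnerProductSpace.rankOne ℂ (fock z.1) (fock z.2))
    (g' := fun (z : (ℕ × ℕ) × (ℕ × ℕ)) t =>
      k' t z.1 z.2 • InnerProductSpace.rankOne ℂ (fock z.1) (fock z.2))
    (summable_wt_prod.mul_left B) hI hI'
    (fun z t ht => hasDerivAt_smul_const (hd t ht z.1 z.2) _) (fun z t ht => ?_) hθ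
    hk.summable_rankOne hθ
  rw [norm_smul, norm_rankOne_fock, mul_one]
  exact hB t ht z.1 z.2

/-! ### The output state as an operator, and its derivative -/

/-- The matrix elements of the output state, in Gaussian form. -/
def outKer (nS nB θ : ℝ) (x y : ℕ × ℕ) : ℂ := (vacProb nS nB : ℂ) *
  gker (gaussS nS nB θ) (gaussS nS nB θ) (gaussP nB) (gaussQ nS nB θ) x y

theorem ladderRel_outKer (nS nB θ : ℝ) : LadderRel (gaussP nB : ℂ) (gaussQ nS nB θ : ℂ)
    (gaussS nS nB θ : ℂ) (gaussS nS nB θ : ℂ) (outKer nS nB θ) :=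
  (ladderRel_gker _ _ _ _).const_mul _

theorem outKer_symm (nS nB θ : ℝ) (x y : ℕ × ℕ) : outKer nS nB θ x y = outKer nS nB θ y x := by
  rw [outKer, gker_symm, outKer]

theorem conj_outKer (nS nB θ : ℝ) (x y : ℕ × ℕ) :
    (starRingEnd ℂ) (outKer nS nB θ x y) = outKer nS nB θ x y := by
  rw [outKer, map_mul, conj_gker, Complex.conj_ofReal]

section

variable {nS nB θ : ℝ}

theorem gaussS_sq (hS : 0 < nS) (hθ : 0 < θ) :
    gaussS nS nB θ ^ 2 = nS / (1 + nS) * θ / (1 + nB) ^ 2 := by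
  rw [gaussS, div_pow, mul_pow, Real.sq_sqrt (by positivity), Real.sq_sqrt hθ.le]

theorem gaussS_pos (hS : 0 < nS) (hB : 0 < nB) (hθ : 0 < θ) : 0 < gaussS nS nB θ := by
  rw [gaussS]; positivity

theorem gaussP_pos (hB : 0 < nB) : 0 < gaussP nB := by rw [gaussP]; positivity

theorem gaussQ_pos (hS : 0 < nS) (hB : 0 < nB) (h1 : θ < 1) : 0 < gaussQ nS nB θ := by
  have : 0 < 1 - θ / (1 + nB) := by
    rw [sub_pos, div_lt_one (by positivity)]; linarith
  rw [gaussQ]; positivity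

theorem vacProb_pos (hS : 0 < nS) (hB : 0 < nB) : 0 < vacProb nS nB := by
  rw [vacProb]; positivity

/-- The positive gap `(1 - p) (1 - q) - s²` is what makes the Gaussian kernel summable; it equals
the vacuum probability. -/
theorem one_sub_mul_one_sub (hS : 0 < nS) (hB : 0 < nB) (h0 : 0 < θ) :
    (1 - gaussP nB) * (1 - gaussQ nS nB θ) = gaussS nS nB θ ^ 2 + vacProb nS nB := by
  rw [gaussS_sq hS h0, gaussP, gaussQ, vacProb]
  field_simp
  ring

theorem hasDerivAt_gaussS (h0 : 0 < θ) :
    HasDerivAt (gaussS nS nB) (gaussS nS nB θ / (2 * θ)) θ := by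
  have h := ((Real.hasDerivAt_sqrt h0.ne').const_mul (Real.sqrt (nS / (1 + nS)))).div_const (1 + nB)
  refine h.congr_deriv ?_
  have h2 : Real.sqrt θ ≠ 0 := by positivity
  rw [gaussS]
  nth_rewrite 3 [← Real.sq_sqrt h0.le]
  field_simp

theorem hasDerivAt_gaussQ (nS nB θ : ℝ) :
    HasDerivAt (gaussQ nS nB) (-(nS / (1 + nS) / (1 + nB))) θ := by
  have h := (((hasDerivAt_id θ).div_const (1 + nB)).const_sub 1).const_mul (nS / (1 + nS))
  refine h.congr_deriv ?_
  ring

theorem exists_decay_params (hS : 0 < nS) (hB : 0 < nB) (h0 : 0 < θ) (h1 : θ < 1) :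
    ∃ δ ε ρ q₀ : ℝ, 0 ≤ δ ∧ 0 ≤ ε ∧ 0 ≤ ρ ∧ ρ < 1 ∧ gaussP nB + δ ≤ ρ ^ 2 ∧ q₀ + ε ≤ ρ ^ 2 ∧
      gaussS nS nB θ ^ 2 < δ * ε ∧ gaussQ nS nB θ < q₀ := by
  have hid := one_sub_mul_one_sub hS hB h0
  have hp := gaussP_pos hB
  have hq := gaussQ_pos hS hB h1
  have hc := vacProb_pos hS hB
  have hA1 : gaussP nB < 1 := by rw [gaussP, div_lt_one (by positivity)]; linarith
  have hs := sq_nonneg (gaussS nS nB θ)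
  set c := vacProb nS nB
  set p := gaussP nB
  set q := gaussQ nS nB θ
  have hAB : c ≤ (1 - p) * (1 - q) := by linarith
  have hB0 : 0 < 1 - q := by
    by_contra h
    nlinarith
  have hA : c ≤ 1 - p := by nlinarith
  have hB : c ≤ 1 - q := by nlinarith
  have hη : 0 ≤ 1 - c / 4 := by linarith
  have hρ : Real.sqrt (1 - c / 4) ^ 2 = 1 - c / 4 := Real.sq_sqrt hη
  -- The gap `c` is spent in quarters: both sums equal `ρ² = 1 - c/4`, the margin `q₀ - q = c/4`
  -- lets `θ` vary, and since `1 - p` and `1 - q` are at most `1` the product `δ ε` still exceeds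
  -- `s²` by at least `c/4`.
  refine ⟨1 - p - c / 4, 1 - q - 2 * (c / 4), Real.sqrt (1 - c / 4), q + c / 4, by linarith,
    by linarith, Real.sqrt_nonneg _, ?_, by rw [hρ]; linarith, by rw [hρ]; linarith, ?_,
    by linarith⟩
  · rw [Real.sqrt_lt' one_pos]; linarith
  · nlinarith

theorem rapidDecay_outKer (hS : 0 < nS) (hB : 0 < nB) (h0 : 0 < θ) (h1 : θ < 1) :
    ∃ I : Set ℝ, IsOpen I ∧ IsPreconnected I ∧ θ ∈ I ∧
      (∀ t ∈ I, 0 < t ∧ t < 1 ∧ |gaussS nS nB t / (2 * t)| ≤ 1 / θ) ∧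
      RapidDecay (fun t : I × (ℕ × ℕ) => wt t.2) (fun t x => outKer nS nB t.1 x t.2) := by
  obtain ⟨δ, ε, ρ, q₀, hδ, hε, hρ0, hρ1, hpδ, hqε, hs, hq⟩ := exists_decay_params hS hB h0 h1
  have cs : ContinuousAt (fun t => gaussS nS nB t ^ 2) θ :=
    (hasDerivAt_gaussS h0).continuousAt.pow 2
  have cq : ContinuousAt (gaussQ nS nB) θ := (hasDerivAt_gaussQ nS nB θ).continuousAt
  have ev : ∀ᶠ t in 𝓝 θ, gaussS nS nB t ^ 2 < δ * ε ∧ gaussQ nS nB t < q₀ ∧ θ / 2 < t ∧ t < 1 :=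
    (cs.eventually_lt_const hs).and ((cq.eventually_lt_const hq).and
      ((lt_mem_nhds (by linarith)).and (gt_mem_nhds h1)))
  obtain ⟨r, hr, hball⟩ := Metric.eventually_nhds_iff_ball.mp ev
  have hpp := gaussP_pos hB
  have pos : ∀ t ∈ Metric.ball θ r, 0 < t := fun t ht => by
    have := (hball t ht).2.2.1; linarith
  refine ⟨Metric.ball θ r, Metric.isOpen_ball, (convex_ball θ r).isPreconnected,
    Metric.mem_ball_self hr, fun t ht => ⟨pos t ht, (hball t ht).2.2.2, ?_⟩, ?_⟩
  -- In this ball `s ≤ 1` and `t > θ / 2`.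
  · have hst := gaussS_pos hS hB (pos t ht)
    have h2 := (hball t ht).1
    have h3 := (hball t ht).2.2.1
    have hq0 : 0 < q₀ := (gaussQ_pos hS hB h1).trans hq
    have hρ2 : ρ ^ 2 ≤ 1 := by nlinarith
    have hle : gaussS nS nB t ≤ 1 := by nlinarith
    have htp := pos t ht
    rw [abs_of_nonneg (by positivity), div_le_div_iff₀ (by positivity) h0]
    nlinarith
  · have hk := rapidDecay_gker (U := Metric.ball θ r) (s := fun t => (gaussS nS nB t : ℂ))
      (s' := fun t => (gaussS nS nB t : ℂ)) (p := fun _ => (gaussP nB : ℂ))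
      (q := fun t => (gaussQ nS nB t : ℂ)) hδ hε hρ0 hρ1
      (fun t => by rw [Complex.norm_real, Real.norm_eq_abs, sq_abs]; exact (hball t t.2).1.le)
      (fun t => by rw [Complex.norm_real, Real.norm_eq_abs, sq_abs]; exact (hball t t.2).1.le)
      (fun _ => by rw [Complex.norm_real, Real.norm_of_nonneg hpp.le])
      (fun t => by
        rw [Complex.norm_real, Real.norm_of_nonneg (gaussQ_pos hS hB (hball t t.2).2.2.2).le]
        exact (hball t t.2).2.1.le) hpδ hqε
    exact hk.smul (fun _ => (vacProb nS nB : ℂ)) (fun _ => le_rfl) (fun t => (wt_pos _).le)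

theorem rapidDecay_outKer_self (hS : 0 < nS) (hB : 0 < nB) (h0 : 0 < θ) (h1 : θ < 1) :
    RapidDecay wt (fun y x => outKer nS nB θ x y) := by
  obtain ⟨I, -, -, hθ, -, hk⟩ := rapidDecay_outKer hS hB h0 h1
  intro n
  obtain ⟨B, hB⟩ := hk n
  exact ⟨B, fun y x => hB (⟨θ, hθ⟩, y) x⟩

theorem summableKernel_outKer (hS : 0 < nS) (hB : 0 < nB) (h0 : 0 < θ) (h1 : θ < 1) :
    SummableKernel (outKer nS nB θ) := (rapidDecay_outKer_self hS hB h0 h1).summableKernel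

theorem isOutputState_opOf (hS : 0 < nS) (hB : 0 < nB) (h0 : 0 < θ) (h1 : θ < 1) :
    IsOutputState nS nB θ (opOf (outKer nS nB θ)) := fun x y => by
  rw [(summableKernel_outKer hS hB h0 h1).inner_opOf, outputMatrix_eq_gker hS hB h0 h1]; rfl

theorem isOutputState_outputState (hS : 0 < nS) (hB : 0 < nB) (h0 : 0 < θ) (h1 : θ < 1) :
    IsOutputState nS nB θ (outputState nS nB θ) :=
  Classical.epsilon_spec ⟨_, isOutputState_opOf hS hB h0 h1⟩

theorem outputState_eq (hS : 0 < nS) (hB : 0 < nB) (h0 : 0 < θ) (h1 : θ < 1) :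
    outputState nS nB θ = opOf (outKer nS nB θ) :=
  clm_ext fun x y => by
    rw [isOutputState_outputState hS hB h0 h1, isOutputState_opOf hS hB h0 h1]

/-- The matrix elements of the derivative of the output state. -/
def outKerDeriv (nS nB θ : ℝ) (x y : ℕ × ℕ) : ℂ :=
  ((gaussS nS nB θ / (2 * θ) : ℝ) : ℂ) *
    (raise₁ (raise₂ fun x' => outKer nS nB θ x' y) x + raise₁ (raise₂ fun y' => outKer nS nB θ x y') y) +
  ((-(nS / (1 + nS) / (1 + nB)) : ℝ) : ℂ) *
    raise₂ (fun x' => raise₂ (fun y' => outKer nS nB θ x' y') y) x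

theorem hasDerivAt_outKer (h0 : 0 < θ) (x y : ℕ × ℕ) :
    HasDerivAt (fun t => outKer nS nB t x y) (outKerDeriv nS nB θ x y) θ := by
  obtain ⟨r, m⟩ := x
  obtain ⟨i, j⟩ := y
  have hs := (hasDerivAt_gaussS (nS := nS) (nB := nB) h0).ofReal_comp
  have hq := (hasDerivAt_gaussQ nS nB θ).ofReal_comp
  have h := (hasDerivAt_gker hs hs (hasDerivAt_const θ (gaussP nB : ℂ)) hq r m i j).const_mul
    (vacProb nS nB : ℂ)
  refine h.congr_deriv ?_
  simp only [outKerDeriv, outKer, raise₁_apply, raise₂_apply]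
  ring

theorem exists_bound_outKerDeriv {I : Set ℝ} (hI : ∀ t ∈ I, |gaussS nS nB t / (2 * t)| ≤ 1 / θ)
    (hk : RapidDecay (fun t : I × (ℕ × ℕ) => wt t.2) (fun t x => outKer nS nB t.1 x t.2)) :
    ∃ B : ℝ, ∀ t ∈ I, ∀ x y, ‖outKerDeriv nS nB t x y‖ ≤ B * ((wt x ^ 4)⁻¹ * (wt y ^ 4)⁻¹) := by
  have w1 : ∀ t : I × (ℕ × ℕ), 1 ≤ wt t.2 := fun t => one_le_wt _
  have w0 : ∀ t : I × (ℕ × ℕ), 0 ≤ wt t.2 := fun t => (wt_pos _).le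
  have hA := (hk.raise₂ w1).raise₁ w1
  have hT : RapidDecay (fun t : I × (ℕ × ℕ) => wt t.2) (fun t x => outKer nS nB t.1 t.2 x) :=
    hk.transpose (k := fun t : I => outKer nS nB t)
  have hB := RapidDecay.transpose
    (k := fun (t : I) x y => raise₁ (raise₂ (fun y' => outKer nS nB t y y')) x)
    ((hT.raise₂ w1).raise₁ w1)
  have hQ := (RapidDecay.transpose
    (k := fun (t : I) x y => raise₂ (fun y' => outKer nS nB t y y') x) (hT.raise₂ w1)).raise₂ w1
  have hc : ∀ t : I × (ℕ × ℕ), ‖((gaussS nS nB t.1 / (2 * t.1) : ℝ) : ℂ)‖ ≤ 1 / θ := fun t => by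
    rw [Complex.norm_real, Real.norm_eq_abs]; exact hI t.1 t.1.2
  have h := ((hA.add w0 hB).smul (fun t => ((gaussS nS nB t.1 / (2 * t.1) : ℝ) : ℂ)) hc w0).add w0
    (hQ.smul (fun _ => ((-(nS / (1 + nS) / (1 + nB)) : ℝ) : ℂ)) (fun _ => le_rfl) w0)
  obtain ⟨B, hB⟩ := h.exists_bound w1
  exact ⟨B, fun t ht x y => hB (⟨t, ht⟩, y) x⟩

theorem hasDerivAt_outputState (hS : 0 < nS) (hB : 0 < nB) (h0 : 0 < θ) (h1 : θ < 1) :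
    SummableKernel (outKerDeriv nS nB θ) ∧
    HasDerivAt (outputState nS nB) (opOf (outKerDeriv nS nB θ)) θ := by
  obtain ⟨I, ho, hc, hθ, hI, hk⟩ := rapidDecay_outKer hS hB h0 h1
  obtain ⟨B, hb⟩ := exists_bound_outKerDeriv (fun t ht => (hI t ht).2.2) hk
  refine ⟨(summable_wt_prod.mul_left B).of_nonneg_of_le (fun _ => norm_nonneg _)
    fun z => hb θ hθ z.1 z.2, ?_⟩
  have h := hasDerivAt_opOf ho hc hθ (summableKernel_outKer hS hB h0 h1) hb
    (fun t ht x y => hasDerivAt_outKer (hI t ht).1 x y)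
  refine h.congr_of_eventuallyEq ?_
  filter_upwards [ho.mem_nhds hθ] with t ht
  exact outputState_eq hS hB (hI t ht).1 (hI t ht).2.1

end

/-! ### The symmetric logarithmic derivative -/

namespace LadderRel

variable {p q s s' : ℂ} {k : ℕ × ℕ → ℕ × ℕ → ℂ}

theorem number₁ (h : LadderRel p q s s' k) (r m i j : ℕ) : (r : ℂ) * k (r, m) (i, j) =
    s * (((Real.sqrt r : ℝ) : ℂ) * ((Real.sqrt m : ℝ) : ℂ) * k (r - 1, m - 1) (i, j)) +
    p * (((Real.sqrt r : ℝ) : ℂ) * ((Real.sqrt i : ℝ) : ℂ) * k (r - 1, m) (i - 1, j)) := by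
  rcases r with _ | r
  · simp
  · have h1 := h.left₁ r m i j
    have h2 := sqrt_succ_mul_self_complex r
    simp only [Nat.add_sub_cancel]
    push_cast
    linear_combination ((Real.sqrt (r + 1) : ℝ) : ℂ) * h1 - k (r + 1, m) (i, j) * h2

theorem number₂ (h : LadderRel p q s s' k) (r m i j : ℕ) : (m : ℂ) * k (r, m) (i, j) =
    s * (((Real.sqrt r : ℝ) : ℂ) * ((Real.sqrt m : ℝ) : ℂ) * k (r - 1, m - 1) (i, j)) +
    q * (((Real.sqrt m : ℝ) : ℂ) * ((Real.sqrt j : ℝ) : ℂ) * k (r, m - 1) (i, j - 1)) := by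
  rcases m with _ | m
  · simp
  · have h1 := h.left₂ r m i j
    have h2 := sqrt_succ_mul_self_complex m
    simp only [Nat.add_sub_cancel]
    push_cast
    linear_combination ((Real.sqrt (m + 1) : ℝ) : ℂ) * h1 - k (r, m + 1) (i, j) * h2

theorem annihilate (h : LadderRel p q s s' k) (r m i j : ℕ) :
    ((Real.sqrt (r + 1) : ℝ) : ℂ) * ((Real.sqrt (m + 1) : ℝ) : ℂ) * k (r + 1, m + 1) (i, j) =
    s * ((m + 1) * k (r, m) (i, j)) +
    p * s * (((Real.sqrt r : ℝ) : ℂ) * ((Real.sqrt i : ℝ) : ℂ) * k (r - 1, m) (i - 1, j)) +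
    p * q * (((Real.sqrt i : ℝ) : ℂ) * ((Real.sqrt j : ℝ) : ℂ) * k (r, m) (i - 1, j - 1)) := by
  have h1 := h.left₁ r (m + 1) i j
  have h2 := h.left₂ r m (i - 1) j
  have h3 := sqrt_succ_mul_self_complex m
  simp only [Nat.add_sub_cancel] at h1
  push_cast at h1
  linear_combination ((Real.sqrt (m + 1) : ℝ) : ℂ) * h1 + p * ((Real.sqrt i : ℝ) : ℂ) * h2 +
    s * k (r, m) (i, j) * h3

/-- The kernel of `(X a†a + Y b†b + Z (a†b† + ab) + W) G`, in normal order around `G`. -/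
theorem quad_apply (h : LadderRel p q s s' k) (X Y Z W : ℂ) (r m i j : ℕ) :
    quad X Y Z Z W (fun x' => k x' (i, j)) (r, m) =
    ((X + Y) * s + Z + Z * s ^ 2) *
      (((Real.sqrt r : ℝ) : ℂ) * ((Real.sqrt m : ℝ) : ℂ) * k (r - 1, m - 1) (i, j)) +
    p * (X + Z * s) * (((Real.sqrt r : ℝ) : ℂ) * ((Real.sqrt i : ℝ) : ℂ) * k (r - 1, m) (i - 1, j)) +
    q * (Y + Z * s) * (((Real.sqrt m : ℝ) : ℂ) * ((Real.sqrt j : ℝ) : ℂ) * k (r, m - 1) (i, j - 1)) +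
    Z * p * q * (((Real.sqrt i : ℝ) : ℂ) * ((Real.sqrt j : ℝ) : ℂ) * k (r, m) (i - 1, j - 1)) +
    (W + Z * s) * k (r, m) (i, j) := by
  rw [TMSV.quad_apply]
  linear_combination X * h.number₁ r m i j + (Y + Z * s) * h.number₂ r m i j +
    Z * h.annihilate r m i j

end LadderRel

/-- The coefficient of `a†b† + ab` in the symmetric logarithmic derivative. -/
def sldCross (nS nB θ : ℝ) : ℝ := gaussS nS nB θ * (1 / θ + 1 / (1 + nB - θ)) /
  (1 - gaussS nS nB θ ^ 2 + gaussP nB * gaussQ nS nB θ)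

/-- The coefficient of `a†a` in the symmetric logarithmic derivative, and its constant term. -/
def sldFst (nS nB θ : ℝ) : ℝ := -(sldCross nS nB θ * gaussS nS nB θ)

/-- The coefficient of `b†b` in the symmetric logarithmic derivative. -/
def sldSnd (nS nB θ : ℝ) : ℝ := -(1 / (1 + nB - θ)) - sldCross nS nB θ * gaussS nS nB θ

/-- The symmetric logarithmic derivative in the original modes. -/
def logDeriv (nS nB θ : ℝ) : Fock →ₗ.[ℂ] Fock :=
  maxOp (sldFst nS nB θ : ℂ) (sldSnd nS nB θ : ℂ) (sldCross nS nB θ : ℂ) (sldCross nS nB θ : ℂ)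
    (sldFst nS nB θ : ℂ)

/-- The kernel of `Λ σ`. -/
def sldKer (nS nB θ : ℝ) (x y : ℕ × ℕ) : ℂ :=
  quad (sldFst nS nB θ : ℂ) (sldSnd nS nB θ : ℂ) (sldCross nS nB θ : ℂ) (sldCross nS nB θ : ℂ)
    (sldFst nS nB θ : ℂ) (fun x' => outKer nS nB θ x' y) x

section

variable {nS nB θ : ℝ}

theorem sldCross_denom_pos (hS : 0 < nS) (hB : 0 < nB) (h0 : 0 < θ) (h1 : θ < 1) :
    0 < 1 - gaussS nS nB θ ^ 2 + gaussP nB * gaussQ nS nB θ := by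
  nlinarith [one_sub_mul_one_sub hS hB h0, vacProb_pos hS hB, gaussP_pos hB, gaussQ_pos hS hB h1]

/-- Matches the coefficients of `a†b† σ` and `σ ab`. Each gets `(X + Y) s + Z + Z s²` from one of
`Λσ`, `σΛ` and `Z p q` from the other, and half of the sum must be `s' = s / (2θ)`. -/
theorem sldCross_spec (hS : 0 < nS) (hB : 0 < nB) (h0 : 0 < θ) (h1 : θ < 1) :
    (sldFst nS nB θ + sldSnd nS nB θ) * gaussS nS nB θ + sldCross nS nB θ +
      sldCross nS nB θ * gaussS nS nB θ ^ 2 + sldCross nS nB θ * gaussP nB * gaussQ nS nB θ =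
        gaussS nS nB θ / θ := by
  have h : sldCross nS nB θ * (1 - gaussS nS nB θ ^ 2 + gaussP nB * gaussQ nS nB θ) =
      gaussS nS nB θ * (1 / θ + 1 / (1 + nB - θ)) := by
    rw [sldCross, div_mul_cancel₀ _ (sldCross_denom_pos hS hB h0 h1).ne']
  rw [sldFst, sldSnd]
  linear_combination h

/-- Matches the coefficient of `b† σ b`, which must be the derivative of `q`. -/
theorem sldSnd_spec (hB : 0 < nB) (h1 : θ < 1) :
    gaussQ nS nB θ * (sldSnd nS nB θ + sldCross nS nB θ * gaussS nS nB θ) =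
      -(nS / (1 + nS) / (1 + nB)) := by
  have h4 : (1 + nB - θ) ≠ 0 := by linarith
  have h5 : (1 + nB) ≠ 0 := by linarith
  rw [sldSnd, gaussQ, show 1 - θ / (1 + nB) = (1 + nB - θ) / (1 + nB) by field_simp]
  field_simp
  ring

/-- Comparison of the five normally ordered monomials around `σ`. Those of `a† σ a` and of `σ` are
absent from the derivative, which is why `sldFst` serves both as first coefficient and as constant
term. -/
theorem sldKer_add (hS : 0 < nS) (hB : 0 < nB) (h0 : 0 < θ) (h1 : θ < 1) (x y : ℕ × ℕ) :
    (1 / 2 : ℂ) * (sldKer nS nB θ x y + sldKer nS nB θ y x) = outKerDeriv nS nB θ x y := by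
  obtain ⟨r, m⟩ := x
  obtain ⟨i, j⟩ := y
  have hl := ladderRel_outKer nS nB θ
  have e1 := congrArg (fun t : ℝ => (t : ℂ)) (sldCross_spec hS hB h0 h1)
  have e2 := congrArg (fun t : ℝ => (t : ℂ)) (sldSnd_spec (nS := nS) hB h1)
  have e3 := congrArg (fun t : ℝ => (t : ℂ))
    (show sldFst nS nB θ + sldCross nS nB θ * gaussS nS nB θ = 0 by rw [sldFst]; ring)
  have hθ : (θ : ℂ) ≠ 0 := by exact_mod_cast h0.ne'
  have e4 : ((gaussS nS nB θ / (2 * θ) : ℝ) : ℂ) = 1 / 2 * ((gaussS nS nB θ / θ : ℝ) : ℂ) := by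
    push_cast; field_simp
  rw [sldKer, sldKer, hl.quad_apply, hl.quad_apply, outKerDeriv, e4]
  simp only [raise₁_apply, raise₂_apply]
  rw [outKer_symm nS nB θ (i, j) (r, m), outKer_symm nS nB θ (i - 1, j - 1) (r, m),
    outKer_symm nS nB θ (i, j) (r - 1, m - 1), outKer_symm nS nB θ (i - 1, j) (r - 1, m),
    outKer_symm nS nB θ (i, j - 1) (r, m - 1)]
  push_cast at e1 e2 e3 ⊢
  set A := outKer nS nB θ (r - 1, m - 1) (i, j)
  set B := outKer nS nB θ (r, m) (i - 1, j - 1)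
  set Q := outKer nS nB θ (r, m - 1) (i, j - 1)
  set P := outKer nS nB θ (r - 1, m) (i - 1, j)
  linear_combination
    (1 / 2 * (((Real.sqrt r : ℝ) : ℂ) * ((Real.sqrt m : ℝ) : ℂ) * A +
      ((Real.sqrt i : ℝ) : ℂ) * ((Real.sqrt j : ℝ) : ℂ) * B)) * e1 +
    (((Real.sqrt m : ℝ) : ℂ) * ((Real.sqrt j : ℝ) : ℂ) * Q) * e2 +
    (outKer nS nB θ (r, m) (i, j) +
      gaussP nB * (((Real.sqrt r : ℝ) : ℂ) * ((Real.sqrt i : ℝ) : ℂ) * P)) * e3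

theorem conj_sldKer (x y : ℕ × ℕ) :
    (starRingEnd ℂ) (sldKer nS nB θ x y) = sldKer nS nB θ x y := by
  obtain ⟨r, m⟩ := x
  rw [sldKer, TMSV.quad_apply]
  simp only [map_add, map_mul, conj_outKer, Complex.conj_ofReal, map_natCast]

theorem logDeriv_opOf (hS : 0 < nS) (hB : 0 < nB) (h0 : 0 < θ) (h1 : θ < 1) (φ : Fock) :
    ∃ h : outputState nS nB θ φ ∈ (logDeriv nS nB θ).domain,
      logDeriv nS nB θ ⟨outputState nS nB θ φ, h⟩ = opOf (sldKer nS nB θ) φ := by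
  have h2 := (quad_opOf (rapidDecay_outKer_self hS hB h0 h1) (sldFst nS nB θ : ℂ)
    (sldSnd nS nB θ : ℂ) (sldCross nS nB θ : ℂ) (sldCross nS nB θ : ℂ) (sldFst nS nB θ : ℂ)).2 φ
  rw [← outputState_eq hS hB h0 h1] at h2
  exact ⟨mem_maxOp_domain h2, maxOp_apply h2⟩

theorem hasDerivAt_sldKer (hS : 0 < nS) (hB : 0 < nB) (h0 : 0 < θ) (h1 : θ < 1) :
    HasDerivAt (outputState nS nB)
      ((1 / 2 : ℂ) • (opOf (sldKer nS nB θ) + star (opOf (sldKer nS nB θ)))) θ := by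
  obtain ⟨hs, hd⟩ := hasDerivAt_outputState hS hB h0 h1
  have hr : SummableKernel (sldKer nS nB θ) :=
    (quad_opOf (rapidDecay_outKer_self hS hB h0 h1) _ _ _ _ _).1.summableKernel
  have e : (1 / 2 : ℂ) • (opOf (sldKer nS nB θ) + star (opOf (sldKer nS nB θ))) =
      opOf (outKerDeriv nS nB θ) := by
    refine hs.eq_opOf fun x y => ?_
    rw [← sldKer_add hS hB h0 h1, smul_apply, add_apply, inner_smul_right, inner_add_right,
      hr.inner_opOf, ContinuousLinearMap.star_eq_adjoint, ContinuousLinearMap.adjoint_inner_right,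
      ← inner_conj_symm, hr.inner_opOf, conj_sldKer]
  rw [e]; exact hd

theorem isSLD_logDeriv (hS : 0 < nS) (hB : 0 < nB) (h0 : 0 < θ) (h1 : θ < 1) :
    IsSLD (outputState nS nB) θ (logDeriv nS nB θ) where
  selfAdjoint := isSelfAdjoint_maxOp _ _ _ _
  equation := ⟨opOf (sldKer nS nB θ), logDeriv_opOf hS hB h0 h1, hasDerivAt_sldKer hS hB h0 h1⟩

end

/-! ### The explicit scalars -/

section

variable {nS nB θ : ℝ}

/-- With `h = 1 + nB + nS + θ nS` this reads `a = h² - (2 corr)²`, so that `h / √a` and `2 corr /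
√a` are `cosh 2ζ` and `sinh 2ζ`. The identities between the scalars then become algebraic in `√a`
and `corr`. -/
theorem a_eq (nS nB θ : ℝ) :
    a nS nB θ = (1 + nB + nS + θ * nS) ^ 2 - 4 * (θ * nS * (1 + nS)) := by
  rw [a]; ring

theorem a_pos (hS : 0 < nS) (hB : 0 < nB) (h0 : 0 < θ) (h1 : θ < 1) : 0 < a nS nB θ := by
  have : 0 < 1 - θ := by linarith
  rw [a]; positivity

theorem sqrt_a_pos (hS : 0 < nS) (hB : 0 < nB) (h0 : 0 < θ) (h1 : θ < 1) :
    0 < Real.sqrt (a nS nB θ) := Real.sqrt_pos.mpr (a_pos hS hB h0 h1)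

theorem sqrt_a_sq (hS : 0 < nS) (hB : 0 < nB) (h0 : 0 < θ) (h1 : θ < 1) :
    Real.sqrt (a nS nB θ) ^ 2 = (1 + nB + nS + θ * nS) ^ 2 - 4 * (θ * nS * (1 + nS)) := by
  rw [Real.sq_sqrt (a_pos hS hB h0 h1).le, a_eq]

theorem sqrt_a_lt (hS : 0 < nS) (hB : 0 < nB) (h0 : 0 < θ) :
    Real.sqrt (a nS nB θ) < 1 + nB + nS + θ * nS := by
  rw [Real.sqrt_lt' (by positivity), a_eq]
  have : 0 < θ * nS * (1 + nS) := by positivity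
  linarith

/-- Half the amplitude `√a sinh (2ζ)` of the correlations. -/
def corr (nS θ : ℝ) : ℝ := Real.sqrt (θ * nS * (1 + nS))

theorem corr_pos (hS : 0 < nS) (h0 : 0 < θ) : 0 < corr nS θ := by rw [corr]; positivity

theorem corr_sq (hS : 0 < nS) (h0 : 0 < θ) : corr nS θ ^ 2 = θ * nS * (1 + nS) :=
  Real.sq_sqrt (by positivity)

theorem μ_sq (hS : 0 < nS) (hB : 0 < nB) (h0 : 0 < θ) : μ nS nB θ ^ 2 =
    (1 + nB + nS + θ * nS) / (2 * Real.sqrt (a nS nB θ)) + 1 / 2 :=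
  Real.sq_sqrt (by positivity)

theorem ν_sq (hS : 0 < nS) (hB : 0 < nB) (h0 : 0 < θ) (h1 : θ < 1) : ν nS nB θ ^ 2 =
    (1 + nB + nS + θ * nS) / (2 * Real.sqrt (a nS nB θ)) - 1 / 2 := by
  refine Real.sq_sqrt ?_
  have h2 := sqrt_a_lt hS hB h0
  have h3 := sqrt_a_pos hS hB h0 h1
  rw [sub_nonneg, div_le_div_iff₀ (by norm_num) (by positivity)]
  linarith

theorem μ_pos (hS : 0 < nS) (hB : 0 < nB) (h0 : 0 < θ) : 0 < μ nS nB θ :=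
  Real.sqrt_pos.mpr (by positivity)

theorem ν_nonneg (nS nB θ : ℝ) : 0 ≤ ν nS nB θ := Real.sqrt_nonneg _

theorem μ_mul_ν (hS : 0 < nS) (hB : 0 < nB) (h0 : 0 < θ) (h1 : θ < 1) :
    μ nS nB θ * ν nS nB θ = corr nS θ / Real.sqrt (a nS nB θ) := by
  have h3 := sqrt_a_pos hS hB h0 h1
  have hc := corr_pos hS h0
  refine (pow_left_inj₀ (mul_nonneg (μ_pos hS hB h0).le (ν_nonneg _ _ _)) (by positivity)
    two_ne_zero).mp ?_
  rw [mul_pow, μ_sq hS hB h0, ν_sq hS hB h0 h1, div_pow, corr_sq hS h0]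
  have := sqrt_a_sq hS hB h0 h1
  field_simp
  linear_combination -this

theorem exp_ζ (hS : 0 < nS) (hB : 0 < nB) (h0 : 0 < θ) :
    Real.exp (ζ nS nB θ) = μ nS nB θ + ν nS nB θ :=
  Real.exp_log (add_pos_of_pos_of_nonneg (μ_pos hS hB h0) (ν_nonneg _ _ _))

theorem exp_neg_ζ (hS : 0 < nS) (hB : 0 < nB) (h0 : 0 < θ) (h1 : θ < 1) :
    Real.exp (-ζ nS nB θ) = μ nS nB θ - ν nS nB θ := by
  rw [Real.exp_neg, exp_ζ hS hB h0]
  refine inv_eq_of_mul_eq_one_right ?_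
  linear_combination μ_sq hS hB h0 - ν_sq hS hB h0 h1

theorem cosh_ζ (hS : 0 < nS) (hB : 0 < nB) (h0 : 0 < θ) (h1 : θ < 1) :
    Real.cosh (ζ nS nB θ) = μ nS nB θ := by
  rw [Real.cosh_eq, exp_ζ hS hB h0, exp_neg_ζ hS hB h0 h1]; ring

theorem sinh_ζ (hS : 0 < nS) (hB : 0 < nB) (h0 : 0 < θ) (h1 : θ < 1) :
    Real.sinh (ζ nS nB θ) = ν nS nB θ := by
  rw [Real.sinh_eq, exp_ζ hS hB h0, exp_neg_ζ hS hB h0 h1]; ring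

/-- These products are free of `√a`; they serve to rationalize the denominators of `C`, `D` and `E`.
-/
theorem N₁_mul (hS : 0 < nS) (hB : 0 < nB) (h0 : 0 < θ) (h1 : θ < 1) :
    N₁ nS nB θ * (N₂ nS nB θ + 1) = nB * (1 + nS) := by
  rw [N₁, N₂]
  linear_combination (1 / 4) * sqrt_a_sq hS hB h0 h1

theorem N₂_mul (hS : 0 < nS) (hB : 0 < nB) (h0 : 0 < θ) (h1 : θ < 1) :
    N₂ nS nB θ * (N₁ nS nB θ + 1) = nS * (1 + nB - θ) := by
  rw [N₁, N₂]
  linear_combination (1 / 4) * sqrt_a_sq hS hB h0 h1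

theorem N₁_pos (hS : 0 < nS) (hB : 0 < nB) : 0 < N₁ nS nB θ := by
  have h2 : 1 + nS * (1 - θ) - nB < Real.sqrt (a nS nB θ) := by
    refine Real.lt_sqrt_of_sq_lt ?_
    rw [a_eq]
    nlinarith [mul_pos hB hS]
  rw [N₁]; linarith

theorem N₂_pos (hS : 0 < nS) (hB : 0 < nB) (h1 : θ < 1) : 0 < N₂ nS nB θ := by
  have h2 : 1 + nB - nS * (1 - θ) < Real.sqrt (a nS nB θ) := by
    refine Real.lt_sqrt_of_sq_lt ?_
    rw [a_eq]
    nlinarith [mul_pos hB hS, mul_pos hS (sub_pos.mpr h1)]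
  rw [N₂]; linarith

theorem N₁_eq (nS nB θ : ℝ) : N₁ nS nB θ = N₂ nS nB θ + nB - nS * (1 - θ) := by
  rw [N₁, N₂]; ring

/-- Multiplying by `N₂ + 1` turns the denominator into an expression without `√a`, which then enters
the second factor only linearly through `N₂`. -/
theorem C_eq (hS : 0 < nS) (hB : 0 < nB) (h0 : 0 < θ) (h1 : θ < 1) :
    C nS nB θ = μ nS nB θ ^ 2 * ((nS * (1 + nB - θ) - (1 + nB + θ * nS) * N₂ nS nB θ) /
      ((1 + nS) * (nS * (1 + nB - θ)))) := by
  have e1 := N₁_mul hS hB h0 h1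
  have e2 := N₂_mul hS hB h0 h1
  have p1 := N₁_pos (θ := θ) hS hB
  have p2 := N₂_pos hS hB h1
  have hb : 0 < 1 + nB - θ := by linarith
  rw [C]
  congr 1
  rw [div_eq_div_iff (by positivity) (by positivity)]
  have e3 := N₁_eq nS nB θ
  set N := N₁ nS nB θ
  set M := N₂ nS nB θ
  have f1 : (nB - N) * (M + 1) = nB * (M - nS) := by linear_combination -e1
  have f2 : M * (M - nS) = nS * (1 + nB - θ) - (1 + nB + θ * nS) * M := by
    linear_combination e2 - M * e3
  refine mul_right_cancel₀ (show M + 1 ≠ 0 by positivity) ?_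
  rw [← f2]
  linear_combination ((1 + nS) * (nS * (1 + nB - θ))) * f1 - (M - nS) * N * (M + 1) * e2 -
    (M - nS) * nS * (1 + nB - θ) * e1

theorem D_eq (hS : 0 < nS) (hB : 0 < nB) (h0 : 0 < θ) (h1 : θ < 1) :
    D nS nB θ = ν nS nB θ ^ 2 * ((nS * (1 + nB - θ) + (1 + nB + θ * nS) * (N₁ nS nB θ + 1)) /
      ((1 + nS) * (nS * (1 + nB - θ)))) := by
  have e1 := N₁_mul hS hB h0 h1
  have e2 := N₂_mul hS hB h0 h1
  have p1 := N₁_pos (θ := θ) hS hB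
  have p2 := N₂_pos hS hB h1
  have hb : 0 < 1 + nB - θ := by linarith
  rw [D]
  congr 1
  rw [div_eq_div_iff (by positivity) (by positivity)]
  have e3 := N₁_eq nS nB θ
  set N := N₁ nS nB θ
  set M := N₂ nS nB θ
  have f1 : (nB + 1 + M) * N = nB * (N + 1 + nS) := by linear_combination e1
  have f2 : (N + 1 + nS) * (N + 1) = nS * (1 + nB - θ) + (1 + nB + θ * nS) * (N + 1) := by
    linear_combination e2 + (N + 1) * e3
  refine mul_right_cancel₀ p1.ne' ?_
  rw [← f2]
  linear_combination ((1 + nS) * (nS * (1 + nB - θ))) * f1 - (N + 1 + nS) * N * (M + 1) * e2 -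
    (N + 1 + nS) * nS * (1 + nB - θ) * e1

theorem C_add_D (hS : 0 < nS) (hB : 0 < nB) (h0 : 0 < θ) (h1 : θ < 1) :
    C nS nB θ + D nS nB θ = θ * (1 + nB - nS + θ * nS) /
      (Real.sqrt (a nS nB θ) * (1 + nB - θ)) := by
  have hR := sqrt_a_pos hS hB h0 h1
  have hR2 := sqrt_a_sq hS hB h0 h1
  have hb : 0 < 1 + nB - θ := by linarith
  rw [C_eq hS hB h0 h1, D_eq hS hB h0 h1, μ_sq hS hB h0, ν_sq hS hB h0 h1, N₁, N₂]
  set R := Real.sqrt (a nS nB θ)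
  field_simp
  linear_combination (-2 * (1 + nB + θ * nS)) * hR2

theorem C_sub_D (hS : 0 < nS) (hB : 0 < nB) (h0 : 0 < θ) (h1 : θ < 1) :
    C nS nB θ - D nS nB θ = -(θ / (1 + nB - θ)) := by
  have hR := sqrt_a_pos hS hB h0 h1
  have hR2 := sqrt_a_sq hS hB h0 h1
  have hb : 0 < 1 + nB - θ := by linarith
  rw [C_eq hS hB h0 h1, D_eq hS hB h0 h1, μ_sq hS hB h0, ν_sq hS hB h0 h1, N₁, N₂]
  set R := Real.sqrt (a nS nB θ)
  field_simp
  ring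

theorem two_mul_N_pos (hS : 0 < nS) (hB : 0 < nB) (h1 : θ < 1) :
    0 < 1 + nS + nB + 2 * nS * nB - θ * nS := by
  nlinarith [mul_pos hS hB, mul_pos hS (sub_pos.mpr h1)]

theorem E_eq (hS : 0 < nS) (hB : 0 < nB) (h0 : 0 < θ) (h1 : θ < 1) :
    E nS nB θ = -(corr nS θ * (1 + nB + nS * (1 - θ)) /
      (Real.sqrt (a nS nB θ) * (1 + nS + nB + 2 * nS * nB - θ * nS))) := by
  have e : 2 * N₁ nS nB θ * N₂ nS nB θ + N₁ nS nB θ + N₂ nS nB θ + 1 =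
      1 + nS + nB + 2 * nS * nB - θ * nS := by
    linear_combination N₁_mul hS hB h0 h1 + N₂_mul hS hB h0 h1
  rw [E, e, μ_mul_ν hS hB h0 h1, N₁_eq]
  have h2 := (two_mul_N_pos hS hB h1).ne'
  have hR := sqrt_a_pos hS hB h0 h1
  field_simp
  ring

/-- Equivalently, `K` has mean zero in the product of thermal states with mean photon numbers `N₁`
and `N₂`. -/
theorem F_eq (hS : 0 < nS) (hB : 0 < nB) (h1 : θ < 1) :
    F nS nB θ = -(C nS nB θ * N₁ nS nB θ) - D nS nB θ * N₂ nS nB θ := by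
  have p1 := N₁_pos (θ := θ) hS hB
  have p2 := N₂_pos hS hB h1
  rw [F, C, D]
  field_simp
  ring

theorem gaussS_eq (hS : 0 < nS) (h0 : 0 < θ) :
    gaussS nS nB θ = corr nS θ / ((1 + nS) * (1 + nB)) := by
  have h : Real.sqrt (nS / (1 + nS)) * Real.sqrt θ = corr nS θ / (1 + nS) := by
    rw [corr, ← Real.sqrt_mul (by positivity), Real.sqrt_eq_iff_mul_self_eq (by positivity)
      (by positivity), div_mul_div_comm, Real.mul_self_sqrt (by positivity)]
    field_simp
  rw [gaussS, h, div_div]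

theorem sldCross_eq (hS : 0 < nS) (hB : 0 < nB) (h0 : 0 < θ) (h1 : θ < 1) :
    sldCross nS nB θ = corr nS θ * (1 + nB) /
      (θ * (1 + nB - θ) * (1 + nS + nB + 2 * nS * nB - θ * nS)) := by
  have hb : 0 < 1 + nB - θ := by linarith
  have hΔ := two_mul_N_pos hS hB h1
  have e : 1 - gaussS nS nB θ ^ 2 + gaussP nB * gaussQ nS nB θ =
      (1 + nS + nB + 2 * nS * nB - θ * nS) / ((1 + nS) * (1 + nB)) := by
    rw [gaussS_sq hS h0, gaussP, gaussQ]
    field_simp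
    ring
  rw [sldCross, e, gaussS_eq hS h0]
  have := hΔ.ne'
  have := hb.ne'
  field_simp
  ring

theorem sldFst_eq (hS : 0 < nS) (hB : 0 < nB) (h0 : 0 < θ) (h1 : θ < 1) :
    sldFst nS nB θ = -(nS / ((1 + nB - θ) * (1 + nS + nB + 2 * nS * nB - θ * nS))) := by
  have hb : 0 < 1 + nB - θ := by linarith
  have hΔ := two_mul_N_pos hS hB h1
  have := hΔ.ne'
  have := hb.ne'
  rw [sldFst, sldCross_eq hS hB h0 h1, gaussS_eq hS h0]
  field_simp
  rw [corr_sq hS h0]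

theorem sldSnd_eq (nS nB θ : ℝ) : sldSnd nS nB θ = sldFst nS nB θ - 1 / (1 + nB - θ) := by
  rw [sldSnd, sldFst]; ring

/-- Conjugation leaves `C - D` invariant and rotates the pair `(C + D, 2E)` hyperbolically by `2ζ`.
So only one identity for the rotated sum, one for the cross term and one for the constant are
needed. -/
theorem squeezeRel_ζ (hS : 0 < nS) (hB : 0 < nB) (h0 : 0 < θ) (h1 : θ < 1) :
    SqueezeRel (ζ nS nB θ) (C nS nB θ) (D nS nB θ) (E nS nB θ) (F nS nB θ)
      (-θ * sldFst nS nB θ) (-θ * sldSnd nS nB θ) (-θ * sldCross nS nB θ)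
      (-θ * sldFst nS nB θ) := by
  have hR := sqrt_a_pos hS hB h0 h1
  have hR2 := sqrt_a_sq hS hB h0 h1
  have hb : 0 < 1 + nB - θ := by linarith
  have hb' := hb.ne'
  have hΔ := (two_mul_N_pos hS hB h1).ne'
  have hg := corr_sq hS h0
  have hsum := C_add_D hS hB h0 h1
  have hdiff := C_sub_D hS hB h0 h1
  have hE := E_eq hS hB h0 h1
  have hm := μ_sq hS hB h0
  have hn := ν_sq hS hB h0 h1
  have hmn := μ_mul_ν hS hB h0 h1
  have hF := F_eq hS hB h1
  have hx := sldFst_eq hS hB h0 h1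
  have hy := sldSnd_eq nS nB θ
  have hz := sldCross_eq hS hB h0 h1
  rw [N₁, N₂] at hF
  -- The polynomial identities `key` and `key'` are the rotations of `C + D` and of `E` after
  -- clearing denominators; they hold because of the value of `a`.
  have key : (1 + nB - nS + θ * nS) * (1 + nB + nS + θ * nS) *
      (1 + nS + nB + 2 * nS * nB - θ * nS) + 4 * (nS * (1 + nS) * (1 + nB - θ) *
      (1 + nB + nS * (1 - θ))) = Real.sqrt (a nS nB θ) ^ 2 *
      (1 + nS + nB + 2 * nS * nB - θ * nS + 2 * nS) := by
    rw [hR2]; ring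
  have key' : (1 + nB) * Real.sqrt (a nS nB θ) ^ 2 = (1 + nB + nS + θ * nS) *
      (1 + nB + nS * (1 - θ)) * (1 + nB - θ) +
      θ * (1 + nB - nS + θ * nS) * (1 + nS + nB + 2 * nS * nB - θ * nS) := by
    rw [hR2]; ring
  -- From here on `Δ` and `√a` are free symbols, known only through the collected identities, which
  -- keeps the field arithmetic small.
  generalize 1 + nS + nB + 2 * nS * nB - θ * nS = Δ at *
  generalize Real.sqrt (a nS nB θ) = R at *
  have r1 : (C nS nB θ + D nS nB θ) * (1 + nB + nS + θ * nS) / R -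
      4 * (corr nS θ / R) * E nS nB θ = -θ * (2 * sldFst nS nB θ) + θ / (1 + nB - θ) := by
    rw [hsum, hE, hx]
    field_simp
    linear_combination θ * key + 4 * (1 + nB + nS * (1 - θ)) * (1 + nB - θ) * hg
  have r2 : (1 + nB + nS + θ * nS) / R * E nS nB θ - corr nS θ / R * (C nS nB θ + D nS nB θ) =
      -θ * sldCross nS nB θ := by
    rw [hsum, hE, hz]
    field_simp
    linear_combination corr nS θ * key'
  have r3 : (C nS nB θ + D nS nB θ) * R = θ * (1 + nB - nS + θ * nS) / (1 + nB - θ) := by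
    rw [hsum, mul_comm R, div_mul_eq_mul_div, mul_div_mul_right _ _ hR.ne']
  have e1 : (1 + nB + nS + θ * nS) / (2 * R) = (1 + nB + nS + θ * nS) / R / 2 := by
    rw [div_div, mul_comm R]
  rw [e1] at hm hn
  constructor <;> rw [cosh_ζ hS hB h0 h1, sinh_ζ hS hB h0 h1]
  · linear_combination -(C nS nB θ) * hm - D nS nB θ * hn + 2 * E nS nB θ * hmn - (1 / 2) * r1 -
      (1 / 2) * hdiff
  · linear_combination -(D nS nB θ) * hm - C nS nB θ * hn + 2 * E nS nB θ * hmn - (1 / 2) * r1 +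
      (1 / 2) * hdiff - θ * hy
  · linear_combination -(E nS nB θ) * (hm + hn) + (C nS nB θ + D nS nB θ) * hmn - r2
  · rw [hF]
    linear_combination -(C nS nB θ + D nS nB θ) * hn + 2 * E nS nB θ * hmn - (1 / 2) * r1 +
      (1 / 2) * r3 + (1 / 2) * (nB - nS * (1 - θ)) * hdiff

end

/-! ### The stated operator is the SLD found in the original modes -/

theorem smul_maxOp {c : ℂ} (hc : c ≠ 0) (C D E E' F : ℂ) :
    c • maxOp C D E E' F = maxOp (c * C) (c * D) (c * E) (c * E') (c * F) := by
  have hq : ∀ f : Seq, quad (c * C) (c * D) (c * E) (c * E') (c * F) f = c • quad C D E E' F f := by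
    intro f; ext ⟨r, m⟩
    rw [Pi.smul_apply, quad_apply, quad_apply, smul_eq_mul]; ring
  apply LinearPMap.eq_of_eq_graph
  ext ⟨φ, ψ⟩
  rw [mem_graph_maxOp, LinearPMap.mem_graph_iff, hq]
  constructor
  · rintro ⟨y, rfl, rfl⟩
    rw [LinearPMap.smul_apply, lp.coeFn_smul, coe_maxOp]
  · intro h
    have h' : (⇑(c⁻¹ • ψ) : Seq) = quad C D E E' F ⇑φ := by
      rw [lp.coeFn_smul, h, smul_smul, inv_mul_cancel₀ hc, one_smul]
    refine ⟨⟨φ, mem_maxOp_domain h'⟩, rfl, ?_⟩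
    rw [LinearPMap.smul_apply, maxOp_apply h', smul_smul, mul_inv_cancel₀ hc, one_smul]

theorem K_eq (nS nB θ : ℝ) :
    K nS nB θ = finQuad (C nS nB θ) (D nS nB θ) (E nS nB θ) (E nS nB θ) (F nS nB θ) := by
  refine LinearMap.ext fun v => ?_
  simp only [K, finQuad, LinearMap.add_apply, LinearMap.smul_apply, Module.End.mul_apply, smul_add,
    cre₁_cre₂, add_assoc]

section

variable {nS nB θ : ℝ}

theorem sld_eq (hS : 0 < nS) (hB : 0 < nB) (h0 : 0 < θ) (h1 : θ < 1) :
    sld nS nB θ = logDeriv nS nB θ := by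
  have hc : ((-(1 / θ) : ℝ) : ℂ) ≠ 0 := by
    rw [Complex.ofReal_ne_zero, neg_ne_zero]; positivity
  rw [sld, squeezer_eq, K_eq, closure_finQuad, conjugate_maxOp (squeezeRel_ζ hS hB h0 h1),
    smul_maxOp hc, logDeriv]
  have e : ∀ x : ℝ, ((-(1 / θ) : ℝ) : ℂ) * ((-θ * x : ℝ) : ℂ) = (x : ℂ) := by
    intro x
    rw [← Complex.ofReal_mul]
    congr 1
    field_simp
  simp only [e]

end

/-! ### Diagonalization of a Gaussian kernel by a squeezer -/

/-- The action of a kernel on sequences. -/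
def kerAct (k : ℕ × ℕ → ℕ × ℕ → ℂ) (f : Seq) : Seq := fun x => pair (k x) f

section

variable {k : ℕ × ℕ → ℕ × ℕ → ℂ} {p q s : ℂ} {f g : Seq}

theorem RapidDecay.swap (hk : RapidDecay wt (fun y x => k x y)) : RapidDecay wt (fun x => k x) := by
  intro n
  obtain ⟨B, hB⟩ := hk n
  exact ⟨B, fun x y => by rw [mul_comm (wt y)]; exact hB y x⟩

theorem RapidDecay.row (hk : RapidDecay wt (fun y x => k x y)) (x : ℕ × ℕ) : Rapid (k x) :=
  hk.swap.curry one_le_wt x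

theorem rapid_kerAct (hk : RapidDecay wt (fun y x => k x y)) (hf : Rapid f) :
    Rapid (kerAct k f) := by
  obtain ⟨A, hA⟩ := hf.bounded
  intro n
  -- Of the `n + 4` powers, `n` give the decay in `x` and four the summability in `y`.
  obtain ⟨B, hB⟩ := hk (n + 4)
  refine ⟨∑' y, B * A * (wt y ^ 4)⁻¹, fun _ x => ?_⟩
  have hA0 : 0 ≤ A := (norm_nonneg _).trans (hA 0)
  have hw := wt_pos x
  have hsum : Summable fun y => ‖k x y * f y‖ := ((hk.row x).summable_mul hA).norm
  calc ‖kerAct k f x‖ * (wt x * 1) ^ n ≤ (∑' y, ‖k x y * f y‖) * (wt x * 1) ^ n := by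
        gcongr; exact norm_tsum_le_tsum_norm hsum
    _ = ∑' y, ‖k x y * f y‖ * (wt x * 1) ^ n := tsum_mul_right.symm
    _ ≤ _ := by
        refine (hsum.mul_right _).tsum_le_tsum (fun y => ?_) (summable_wt.mul_left _)
        have hy := wt_pos y
        have hy1 := one_le_wt y
        have hx1 := one_le_wt x
        have h1 : ‖k x y‖ * wt x ^ n ≤ B * (wt y ^ 4)⁻¹ := by
          rw [← div_eq_mul_inv, le_div_iff₀ (by positivity)]
          refine le_trans ?_ (hB y x)
          rw [mul_pow, mul_assoc]
          have h2 : wt x ^ n ≤ wt x ^ (n + 4) := pow_le_pow_right₀ hx1 (by omega)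
          have h3 : wt y ^ 4 ≤ wt y ^ (n + 4) := pow_le_pow_right₀ hy1 (by omega)
          gcongr
        rw [norm_mul, mul_one]
        calc ‖k x y‖ * ‖f y‖ * wt x ^ n = (‖k x y‖ * wt x ^ n) * ‖f y‖ := by ring
          _ ≤ (B * (wt y ^ 4)⁻¹) * A := by
              gcongr
              · exact le_trans (by positivity) h1
              · exact hA y
          _ = _ := by ring

theorem kerAct_add (hk : RapidDecay wt (fun y x => k x y)) (hf : Rapid f) (hg : Rapid g) :
    kerAct k (f + g) = kerAct k f + kerAct k g := by
  ext x
  obtain ⟨B, hB⟩ := (hk.row x).bounded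
  exact pair_add_right hf hg hB

theorem kerAct_smul (c : ℂ) : kerAct k (c • f) = c • kerAct k f := by
  ext x; exact pair_smul_right _ _ _

/-- This and the next three turn the ladder relations into operator identities on rapidly decreasing
sequences, where they can be combined with the Bogoliubov relations. -/
theorem lower₁_kerAct (hk : RapidDecay wt (fun y x => k x y)) (h : LadderRel p q s s k)
    (hf : Rapid f) : lower₁ (kerAct k f) = s • raise₂ (kerAct k f) + p • kerAct k (lower₁ f) := by
  ext ⟨r, m⟩
  obtain ⟨B, hB⟩ := hf.bounded
  have e : ((Real.sqrt (r + 1) : ℝ) : ℂ) • k (r + 1, m) =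
      s • (((Real.sqrt m : ℝ) : ℂ) • k (r, m - 1)) + p • raise₁ (k (r, m)) := by
    ext ⟨i, j⟩; exact h.left₁ r m i j
  simp only [lower₁_apply, raise₂_apply, Pi.add_apply, Pi.smul_apply, smul_eq_mul, kerAct]
  rw [← pair_smul_left, e, pair_add_left (((hk.row _).smul _).smul _) ((hk.row _).raise₁.smul _) hB,
    pair_smul_left, pair_smul_left, pair_smul_left, pair_raise₁]

theorem lower₂_kerAct (hk : RapidDecay wt (fun y x => k x y)) (h : LadderRel p q s s k)
    (hf : Rapid f) : lower₂ (kerAct k f) = s • raise₁ (kerAct k f) + q • kerAct k (lower₂ f) := by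
  ext ⟨r, m⟩
  obtain ⟨B, hB⟩ := hf.bounded
  have e : ((Real.sqrt (m + 1) : ℝ) : ℂ) • k (r, m + 1) =
      s • (((Real.sqrt r : ℝ) : ℂ) • k (r - 1, m)) + q • raise₂ (k (r, m)) := by
    ext ⟨i, j⟩; exact h.left₂ r m i j
  simp only [lower₂_apply, raise₁_apply, Pi.add_apply, Pi.smul_apply, smul_eq_mul, kerAct]
  rw [← pair_smul_left, e, pair_add_left (((hk.row _).smul _).smul _) ((hk.row _).raise₂.smul _) hB,
    pair_smul_left, pair_smul_left, pair_smul_left, pair_raise₂]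

theorem kerAct_raise₁ (hk : RapidDecay wt (fun y x => k x y)) (h : LadderRel p q s s k)
    (hf : Rapid f) : kerAct k (raise₁ f) = s • kerAct k (lower₂ f) + p • raise₁ (kerAct k f) := by
  ext ⟨r, m⟩
  obtain ⟨B, hB⟩ := hf.bounded
  have e : lower₁ (k (r, m)) =
      s • raise₂ (k (r, m)) + p • (((Real.sqrt r : ℝ) : ℂ) • k (r - 1, m)) := by
    ext ⟨i, j⟩; exact h.right₁ r m i j
  simp only [raise₁_apply, Pi.add_apply, Pi.smul_apply, smul_eq_mul, kerAct]
  rw [← pair_lower₁, e, pair_add_left ((hk.row _).raise₂.smul _) (((hk.row _).smul _).smul _) hB,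
    pair_smul_left, pair_smul_left, pair_smul_left, pair_raise₂]

theorem kerAct_raise₂ (hk : RapidDecay wt (fun y x => k x y)) (h : LadderRel p q s s k)
    (hf : Rapid f) : kerAct k (raise₂ f) = s • kerAct k (lower₁ f) + q • raise₂ (kerAct k f) := by
  ext ⟨r, m⟩
  obtain ⟨B, hB⟩ := hf.bounded
  have e : lower₂ (k (r, m)) =
      s • raise₁ (k (r, m)) + q • (((Real.sqrt m : ℝ) : ℂ) • k (r, m - 1)) := by
    ext ⟨i, j⟩; exact h.right₂ r m i j
  simp only [raise₂_apply, Pi.add_apply, Pi.smul_apply, smul_eq_mul, kerAct]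
  rw [← pair_lower₂, e, pair_add_left ((hk.row _).raise₁.smul _) (((hk.row _).smul _).smul _) hB,
    pair_smul_left, pair_smul_left, pair_smul_left, pair_raise₁]

/-- The matrix elements of `S(η)† G S(η)`, as a bilinear form. -/
def sqForm (k : ℕ × ℕ → ℕ × ℕ → ℂ) (η : ℝ) (v w : FinFock) : ℂ :=
  pair (sqSeq η v) (kerAct k (sqSeq η w))

variable {η : ℝ} {t₁ t₂ : ℂ}

/-- For `G' = S(η)† G S(η)` this is `a G' = t₁ G' a`: the hypothesis `e1` cancels the cross term `b†
G`, and `e2` fixes the factor `t₁`. -/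
theorem sqForm_cre₁_left (hk : RapidDecay wt (fun y x => k x y)) (h : LadderRel p q s s k)
    (e1 : (Real.cosh η : ℂ) * s + Real.sinh η = t₁ * (Real.sinh η * q))
    (e2 : (Real.cosh η : ℂ) * p = t₁ * (Real.cosh η + Real.sinh η * s)) (v w : FinFock) :
    sqForm k η (cre₁ v) w = t₁ * sqForm k η v (ann₁ w) := by
  have hv := rapid_sqSeq η v
  have hw := rapid_sqSeq η w
  have hK := rapid_kerAct hk hw
  rw [sqForm, sqForm, sqSeq_cre₁, sqSeq_ann₁, pair_comb_left _ _ hv.raise₁ hv.lower₂ hK.lower₁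
    hK.raise₂ hK hv (pair_raise₁ _ _) (pair_lower₂ _ _), kerAct_add hk (hw.lower₁.smul _)
    (hw.raise₂.smul _), kerAct_smul, kerAct_smul, ← pair_smul_right, lower₁_kerAct hk h hw,
    kerAct_raise₂ hk h hw]
  congr 1
  linear_combination (norm := module) e1 • raise₂ (kerAct k (sqSeq η w)) +
    e2 • kerAct k (lower₁ (sqSeq η w))

theorem sqForm_cre₂_left (hk : RapidDecay wt (fun y x => k x y)) (h : LadderRel p q s s k)
    (e1 : (Real.cosh η : ℂ) * s + Real.sinh η = t₂ * (Real.sinh η * p))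
    (e2 : (Real.cosh η : ℂ) * q = t₂ * (Real.cosh η + Real.sinh η * s)) (v w : FinFock) :
    sqForm k η (cre₂ v) w = t₂ * sqForm k η v (ann₂ w) := by
  have hv := rapid_sqSeq η v
  have hw := rapid_sqSeq η w
  have hK := rapid_kerAct hk hw
  rw [sqForm, sqForm, sqSeq_cre₂, sqSeq_ann₂, pair_comb_left _ _ hv.raise₂ hv.lower₁ hK.lower₂
    hK.raise₁ hK hv (pair_raise₂ _ _) (pair_lower₁ _ _), kerAct_add hk (hw.lower₂.smul _)
    (hw.raise₁.smul _), kerAct_smul, kerAct_smul, ← pair_smul_right, lower₂_kerAct hk h hw,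
    kerAct_raise₁ hk h hw]
  congr 1
  linear_combination (norm := module) e1 • raise₁ (kerAct k (sqSeq η w)) +
    e2 • kerAct k (lower₂ (sqSeq η w))

theorem sqForm_cre₁_right (hk : RapidDecay wt (fun y x => k x y)) (h : LadderRel p q s s k)
    (e1 : (Real.cosh η : ℂ) * s + Real.sinh η = t₁ * (Real.sinh η * q))
    (e2 : (Real.cosh η : ℂ) * p = t₁ * (Real.cosh η + Real.sinh η * s)) (v w : FinFock) :
    sqForm k η v (cre₁ w) = t₁ * sqForm k η (ann₁ v) w := by
  have hv := rapid_sqSeq η v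
  have hw := rapid_sqSeq η w
  have hK := rapid_kerAct hk hw
  rw [sqForm, sqForm, sqSeq_cre₁, sqSeq_ann₁, pair_comb_left _ _ hv.lower₁ hv.raise₂ hK.raise₁
    hK.lower₂ hK hv (pair_lower₁ _ _) (pair_raise₂ _ _), kerAct_add hk (hw.raise₁.smul _)
    (hw.lower₂.smul _), kerAct_smul, kerAct_smul, ← pair_smul_right, lower₂_kerAct hk h hw,
    kerAct_raise₁ hk h hw]
  congr 1
  linear_combination (norm := module) e1 • kerAct k (lower₂ (sqSeq η w)) +
    e2 • raise₁ (kerAct k (sqSeq η w))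

theorem sqForm_cre₂_right (hk : RapidDecay wt (fun y x => k x y)) (h : LadderRel p q s s k)
    (e1 : (Real.cosh η : ℂ) * s + Real.sinh η = t₂ * (Real.sinh η * p))
    (e2 : (Real.cosh η : ℂ) * q = t₂ * (Real.cosh η + Real.sinh η * s)) (v w : FinFock) :
    sqForm k η v (cre₂ w) = t₂ * sqForm k η (ann₂ v) w := by
  have hv := rapid_sqSeq η v
  have hw := rapid_sqSeq η w
  have hK := rapid_kerAct hk hw
  rw [sqForm, sqForm, sqSeq_cre₂, sqSeq_ann₂, pair_comb_left _ _ hv.lower₂ hv.raise₁ hK.raise₂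
    hK.lower₁ hK hv (pair_lower₂ _ _) (pair_raise₁ _ _), kerAct_add hk (hw.raise₂.smul _)
    (hw.lower₁.smul _), kerAct_smul, kerAct_smul, ← pair_smul_right, lower₁_kerAct hk h hw,
    kerAct_raise₂ hk h hw]
  congr 1
  linear_combination (norm := module) e1 • kerAct k (lower₁ (sqSeq η w)) +
    e2 • raise₂ (kerAct k (sqSeq η w))

theorem sqForm_single (k : ℕ × ℕ → ℕ × ℕ → ℂ) (η : ℝ) (x y : ℕ × ℕ) (c d : ℂ) :
    sqForm k η (Finsupp.single x c) (Finsupp.single y d) =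
      c * (d * pair (fun z => sqk η z x) (kerAct k fun z => sqk η z y)) := by
  rw [sqForm, sqSeq_single, sqSeq_single, kerAct_smul, pair_smul_left, pair_smul_right]

theorem inner_sqOp_opOf (hk : SummableKernel k) (η : ℝ) (x y : ℕ × ℕ) :
    ⟪sqOp η (fock x), opOf k (sqOp η (fock y))⟫_ℂ =
      pair (fun z => sqk η z x) (kerAct k fun z => sqk η z y) := by
  rw [inner_eq_pair, sqOp_fock, sqOp_fock]
  simp only [Rapid.coe_toFock, conj_sqk]
  congr 1
  ext z
  exact ((hk.opOf_apply _ z).tsum_eq).symm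

/-- The conjugated kernel satisfies ladder relations without correlation, so by uniqueness it is a
multiple of the diagonal operator `t₁^n₁ t₂^n₂`. -/
theorem opOf_sqOp_fock (hk : RapidDecay wt (fun y x => k x y)) (h : LadderRel p q s s k)
    (e0 : (Real.cosh η : ℂ) * s + Real.sinh η = t₁ * (Real.sinh η * q))
    (e0' : (Real.cosh η : ℂ) * s + Real.sinh η = t₂ * (Real.sinh η * p))
    (e1 : (Real.cosh η : ℂ) * p = t₁ * (Real.cosh η + Real.sinh η * s))
    (e2 : (Real.cosh η : ℂ) * q = t₂ * (Real.cosh η + Real.sinh η * s)) :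
    ∃ τ : ℂ, ∀ y, opOf k (sqOp η (fock y)) = (τ * (t₁ ^ y.1 * t₂ ^ y.2)) • sqOp η (fock y) := by
  set l : ℕ × ℕ → ℕ × ℕ → ℂ := fun x y => pair (fun z => sqk η z x) (kerAct k fun z => sqk η z y)
    with hl
  have hlad : LadderRel t₁ t₂ 0 0 l := by
    constructor
    · intro r m i j
      have := sqForm_cre₁_left hk h e0 e1 (Finsupp.single (r, m) 1) (Finsupp.single (i, j) 1)
      simp only [cre₁_single, ann₁_single, sqForm_single, one_mul] at this
      rw [zero_mul, zero_add]; exact this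
    · intro r m i j
      have := sqForm_cre₂_left hk h e0' e2 (Finsupp.single (r, m) 1) (Finsupp.single (i, j) 1)
      simp only [cre₂_single, ann₂_single, sqForm_single, one_mul] at this
      rw [zero_mul, zero_add]; exact this
    · intro r m i j
      have := sqForm_cre₁_right hk h e0 e1 (Finsupp.single (r, m) 1) (Finsupp.single (i, j) 1)
      simp only [cre₁_single, ann₁_single, sqForm_single, one_mul] at this
      rw [zero_mul, zero_add]; exact this
    · intro r m i j
      have := sqForm_cre₂_right hk h e0' e2 (Finsupp.single (r, m) 1) (Finsupp.single (i, j) 1)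
      simp only [cre₂_single, ann₂_single, sqForm_single, one_mul] at this
      rw [zero_mul, zero_add]; exact this
  have hu := hlad.unique ((ladderRel_gker 0 0 t₁ t₂).const_mul (l (0, 0) (0, 0)))
    (by rw [gker_zero_zero, mul_one])
  refine ⟨l (0, 0) (0, 0), fun y => ?_⟩
  have e : sqOp (-η) (opOf k (sqOp η (fock y))) =
      (l (0, 0) (0, 0) * (t₁ ^ y.1 * t₂ ^ y.2)) • fock y := by
    ext x
    rw [← inner_fock, ← star_sqOp, ContinuousLinearMap.star_eq_adjoint,
      ContinuousLinearMap.adjoint_inner_right, inner_sqOp_opOf hk.summableKernel,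
      show pair (fun z => sqk η z x) (kerAct k fun z => sqk η z y) = l x y from rfl,
      show l x y = l (0, 0) (0, 0) * gker 0 0 t₁ t₂ x y from congrFun (congrFun hu x) y,
      gker_of_zero, lp.coeFn_smul, Pi.smul_apply, fock_apply]
    by_cases hxy : x = y
    · simp [hxy]
    · simp [hxy]
  rw [← map_smul, ← e, sqOp_apply_neg]

end

/-! ### Spectral decomposition of the output state -/

section

variable {nS nB θ : ℝ}

theorem gaussS_lt_one (hS : 0 < nS) (hB : 0 < nB) (h0 : 0 < θ) (h1 : θ < 1) :
    gaussS nS nB θ < 1 := by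
  have hA1 : gaussP nB < 1 := by rw [gaussP, div_lt_one (by positivity)]; linarith
  nlinarith [one_sub_mul_one_sub hS hB h0, vacProb_pos hS hB, gaussP_pos hB, gaussQ_pos hS hB h1,
    gaussS_pos hS hB h0, mul_pos (gaussQ_pos hS hB h1) (sub_pos.mpr hA1)]

/-- Equivalent to `tanh 2ζ = 2s / (1 + s² - p q)`, the choice of angle for which the cross terms of
both modes vanish at once. -/
theorem diagonal_condition (hS : 0 < nS) (hB : 0 < nB) (h0 : 0 < θ) (h1 : θ < 1) :
    (μ nS nB θ * gaussS nS nB θ - ν nS nB θ) * (μ nS nB θ - ν nS nB θ * gaussS nS nB θ) =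
      -(μ nS nB θ * ν nS nB θ * (gaussP nB * gaussQ nS nB θ)) := by
  have hm := μ_sq hS hB h0
  have hn := ν_sq hS hB h0 h1
  have hmn := μ_mul_ν hS hB h0 h1
  have hR := sqrt_a_pos hS hB h0 h1
  have e : 1 + gaussS nS nB θ ^ 2 - gaussP nB * gaussQ nS nB θ =
      (1 + nB + nS + θ * nS) / ((1 + nS) * (1 + nB)) := by
    rw [gaussS_sq hS h0, gaussP, gaussQ]
    field_simp
    ring
  have h2 : gaussS nS nB θ * (μ nS nB θ ^ 2 + ν nS nB θ ^ 2) = μ nS nB θ * ν nS nB θ *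
      (1 + gaussS nS nB θ ^ 2 - gaussP nB * gaussQ nS nB θ) := by
    rw [e, hm, hn, hmn, gaussS_eq hS h0]
    field_simp
    ring
  linear_combination h2

theorem ν_lt_μ (hS : 0 < nS) (hB : 0 < nB) (h0 : 0 < θ) (h1 : θ < 1) : ν nS nB θ < μ nS nB θ := by
  have := exp_neg_ζ hS hB h0 h1
  linarith [Real.exp_pos (-ζ nS nB θ)]

theorem μ_sub_pos (hS : 0 < nS) (hB : 0 < nB) (h0 : 0 < θ) (h1 : θ < 1) :
    0 < μ nS nB θ - ν nS nB θ * gaussS nS nB θ := by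
  nlinarith [ν_lt_μ hS hB h0 h1, ν_nonneg nS nB θ, gaussS_lt_one hS hB h0 h1]

/-- The eigenvectors of the output state. -/
def eigVec (nS nB θ : ℝ) (x : ℕ × ℕ) : Fock := sqOp (-ζ nS nB θ) (fock x)

theorem exists_eigenvalues (hS : 0 < nS) (hB : 0 < nB) (h0 : 0 < θ) (h1 : θ < 1) :
    ∃ (τ : ℂ) (t₁ t₂ : ℝ), 0 < t₁ ∧ 0 < t₂ ∧ ∀ y, outputState nS nB θ (eigVec nS nB θ y) =
      (τ * ((t₁ ^ y.1 * t₂ ^ y.2 : ℝ) : ℂ)) • eigVec nS nB θ y := by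
  have hd := μ_sub_pos hS hB h0 h1
  have hc := diagonal_condition hS hB h0 h1
  have hμ := μ_pos hS hB h0
  have hp := gaussP_pos hB
  have hq := gaussQ_pos hS hB h1
  set m := μ nS nB θ
  set n := ν nS nB θ
  set s := gaussS nS nB θ
  set p := gaussP nB
  set q := gaussQ nS nB θ
  have hch : Real.cosh (-ζ nS nB θ) = m := by rw [Real.cosh_neg, cosh_ζ hS hB h0 h1]
  have hsh : Real.sinh (-ζ nS nB θ) = -n := by rw [Real.sinh_neg, sinh_ζ hS hB h0 h1]
  have f0 : m * s + -n = m * p / (m - n * s) * (-n * q) := by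
    rw [div_mul_eq_mul_div, eq_div_iff hd.ne']; linear_combination hc
  have f0' : m * s + -n = m * q / (m - n * s) * (-n * p) := by
    rw [div_mul_eq_mul_div, eq_div_iff hd.ne']; linear_combination hc
  have f1 : m * p = m * p / (m - n * s) * (m + -n * s) := by
    rw [div_mul_eq_mul_div, eq_div_iff hd.ne']; ring
  have f2 : m * q = m * q / (m - n * s) * (m + -n * s) := by
    rw [div_mul_eq_mul_div, eq_div_iff hd.ne']; ring
  obtain ⟨τ, hτ⟩ := opOf_sqOp_fock (η := -ζ nS nB θ) (t₁ := ((m * p / (m - n * s) : ℝ) : ℂ))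
    (t₂ := ((m * q / (m - n * s) : ℝ) : ℂ))
    (rapidDecay_outKer_self hS hB h0 h1) (ladderRel_outKer nS nB θ)
    (by rw [hch, hsh]; exact_mod_cast f0) (by rw [hch, hsh]; exact_mod_cast f0')
    (by rw [hch, hsh]; exact_mod_cast f1) (by rw [hch, hsh]; exact_mod_cast f2)
  refine ⟨τ, m * p / (m - n * s), m * q / (m - n * s), by positivity, by positivity, fun y => ?_⟩
  rw [outputState_eq hS hB h0 h1, eigVec, hτ y]
  push_cast
  rfl

theorem sqOp_comp (α β : ℝ) (φ : Fock) : sqOp α (sqOp β φ) = sqOp (α + β) φ := by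
  rw [← mul_apply_eq_comp, sqOp_mul]

theorem inner_sqOp_sqOp (α : ℝ) (φ ψ : Fock) : ⟪sqOp α φ, sqOp α ψ⟫_ℂ = ⟪φ, ψ⟫_ℂ :=
  norm_of_mem_unitary (sqOp_mem_unitary α) φ ψ

theorem inner_sqOp_left (α : ℝ) (φ ψ : Fock) : ⟪sqOp α φ, ψ⟫_ℂ = ⟪φ, sqOp (-α) ψ⟫_ℂ := by
  rw [← inner_sqOp_sqOp α φ, sqOp_apply_neg]

/-- The squeezed Fock states form a Hilbert basis. -/
def sqBasis (α : ℝ) : HilbertBasis (ℕ × ℕ) ℂ Fock :=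
  HilbertBasis.mkOfOrthogonalEqBot (v := fun x => sqOp α (fock x))
    (by
      have h := fock.orthonormal
      rw [orthonormal_iff_ite] at h ⊢
      intro x y
      rw [inner_sqOp_sqOp, h])
    (by
      rw [Submodule.eq_bot_iff]
      intro φ hφ
      have h : sqOp (-α) φ = 0 := by
        ext x
        rw [← inner_fock, ← inner_sqOp_left]
        exact (Submodule.mem_orthogonal _ _).mp hφ _ (Submodule.subset_span ⟨x, rfl⟩)
      rw [← sqOp_apply_neg α φ, h, map_zero])

theorem sqBasis_apply (α : ℝ) (x : ℕ × ℕ) : sqBasis α x = sqOp α (fock x) :=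
  congrFun (HilbertBasis.coe_mkOfOrthogonalEqBot _ _) x

theorem hasSum_inner_of_eigenvector (b : HilbertBasis (ℕ × ℕ) ℂ Fock) {A : Fock →L[ℂ] Fock}
    {w : ℕ × ℕ → ℂ} (h : ∀ x, A (b x) = w x • b x) (φ : Fock) :
    HasSum (fun x => w x * ((‖⟪b x, φ⟫_ℂ‖ ^ 2 : ℝ) : ℂ)) ⟪φ, A φ⟫_ℂ := by
  have h1 := (b.hasSum_repr φ).mapL ((innerSL ℂ φ).comp A)
  refine h1.congr_fun fun x => ?_
  rw [ContinuousLinearMap.comp_apply, innerSL_apply_apply, map_smul, h, inner_smul_right,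
    inner_smul_right, b.repr_apply_apply, Complex.ofReal_pow, ← Complex.conj_mul', inner_conj_symm]
  ring

/-- The output state is diagonal with positive eigenvalues in the basis `S(-ζ)|k m⟩`. -/
theorem exists_pos_eigenvalues (hS : 0 < nS) (hB : 0 < nB) (h0 : 0 < θ) (h1 : θ < 1) :
    ∃ w : ℕ × ℕ → ℝ, (∀ x, 0 < w x) ∧ ∀ x, outputState nS nB θ (eigVec nS nB θ x) =
      (w x : ℂ) • eigVec nS nB θ x := by
  obtain ⟨τ, t₁, t₂, ht₁, ht₂, h⟩ := exists_eigenvalues hS hB h0 h1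
  have hc := vacProb_pos hS hB
  have hsum := hasSum_inner_of_eigenvector (sqBasis (-ζ nS nB θ)) (A := outputState nS nB θ)
    (w := fun y => τ * ((t₁ ^ y.1 * t₂ ^ y.2 : ℝ) : ℂ))
    (fun x => by rw [sqBasis_apply]; exact h x) (fock (0, 0))
  rw [outputState_eq hS hB h0 h1, (summableKernel_outKer hS hB h0 h1).inner_opOf, outKer,
    gker_zero_zero, mul_one] at hsum
  -- The vacuum probability is `τ` times a sum of nonnegative reals. This excludes `τ = 0`, and
  -- below it forces `τ` to be a positive real.
  have hτ : τ ≠ 0 := by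
    rintro rfl
    simp only [zero_mul] at hsum
    exact hc.ne' (by exact_mod_cast hsum.unique hasSum_zero)
  set b := sqBasis (-ζ nS nB θ)
  have hs2 : HasSum (fun y : ℕ × ℕ => ((t₁ ^ y.1 * t₂ ^ y.2 * ‖⟪b y, fock (0, 0)⟫_ℂ‖ ^ 2 : ℝ) : ℂ))
      (τ⁻¹ * (vacProb nS nB : ℂ)) := by
    refine (hsum.mul_left τ⁻¹).congr_fun fun y => ?_
    push_cast
    field_simp
  have hre := Complex.hasSum_re hs2
  simp only [Complex.ofReal_re] at hre
  have hS' := hs2.unique (Complex.hasSum_ofReal.mpr hre)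
  set S := (τ⁻¹ * (vacProb nS nB : ℂ)).re
  have hS0 : 0 ≤ S := hre.nonneg fun y => by positivity
  have hne : τ⁻¹ * (vacProb nS nB : ℂ) ≠ 0 :=
    mul_ne_zero (inv_ne_zero hτ) (by exact_mod_cast hc.ne')
  have hS1 : 0 < S := by
    refine lt_of_le_of_ne hS0 fun he => hne ?_
    rw [hS', ← he, Complex.ofReal_zero]
  have hτ2 : τ = ((vacProb nS nB / S : ℝ) : ℂ) := by
    have : (S : ℂ) ≠ 0 := by exact_mod_cast hS1.ne'
    have hc' : (vacProb nS nB : ℂ) ≠ 0 := by exact_mod_cast hc.ne'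
    push_cast
    rw [← hS']
    field_simp
  refine ⟨fun y => vacProb nS nB / S * (t₁ ^ y.1 * t₂ ^ y.2), fun y => by positivity, fun y => ?_⟩
  rw [h y, hτ2]
  push_cast
  rfl

theorem inner_outputState_pos (hS : 0 < nS) (hB : 0 < nB) (h0 : 0 < θ) (h1 : θ < 1) {φ : Fock}
    (hφ : φ ≠ 0) : 0 < (⟪φ, outputState nS nB θ φ⟫_ℂ).re := by
  obtain ⟨w, hw, h⟩ := exists_pos_eigenvalues hS hB h0 h1
  have hsum := hasSum_inner_of_eigenvector (sqBasis (-ζ nS nB θ)) (A := outputState nS nB θ)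
    (w := fun y => (w y : ℂ)) (fun x => by rw [sqBasis_apply]; exact h x) φ
  have hre := Complex.hasSum_re hsum
  set b := sqBasis (-ζ nS nB θ)
  simp only [← Complex.ofReal_mul, Complex.ofReal_re] at hre
  obtain ⟨x, hx⟩ : ∃ x, ⟪b x, φ⟫_ℂ ≠ 0 := by
    by_contra! hall
    refine hφ (b.repr.injective ?_)
    ext x
    rw [b.repr_apply_apply, hall, map_zero]; rfl
  have hwx := hw x
  refine lt_of_lt_of_le ?_ (le_hasSum hre x fun y _ => by have := hw y; positivity)
  positivity

end

/-! ### Uniqueness of the symmetric logarithmic derivative -/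

theorem inner_graph_symm {A : Fock →ₗ.[ℂ] Fock} (hA : IsSelfAdjoint A) {φ ψ φ' ψ' : Fock}
    (h : (φ, ψ) ∈ A.graph) (h' : (φ', ψ') ∈ A.graph) : ⟪ψ, φ'⟫_ℂ = ⟪φ, ψ'⟫_ℂ := by
  have hf := LinearPMap.adjoint_isFormalAdjoint hA.dense_domain
  rw [LinearPMap.isSelfAdjoint_def.mp hA] at hf
  rw [LinearPMap.mem_graph_iff] at h h'
  obtain ⟨x, rfl, rfl⟩ := h
  obtain ⟨x', rfl, rfl⟩ := h'
  exact hf x x'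

/-- A self-adjoint operator is maximal symmetric: an extension `B` of `A` satisfies `B ≤ A† = A`. -/
theorem eq_of_graph_le {A B : Fock →ₗ.[ℂ] Fock} (hA : IsSelfAdjoint A) (hB : IsSelfAdjoint B)
    (h : A.graph ≤ B.graph) : B = A := by
  refine le_antisymm ?_ (LinearPMap.le_of_le_graph h)
  have hle : B ≤ A.adjoint := by
    refine LinearPMap.IsFormalAdjoint.le_adjoint hA.dense_domain fun x y => ?_
    exact inner_graph_symm hB (h (A.mem_graph x)) (B.mem_graph y)
  rwa [LinearPMap.isSelfAdjoint_def.mp hA] at hle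

/-- An SLD is determined on the eigenvectors of a strictly positive state. -/
theorem IsSLD.graph_eigenvector {σ : ℝ → Fock →L[ℂ] Fock} {θ : ℝ} {Λ Λ' : Fock →ₗ.[ℂ] Fock}
    (hΛ : IsSLD σ θ Λ) (hΛ' : IsSLD σ θ Λ') (b : HilbertBasis (ℕ × ℕ) ℂ Fock) {w : ℕ × ℕ → ℝ}
    (hw : ∀ x, 0 < w x) (hb : ∀ x, σ θ (b x) = (w x : ℂ) • b x) (y : ℕ × ℕ) :
    ∃ ψ, (b y, ψ) ∈ Λ.graph ∧ (b y, ψ) ∈ Λ'.graph := by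
  -- In the eigenbasis the SLD equation is `(w x + w y) ⟨x|M|y⟩ = 2 ⟨x|σ'|y⟩`; positivity of the
  -- eigenvalues makes it solvable for the matrix element.
  have main : ∀ {M : Fock →ₗ.[ℂ] Fock}, IsSLD σ θ M → ∃ L : Fock →L[ℂ] Fock,
      HasDerivAt σ ((1 / 2 : ℂ) • (L + star L)) θ ∧ (∀ y, (b y, (w y : ℂ)⁻¹ • L (b y)) ∈ M.graph) ∧
      ∀ x y, ((w x + w y : ℝ) : ℂ) * ⟪b x, (w y : ℂ)⁻¹ • L (b y)⟫_ℂ = ⟪b x, (L + star L) (b y)⟫_ℂ := by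
    intro M hM
    obtain ⟨L, hL, hd⟩ := hM.equation
    have hw' : ∀ y, (w y : ℂ) ≠ 0 := fun y => by exact_mod_cast (hw y).ne'
    have hg : ∀ y, (b y, (w y : ℂ)⁻¹ • L (b y)) ∈ M.graph := by
      intro y
      obtain ⟨h, e⟩ := hL (b y)
      have h1 : (σ θ (b y), L (b y)) ∈ M.graph := by
        rw [← e]; exact M.mem_graph ⟨_, h⟩
      have h2 := M.graph.smul_mem (w y : ℂ)⁻¹ h1
      rwa [Prod.smul_mk, hb, smul_smul, inv_mul_cancel₀ (hw' y), one_smul] at h2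
    refine ⟨L, hd, hg, fun x y => ?_⟩
    have hs := inner_graph_symm hM.selfAdjoint (hg x) (hg y)
    rw [inner_smul_left, map_inv₀, Complex.conj_ofReal] at hs
    rw [add_apply, inner_add_right, ContinuousLinearMap.star_eq_adjoint,
      ContinuousLinearMap.adjoint_inner_right, Complex.ofReal_add, add_mul, ← hs]
    nth_rewrite 2 [hs]
    rw [inner_smul_right, mul_inv_cancel_left₀ (hw' x), mul_inv_cancel_left₀ (hw' y), add_comm]
  obtain ⟨L, hd, hg, hm⟩ := main hΛ
  obtain ⟨L', hd', hg', hm'⟩ := main hΛ'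
  have hLL : L + star L = L' + star L' := by
    have h := hd.unique hd'
    have h2 : (1 / 2 : ℂ) ≠ 0 := by norm_num
    exact smul_right_injective _ h2 h
  refine ⟨_, hg y, ?_⟩
  have e : (w y : ℂ)⁻¹ • L (b y) = (w y : ℂ)⁻¹ • L' (b y) := by
    refine b.repr.injective ?_
    ext x
    rw [b.repr_apply_apply, b.repr_apply_apply]
    have hne : ((w x + w y : ℝ) : ℂ) ≠ 0 := by exact_mod_cast (add_pos (hw x) (hw y)).ne'
    refine mul_left_cancel₀ hne ?_
    rw [hm, hm', hLL]
  rw [e]; exact hg' y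

section

variable {nS nB θ : ℝ}

theorem SqueezeRel.smul {ω C D E F C' D' E' F' : ℝ} (h : SqueezeRel ω C D E F C' D' E' F') (c : ℝ) :
    SqueezeRel ω (c * C) (c * D) (c * E) (c * F) (c * C') (c * D') (c * E') (c * F') := by
  obtain ⟨rfl, rfl, rfl, rfl⟩ := h
  constructor <;> ring

theorem squeezeRel_sld (hS : 0 < nS) (hB : 0 < nB) (h0 : 0 < θ) (h1 : θ < 1) :
    SqueezeRel (ζ nS nB θ) (-(1 / θ) * C nS nB θ) (-(1 / θ) * D nS nB θ) (-(1 / θ) * E nS nB θ)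
      (-(1 / θ) * F nS nB θ) (sldFst nS nB θ) (sldSnd nS nB θ) (sldCross nS nB θ)
      (sldFst nS nB θ) := by
  have h := (squeezeRel_ζ hS hB h0 h1).smul (-(1 / θ))
  have e : ∀ x : ℝ, -(1 / θ) * (-θ * x) = x := fun x => by field_simp
  simpa only [e] using h

/-- Any SLD agrees with `logDeriv` on the eigenvectors of `σ`. These span the image under `S(-ζ)` of
a core, hence a core of `logDeriv`, so closedness of the other operator gives an inclusion of
graphs, and self-adjointness turns it into equality. -/
theorem IsSLD.eq_logDeriv (hS : 0 < nS) (hB : 0 < nB) (h0 : 0 < θ) (h1 : θ < 1)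
    {Λ : Fock →ₗ.[ℂ] Fock} (hΛ : IsSLD (outputState nS nB) θ Λ) : Λ = logDeriv nS nB θ := by
  have hL := isSLD_logDeriv hS hB h0 h1
  obtain ⟨w, hw, hb⟩ := exists_pos_eigenvalues hS hB h0 h1
  have hrel := squeezeRel_sld hS hB h0 h1
  refine eq_of_graph_le hL.selfAdjoint hΛ.selfAdjoint ?_
  have hsq := sqOp_neg_apply (ζ nS nB θ)
  set S := sqOp (ζ nS nB θ)
  set S' := sqOp (-ζ nS nB θ) with hS'
  set X := finQuad ((-(1 / θ) * C nS nB θ : ℝ) : ℂ) ((-(1 / θ) * D nS nB θ : ℝ) : ℂ)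
    ((-(1 / θ) * E nS nB θ : ℝ) : ℂ) ((-(1 / θ) * E nS nB θ : ℝ) : ℂ)
    ((-(1 / θ) * F nS nB θ : ℝ) : ℂ) with hX
  have hcore : ∀ v : FinFock, (S' (incl v), S' (incl (X v))) ∈ Λ.graph := by
    intro v
    induction v using Finsupp.induction_linear with
    | zero => simp only [map_zero]; exact Λ.graph.zero_mem
    | add v v' hv hv' =>
      have := Λ.graph.add_mem hv hv'
      simpa only [map_add, Prod.mk_add_mk] using this
    | single y c =>
      obtain ⟨ψ, hψ, hψ'⟩ := hL.graph_eigenvector hΛ (sqBasis (-ζ nS nB θ)) hw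
        (fun x => by rw [sqBasis_apply]; exact hb x) y
      have e : (⇑(S' (incl (X (Finsupp.single y 1)))) : Seq) =
          quad (sldFst nS nB θ : ℂ) (sldSnd nS nB θ : ℂ) (sldCross nS nB θ : ℂ)
            (sldCross nS nB θ : ℂ) (sldFst nS nB θ : ℂ) ⇑(S' (incl (Finsupp.single y 1))) :=
        quad_sqOp hrel.symm (by rw [coe_incl, coe_incl, coe_finQuad])
      rw [logDeriv, mem_graph_maxOp, sqBasis_apply] at hψ
      rw [incl_single, one_smul, ← hψ] at e
      have e2 : S' (incl (X (Finsupp.single y 1))) = ψ := lp.ext e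
      have es : (Finsupp.single y c : FinFock) = c • Finsupp.single y 1 := by
        rw [Finsupp.smul_single, smul_eq_mul, mul_one]
      have := Λ.graph.smul_mem c hψ'
      rw [sqBasis_apply] at this
      rw [es, map_smul X, map_smul incl, map_smul incl, map_smul S', map_smul S', e2, incl_single,
        one_smul]
      exact this
  have hcl : IsClosed (Λ.graph : Set (Fock × Fock)) := hΛ.selfAdjoint.isClosed
  have hclosure : ∀ z ∈ (toPMap X).graph.topologicalClosure, (S' z.1, S' z.2) ∈ Λ.graph := by
    intro z hz
    have hc : Continuous fun z : Fock × Fock => (S' z.1, S' z.2) := by fun_prop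
    have hsub : ((toPMap X).graph : Set (Fock × Fock)) ⊆
        (fun z : Fock × Fock => (S' z.1, S' z.2)) ⁻¹' (Λ.graph : Set (Fock × Fock)) := by
      intro z hz
      obtain ⟨v, rfl⟩ := (mem_graph_toPMap _ z).mp hz
      exact hcore v
    exact closure_minimal hsub (hcl.preimage hc) hz
  rintro ⟨φ, ψ⟩ h
  rw [logDeriv, mem_graph_maxOp] at h
  have h2 := hclosure (S φ, S ψ) (by
    rw [closure_graph_finQuad, mem_graph_maxOp]
    exact quad_sqOp hrel h)
  simpa only [hsq] using h2

end

/-! ### Eigenvectors of the symmetric logarithmic derivative -/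

section

variable {nS nB θ : ℝ}

/-- The discriminant condition leaves `C + D > 2|E|` or `C + D < -2|E|`. Being a cone condition, the
second would make the rotated sum nonpositive, whereas both diagonal coefficients of `Λ` are
negative. So the absolute value in `lam` is `C + D`. -/
theorem C_add_D_pos (hS : 0 < nS) (hB : 0 < nB) (h0 : 0 < θ) (h1 : θ < 1)
    (h : 4 * E nS nB θ ^ 2 < (C nS nB θ + D nS nB θ) ^ 2) : 0 < C nS nB θ + D nS nB θ := by
  have hrel := squeezeRel_ζ hS hB h0 h1
  have hb : 0 < 1 + nB - θ := by linarith
  have hx : sldFst nS nB θ < 0 := by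
    rw [sldFst_eq hS hB h0 h1, neg_lt_zero]
    have := two_mul_N_pos hS hB h1
    positivity
  have hy : sldSnd nS nB θ < 0 := by
    rw [sldSnd_eq]
    have : 0 < 1 / (1 + nB - θ) := by positivity
    linarith
  have hP : 0 < -θ * sldFst nS nB θ + -θ * sldSnd nS nB θ := by nlinarith
  rw [hrel.fst, hrel.snd] at hP
  by_contra hneg
  have hneg' : 0 ≤ -(C nS nB θ + D nS nB θ) := by linarith
  have hE : |2 * E nS nB θ| < -(C nS nB θ + D nS nB θ) := by
    refine abs_lt_of_sq_lt_sq ?_ hneg'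
    nlinarith
  obtain ⟨hE1, hE2⟩ := abs_lt.mp hE
  have hc := Real.cosh_pos (ζ nS nB θ)
  have hcs := Real.cosh_sq (ζ nS nB θ)
  set c := Real.cosh (ζ nS nB θ)
  set s := Real.sinh (ζ nS nB θ)
  nlinarith [mul_nonneg (sq_nonneg (c + s)) (show 0 ≤ -(C nS nB θ + D nS nB θ) + 2 * E nS nB θ by linarith),
    mul_nonneg (sq_nonneg (c - s)) (show 0 ≤ -(C nS nB θ + D nS nB θ) - 2 * E nS nB θ by linarith)]

theorem disc_pos (h : 4 * E nS nB θ ^ 2 < (C nS nB θ + D nS nB θ) ^ 2) : 0 < disc nS nB θ :=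
  Real.sqrt_pos.mpr (by linarith)

theorem disc_sq (h : 4 * E nS nB θ ^ 2 < (C nS nB θ + D nS nB θ) ^ 2) :
    disc nS nB θ ^ 2 = (C nS nB θ + D nS nB θ) ^ 2 - 4 * E nS nB θ ^ 2 :=
  Real.sq_sqrt (by linarith)

/-- The definition of `lam` says `cosh 2λ = (C + D) / disc` and `sinh 2λ = 2E / disc`, the
hyperbolic rotation that takes `(C + D, 2E)` to `(disc, 0)`. -/
theorem squeezeRel_lam (hS : 0 < nS) (hB : 0 < nB) (h0 : 0 < θ) (h1 : θ < 1)
    (h : 4 * E nS nB θ ^ 2 < (C nS nB θ + D nS nB θ) ^ 2) :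
    SqueezeRel (lam nS nB θ) (C nS nB θ) (D nS nB θ) (E nS nB θ) (F nS nB θ)
      (T₁ nS nB θ) (T₂ nS nB θ) 0 (F' nS nB θ) := by
  have hpos := C_add_D_pos hS hB h0 h1 h
  have hd := disc_pos h
  have hd2 := disc_sq h
  have hE : |2 * E nS nB θ| < C nS nB θ + D nS nB θ :=
    abs_lt_of_sq_lt_sq (by nlinarith) hpos.le
  obtain ⟨hE1, hE2⟩ := abs_lt.mp hE
  have hnum : 0 < 2 * E nS nB θ + (C nS nB θ + D nS nB θ) := by linarith
  have e1 : Real.exp (2 * lam nS nB θ) =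
      (2 * E nS nB θ + (C nS nB θ + D nS nB θ)) / disc nS nB θ := by
    rw [lam, abs_of_pos hpos, ← mul_assoc, mul_one_div, div_self two_ne_zero, one_mul,
      Real.exp_log (by positivity)]
  have e2 : Real.exp (-(2 * lam nS nB θ)) =
      ((C nS nB θ + D nS nB θ) - 2 * E nS nB θ) / disc nS nB θ := by
    rw [Real.exp_neg, e1, inv_div, div_eq_div_iff hnum.ne' hd.ne']
    linear_combination hd2
  have hch : Real.cosh (2 * lam nS nB θ) = (C nS nB θ + D nS nB θ) / disc nS nB θ := by
    rw [Real.cosh_eq, e1, e2]; ring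
  have hsh : Real.sinh (2 * lam nS nB θ) = 2 * E nS nB θ / disc nS nB θ := by
    rw [Real.sinh_eq, e1, e2]; ring
  rw [Real.cosh_two_mul] at hch
  rw [Real.sinh_two_mul] at hsh
  have hcs := Real.cosh_sq (lam nS nB θ)
  have f1 : (C nS nB θ + D nS nB θ) * ((C nS nB θ + D nS nB θ) / disc nS nB θ) -
      2 * E nS nB θ * (2 * E nS nB θ / disc nS nB θ) = disc nS nB θ := by
    field_simp
    linear_combination -hd2
  have f2 : disc nS nB θ * ((C nS nB θ + D nS nB θ) / disc nS nB θ) = C nS nB θ + D nS nB θ :=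
    mul_div_cancel₀ _ hd.ne'
  rw [← hch, ← hsh] at f1
  rw [← hch] at f2
  have f3 : disc nS nB θ * (2 * Real.sinh (lam nS nB θ) * Real.cosh (lam nS nB θ)) =
      2 * E nS nB θ := by
    rw [hsh]; exact mul_div_cancel₀ _ hd.ne'
  rw [F', T₁, T₂]
  set c := Real.cosh (lam nS nB θ)
  set s := Real.sinh (lam nS nB θ)
  constructor
  · linear_combination (-(1 / 2)) * f1 - (1 / 2) * (C nS nB θ - D nS nB θ) * hcs
  · linear_combination (-(1 / 2)) * f1 + (1 / 2) * (C nS nB θ - D nS nB θ) * hcs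
  · linear_combination (1 / 2) * (c ^ 2 + s ^ 2) * f3 - s * c * f2
  · linear_combination (-(1 / 2)) * f1 - (1 / 2) * f2 +
      (1 / 2) * (disc nS nB θ + (C nS nB θ + D nS nB θ)) * hcs

theorem quad_sqOp_fock {ω C D E F T₁ T₂ F' : ℝ} (h : SqueezeRel ω C D E F T₁ T₂ 0 F')
    (x : ℕ × ℕ) : (⇑(((F' + T₁ * x.1 + T₂ * x.2 : ℝ) : ℂ) • sqOp ω (fock x)) : Seq) =
      quad C D E E F ⇑(sqOp ω (fock x)) := by
  rw [← map_smul]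
  refine quad_sqOp h ?_
  ext ⟨r, m⟩
  rw [quad_apply, lp.coeFn_smul, Pi.smul_apply, fock_apply, smul_eq_mul]
  by_cases hx : (r, m) = x
  · subst hx; push_cast; simp; ring
  · simp [hx]

/-- The eigenvalues of the symmetric logarithmic derivative. -/
def sldEig (nS nB θ : ℝ) (x : ℕ × ℕ) : ℝ :=
  -((F' nS nB θ + T₁ nS nB θ * x.1 + T₂ nS nB θ * x.2) / θ)

theorem squeezedFock_eq (nS nB θ : ℝ) (x : ℕ × ℕ) :
    squeezedFock nS nB θ x = sqBasis (ω nS nB θ) x := by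
  rw [squeezedFock, squeezer_eq, sqBasis_apply]

theorem quad_squeezedFock (hS : 0 < nS) (hB : 0 < nB) (h0 : 0 < θ) (h1 : θ < 1)
    (h : 4 * E nS nB θ ^ 2 < (C nS nB θ + D nS nB θ) ^ 2) (x : ℕ × ℕ) :
    (⇑((sldEig nS nB θ x : ℂ) • squeezedFock nS nB θ x) : Seq) =
      quad (sldFst nS nB θ : ℂ) (sldSnd nS nB θ : ℂ) (sldCross nS nB θ : ℂ) (sldCross nS nB θ : ℂ)
        (sldFst nS nB θ : ℂ) ⇑(squeezedFock nS nB θ x) := by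
  have hl := (squeezeRel_lam hS hB h0 h1 h).smul (-(1 / θ))
  rw [mul_zero] at hl
  have h2 := quad_sqOp (squeezeRel_sld hS hB h0 h1).symm (quad_sqOp_fock hl x)
  have e : sldEig nS nB θ x = -(1 / θ) * F' nS nB θ + -(1 / θ) * T₁ nS nB θ * x.1 +
      -(1 / θ) * T₂ nS nB θ * x.2 := by rw [sldEig]; ring
  -- By the group law `S(-ζ) S(λ) = S(λ - ζ)`, which is where `ω` comes from.
  rw [map_smul, sqOp_comp, neg_add_eq_sub, ← e] at h2
  rw [squeezedFock, squeezer_eq, ω]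
  exact h2

theorem mem_graph_squeezedFock (hS : 0 < nS) (hB : 0 < nB) (h0 : 0 < θ) (h1 : θ < 1)
    (h : 4 * E nS nB θ ^ 2 < (C nS nB θ + D nS nB θ) ^ 2) (x : ℕ × ℕ) :
    (squeezedFock nS nB θ x, (sldEig nS nB θ x : ℂ) • squeezedFock nS nB θ x) ∈
      (logDeriv nS nB θ).graph := by
  rw [logDeriv, mem_graph_maxOp]
  exact quad_squeezedFock hS hB h0 h1 h x

/-! ### Attainment of the quantum Cramér-Rao bound -/

theorem hasDerivAt_outcomeProb {σ : ℝ → Fock →L[ℂ] Fock} {θ : ℝ} {A : Fock →L[ℂ] Fock}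
    (hd : HasDerivAt σ A θ) (s : ℕ × ℕ → Fock) (x : ℕ × ℕ) :
    HasDerivAt (outcomeProb σ s x) (⟪s x, A (s x)⟫_ℂ).re θ := by
  let l : (Fock →L[ℂ] Fock) →L[ℂ] ℂ := (innerSL ℂ (s x)).comp (ContinuousLinearMap.apply ℂ Fock (s x))
  have h := (l.restrictScalars ℝ).hasFDerivAt.comp_hasDerivAt θ hd
  exact Complex.reCLM.hasFDerivAt.comp_hasDerivAt θ h

theorem inner_outputState_eq_re (hS : 0 < nS) (hB : 0 < nB) (h0 : 0 < θ) (h1 : θ < 1) (φ : Fock) :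
    ⟪φ, outputState nS nB θ φ⟫_ℂ = ((⟪φ, outputState nS nB θ φ⟫_ℂ).re : ℂ) := by
  obtain ⟨w, hw, h⟩ := exists_pos_eigenvalues hS hB h0 h1
  have hsum := hasSum_inner_of_eigenvector (sqBasis (-ζ nS nB θ)) (A := outputState nS nB θ)
    (w := fun y => (w y : ℂ)) (fun x => by rw [sqBasis_apply]; exact h x) φ
  simp only [← Complex.ofReal_mul] at hsum
  have hre := Complex.hasSum_re hsum
  simp only [Complex.ofReal_re] at hre
  exact hsum.unique (Complex.hasSum_ofReal.mpr hre)

/-- The kernel of `Λ² σ`. -/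
def sldSqKer (nS nB θ : ℝ) (x y : ℕ × ℕ) : ℂ :=
  quad (sldFst nS nB θ : ℂ) (sldSnd nS nB θ : ℂ) (sldCross nS nB θ : ℂ) (sldCross nS nB θ : ℂ)
    (sldFst nS nB θ : ℂ) (fun x' => sldKer nS nB θ x' y) x

theorem logDeriv_sq_opOf (hS : 0 < nS) (hB : 0 < nB) (h0 : 0 < θ) (h1 : θ < 1) (φ : Fock) :
    ∃ h : outputState nS nB θ φ ∈ (logDeriv nS nB θ).domain,
      ∃ h' : logDeriv nS nB θ ⟨outputState nS nB θ φ, h⟩ ∈ (logDeriv nS nB θ).domain,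
        logDeriv nS nB θ ⟨logDeriv nS nB θ ⟨outputState nS nB θ φ, h⟩, h'⟩ =
          opOf (sldSqKer nS nB θ) φ := by
  obtain ⟨h, e⟩ := logDeriv_opOf hS hB h0 h1 φ
  have hr : RapidDecay wt (fun y x => sldKer nS nB θ x y) :=
    (quad_opOf (rapidDecay_outKer_self hS hB h0 h1) _ _ _ _ _).1
  have h2 := (quad_opOf hr (sldFst nS nB θ : ℂ)
    (sldSnd nS nB θ : ℂ) (sldCross nS nB θ : ℂ) (sldCross nS nB θ : ℂ) (sldFst nS nB θ : ℂ)).2 φ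
  rw [← e] at h2
  exact ⟨h, mem_maxOp_domain h2, maxOp_apply h2⟩

/-- Self-adjointness moves `Λ` from `σ s` to the eigenvector `s`, which avoids any question about
the domain of `σ Λ`. -/
theorem inner_squeezedFock_sldKer (hS : 0 < nS) (hB : 0 < nB) (h0 : 0 < θ) (h1 : θ < 1)
    (h : 4 * E nS nB θ ^ 2 < (C nS nB θ + D nS nB θ) ^ 2) (x : ℕ × ℕ) :
    ⟪squeezedFock nS nB θ x, opOf (sldKer nS nB θ) (squeezedFock nS nB θ x)⟫_ℂ =
      ((sldEig nS nB θ x * outcomeProb (outputState nS nB) (squeezedFock nS nB θ) x θ : ℝ) : ℂ) := by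
  obtain ⟨hd, e⟩ := logDeriv_opOf hS hB h0 h1 (squeezedFock nS nB θ x)
  have hg := (logDeriv nS nB θ).mem_graph ⟨_, hd⟩
  rw [e] at hg
  rw [← inner_graph_symm (isSLD_logDeriv hS hB h0 h1).selfAdjoint
    (mem_graph_squeezedFock hS hB h0 h1 h x) hg, inner_smul_left, Complex.conj_ofReal,
    inner_outputState_eq_re hS hB h0 h1, Complex.ofReal_mul, outcomeProb]

theorem inner_squeezedFock_sldSqKer (hS : 0 < nS) (hB : 0 < nB) (h0 : 0 < θ) (h1 : θ < 1)
    (h : 4 * E nS nB θ ^ 2 < (C nS nB θ + D nS nB θ) ^ 2) (x : ℕ × ℕ) :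
    ⟪squeezedFock nS nB θ x, opOf (sldSqKer nS nB θ) (squeezedFock nS nB θ x)⟫_ℂ =
      ((outcomeProb (outputState nS nB) (squeezedFock nS nB θ) x θ * sldEig nS nB θ x ^ 2 : ℝ) : ℂ) := by
  obtain ⟨hd, hd', e⟩ := logDeriv_sq_opOf hS hB h0 h1 (squeezedFock nS nB θ x)
  obtain ⟨_, e'⟩ := logDeriv_opOf hS hB h0 h1 (squeezedFock nS nB θ x)
  have hg := (logDeriv nS nB θ).mem_graph ⟨_, hd'⟩
  rw [e] at hg
  simp only [e'] at hg
  rw [← inner_graph_symm (isSLD_logDeriv hS hB h0 h1).selfAdjoint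
    (mem_graph_squeezedFock hS hB h0 h1 h x) hg, inner_smul_left, Complex.conj_ofReal,
    inner_squeezedFock_sldKer hS hB h0 h1 h]
  push_cast
  ring

theorem squeezedFock_ne_zero (nS nB θ : ℝ) (x : ℕ × ℕ) : squeezedFock nS nB θ x ≠ 0 := by
  rw [squeezedFock_eq]
  exact (sqBasis (ω nS nB θ)).orthonormal.ne_zero x

theorem outcomeProb_pos (hS : 0 < nS) (hB : 0 < nB) (h0 : 0 < θ) (h1 : θ < 1) (x : ℕ × ℕ) :
    0 < outcomeProb (outputState nS nB) (squeezedFock nS nB θ) x θ :=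
  inner_outputState_pos hS hB h0 h1 (squeezedFock_ne_zero nS nB θ x)

/-- Both halves of `(Λσ + σΛ) / 2` contribute the eigenvalue times the probability, so the score at
an outcome is the eigenvalue of `Λ`. -/
theorem hasDerivAt_outcomeProb_squeezedFock (hS : 0 < nS) (hB : 0 < nB) (h0 : 0 < θ) (h1 : θ < 1)
    (h : 4 * E nS nB θ ^ 2 < (C nS nB θ + D nS nB θ) ^ 2) (x : ℕ × ℕ) :
    HasDerivAt (outcomeProb (outputState nS nB) (squeezedFock nS nB θ) x)
      (sldEig nS nB θ x * outcomeProb (outputState nS nB) (squeezedFock nS nB θ) x θ) θ := by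
  refine (hasDerivAt_outcomeProb (hasDerivAt_sldKer hS hB h0 h1) _ x).congr_deriv ?_
  rw [smul_apply, add_apply, inner_smul_right, inner_add_right,
    ContinuousLinearMap.star_eq_adjoint, ContinuousLinearMap.adjoint_inner_right, ← inner_conj_symm
    (opOf (sldKer nS nB θ) (squeezedFock nS nB θ x)), inner_squeezedFock_sldKer hS hB h0 h1 h,
    Complex.conj_ofReal, ← two_mul, ← mul_assoc, one_div, inv_mul_cancel₀ two_ne_zero, one_mul,
    Complex.ofReal_re]

/-- Since `T₁ + T₂ = disc > 0`, the eigenvalues at `(0, 0)`, `(1, 0)` and `(0, 1)` cannot all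
vanish. As all outcome probabilities are positive, the Fisher information is then positive. -/
theorem exists_sldEig_ne_zero (h0 : 0 < θ)
    (h : 4 * E nS nB θ ^ 2 < (C nS nB θ + D nS nB θ) ^ 2) : ∃ x, sldEig nS nB θ x ≠ 0 := by
  by_contra! hall
  have e0 := hall (0, 0)
  have e1 := hall (1, 0)
  have e2 := hall (0, 1)
  have hd := disc_pos h
  simp only [sldEig, neg_eq_zero, div_eq_zero_iff, h0.ne', or_false, Nat.cast_zero, Nat.cast_one,
    mul_zero, mul_one, add_zero] at e0 e1 e2
  have : T₁ nS nB θ + T₂ nS nB θ = disc nS nB θ := by rw [T₁, T₂]; ring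
  linarith

theorem achievesQuantumCRB_logDeriv (hS : 0 < nS) (hB : 0 < nB) (h0 : 0 < θ) (h1 : θ < 1)
    (h : 4 * E nS nB θ ^ 2 < (C nS nB θ + D nS nB θ) ^ 2) :
    AchievesQuantumCRB (outputState nS nB) θ (logDeriv nS nB θ)
    (squeezedFock nS nB θ) where
  isBasis := ⟨sqBasis (ω nS nB θ), fun x => (squeezedFock_eq nS nB θ x).symm⟩
  differentiable x := (hasDerivAt_outcomeProb_squeezedFock hS hB h0 h1 h x).differentiableAt
  fisher_eq := by
    have hr : SummableKernel (sldSqKer nS nB θ) :=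
      (quad_opOf (quad_opOf (rapidDecay_outKer_self hS hB h0 h1) _ _ _ _ _).1 _ _ _ _ _).1.summableKernel
    obtain ⟨τ, hτ⟩ := hr.exists_trace
    have hp := outcomeProb_pos hS hB h0 h1
    -- Evaluated in the measured basis, the trace of `Λ² σ` is termwise the classical Fisher sum.
    have hsum := hτ (sqBasis (ω nS nB θ))
    simp only [← squeezedFock_eq, inner_squeezedFock_sldSqKer hS hB h0 h1 h] at hsum
    have hre := Complex.hasSum_re hsum
    simp only [Complex.ofReal_re] at hre
    have hτre : τ = (τ.re : ℂ) := hsum.unique (Complex.hasSum_ofReal.mpr hre)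
    refine ⟨τ.re, ?_, ⟨opOf (sldSqKer nS nB θ), logDeriv_sq_opOf hS hB h0 h1, ?_⟩, ?_⟩
    · obtain ⟨x, hx⟩ := exists_sldEig_ne_zero h0 h
      have hpx := hp x
      refine lt_of_lt_of_le ?_ (le_hasSum hre x fun y _ => by have := hp y; positivity)
      positivity
    · intro b
      rw [← hτre]; exact hτ b
    · refine hre.congr_fun fun x => ?_
      rw [((hasDerivAt_outcomeProb_squeezedFock hS hB h0 h1 h x).log (hp x).ne').deriv,
        mul_div_cancel_right₀ _ (hp x).ne']

end

end

end TMSV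

theorem mainTheorem2 :
    -- for real `ω` the two-mode squeezer `exp (ω (a_R a_I - a_R† a_I†))` exists and is unique
    (∀ ω : ℝ, ∃! S : TMSV.Fock →L[ℂ] TMSV.Fock, TMSV.IsTwoModeSqueezer (ω : ℂ) S) ∧
    ∀ nS nB θ : ℝ, 0 < nS → 0 < nB → 0 < θ → θ < 1 →
      -- the output state exists as a bounded operator
      TMSV.IsOutputState nS nB θ (TMSV.outputState nS nB θ) ∧
      -- `-(1/θ) S(ζ)† K S(ζ)` is its symmetric logarithmic derivative, and the only one
      TMSV.IsSLD (TMSV.outputState nS nB) θ (TMSV.sld nS nB θ) ∧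
      (∀ Λ : TMSV.Fock →ₗ.[ℂ] TMSV.Fock,
        TMSV.IsSLD (TMSV.outputState nS nB) θ Λ → Λ = TMSV.sld nS nB θ) ∧
      (4 * TMSV.E nS nB θ ^ 2 < (TMSV.C nS nB θ + TMSV.D nS nB θ) ^ 2 →
        -- the squeezed Fock states are eigenvectors
        (∀ k m : ℕ, ∃ h : TMSV.squeezedFock nS nB θ (k, m) ∈ (TMSV.sld nS nB θ).domain,
          TMSV.sld nS nB θ ⟨TMSV.squeezedFock nS nB θ (k, m), h⟩ =
            ((-((TMSV.F' nS nB θ + TMSV.T₁ nS nB θ * k + TMSV.T₂ nS nB θ * m) / θ) : ℝ) : ℂ) •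
              TMSV.squeezedFock nS nB θ (k, m)) ∧
        -- measuring in this basis achieves the quantum Cramér-Rao bound
        TMSV.AchievesQuantumCRB (TMSV.outputState nS nB) θ (TMSV.sld nS nB θ)
          (TMSV.squeezedFock nS nB θ)) := by
  refine ⟨TMSV.existsUnique_squeezer, fun nS nB θ hS hB h0 h1 => ?_⟩
  rw [TMSV.sld_eq hS hB h0 h1]
  refine ⟨TMSV.isOutputState_outputState hS hB h0 h1, TMSV.isSLD_logDeriv hS hB h0 h1,
    fun Λ hΛ => hΛ.eq_logDeriv hS hB h0 h1, fun h => ⟨fun k m => ?_,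
      TMSV.achievesQuantumCRB_logDeriv hS hB h0 h1 h⟩⟩
  have hq := TMSV.quad_squeezedFock hS hB h0 h1 h (k, m)
  exact ⟨TMSV.mem_maxOp_domain hq, TMSV.maxOp_apply hq⟩
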